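/- Let $\rho,\mu_1,\mu_2:\mathbb R\to\mathbb R$ be $1$-periodic, piecewise continuous and strictly positive (the one-sided limits at the discontinuities being strictly positive as well). Fix a real Floquet parameter $K$. For real $\kappa$ (with $\kappa=k^2$) let $\mathcal A_K(\kappa)$ be the operator $$\mathcal A_K u=-\frac1\rho(\mu_1u')'+\kappa\,\frac{\mu_2}{\rho}\,u$$ on the functions $u:[0,1]\to\mathbb C$ such that $u$ and $\mu_1u'$ are absolutely continuous on $[0,1]$ and $u(1)=e^{iK}u(0)$, $(\mu_1u')(1)=e^{iK}(\mu_1u')(0)$. Let $\omega_1^2(\kappa)\le\omega_2^2(\kappa)\le\dots$ be its eigenvalues in increasing order, repeated according to multiplicity, and for $k\ge 0$ let $\omega_n(k)=\sqrt{\omega_n^2(k^2)}$ be the dispersion branches. 1. For every $n$, the function $k\mapsto\omega_n(k)$ is strictly increasing on $k>0$. 2. For every $n$ and every $\kappa\ge0$ at which $\omega_n^2(\kappa)$ is a simple eigenvalue, with any eigenfunction $u_n$, the function $\omega_n^2$ is differentiable at $\kappa$ and $$\frac{d\omega_n^2}{d(k^2)}=\frac{\int_0^1\mu_2|u_n|^2\,dy}{\int_0^1\rho|u_n|^2\,dy}.$$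 3. At multiple eigenvalues the formula holds along analytic branches: there are functions $\Lambda_1,\Lambda_2,\dots$ of $\kappa$, real analytic in a neighbourhood of $[0,\infty)$, such that for every $\kappa\ge0$ the sequence $(\Lambda_n(\kappa))_n$ is a rearrangement of $(\omega_n^2(\kappa))_n$, and for every $\kappa\ge0$ there are eigenfunctions $u_n$ of $\mathcal A_K(\kappa)$ for $\Lambda_n(\kappa)$, pairwise orthogonal in $L^2_\rho(0,1)$, with $$\Lambda_n'(\kappa)=\frac{\int_0^1\mu_2|u_n|^2\,dy}{\int_0^1\rho|u_n|^2\,dy}\qquad\text{for all } n.$$ Moreover every branch $k\mapsto\sqrt{\Lambda_n(k^2)}$ is strictly increasing on $k>0$. -/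

import Mathlib

open MeasureTheory Filter Topology Set

noncomputable section

namespace FloquetSH

/-- A material coefficient: a `1`-periodic, strictly positive, piecewise continuous real function.
Piecewise continuity: finitely many discontinuities per period, with one-sided limits at every
point; strict positivity is understood to hold for these limits as well. -/
structure IsCoefficient (f : ℝ → ℝ) : Prop where
  periodic : Function.Periodic f 1
  pos : ∀ y, 0 < f y
  finite_disc : {y ∈ Icc (0 : ℝ) 1 | ¬ ContinuousAt f y}.Finite
  left_lim : ∀ y, ∃ l, 0 < l ∧ Tendsto f (𝓝[<] y) (𝓝 l)
  right_lim : ∀ y, ∃ l, 0 < l ∧ Tendsto f (𝓝[>] y) (𝓝 l)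

/-- `u` lies in the space `D`: both `u` and `p = μ₁ u'` are absolutely continuous on `[0,1]`.
The absolutely continuous function `p` is the quasi-derivative; it is determined by `u`
on `[0,1]`, whatever the values of `μ₁` at its points of discontinuity. -/
structure MemD (μ₁ : ℝ → ℝ) (u p : ℝ → ℂ) : Prop where
  ac_u : AbsolutelyContinuousOnInterval u 0 1
  ac_p : AbsolutelyContinuousOnInterval p 0 1
  quasi_deriv : ∀ᵐ y ∂(volume.restrict (Icc (0 : ℝ) 1)), p y = (μ₁ y : ℂ) * deriv u y

/-- `u` lies in the domain `D_K`: it lies in `D` and satisfies the quasi-periodic boundary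
conditions `u(1) = e^{iK} u(0)`, `(μ₁ u')(1) = e^{iK} (μ₁ u')(0)`. -/
structure MemDK (μ₁ : ℝ → ℝ) (K : ℝ) (u p : ℝ → ℂ) : Prop extends MemD μ₁ u p where
  bc_u : u 1 = Complex.exp (Complex.I * K) * u 0
  bc_p : p 1 = Complex.exp (Complex.I * K) * p 0

/-- The differential expression `𝓐 u = -(1/ρ) (μ₁ u')' + κ (μ₂/ρ) u`, where `κ = k²` and
`p = μ₁ u'`. -/
def opA (ρ μ₂ : ℝ → ℝ) (κ : ℝ) (u p : ℝ → ℂ) (y : ℝ) : ℂ :=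
  -(1 / (ρ y : ℂ)) * deriv p y + (κ : ℂ) * ((μ₂ y : ℂ) / (ρ y : ℂ)) * u y

/-- `u` is an eigenfunction of the operator `𝓐_K` (at `k² = κ`) with eigenvalue `ν`: a function
in `D_K`, not identically zero on `[0,1]`, with `𝓐 u = ν u` almost everywhere on `[0,1]`.
Only the values of `u` on `[0,1]` are relevant. -/
def IsEigenfunction (ρ μ₁ μ₂ : ℝ → ℝ) (K κ ν : ℝ) (u : ℝ → ℂ) : Prop :=
  (∃ y ∈ Icc (0 : ℝ) 1, u y ≠ 0) ∧
  ∃ p : ℝ → ℂ, MemDK μ₁ K u p ∧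
    ∀ᵐ y ∂(volume.restrict (Icc (0 : ℝ) 1)), opA ρ μ₂ κ u p y = (ν : ℂ) * u y

/-- The eigenspace of `𝓐_K` for `ν`, as a space of functions on `[0,1]`
(it is `0` when `ν` is not an eigenvalue). -/
def eigenspace (ρ μ₁ μ₂ : ℝ → ℝ) (K κ ν : ℝ) : Submodule ℂ (Icc (0 : ℝ) 1 → ℂ) :=
  Submodule.span ℂ
    {f | ∃ u : ℝ → ℂ, IsEigenfunction ρ μ₁ μ₂ K κ ν u ∧ f = (Icc (0 : ℝ) 1).domRestrict u}

/-- The sum of the eigenspaces of `𝓐_K` for all eigenvalues `≤ x`; its dimension is the number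
of eigenvalues `≤ x`, counted with multiplicity. -/
def spectralSubspace (ρ μ₁ μ₂ : ℝ → ℝ) (K κ x : ℝ) : Submodule ℂ (Icc (0 : ℝ) 1 → ℂ) :=
  ⨆ ν ∈ Iic x, eigenspace ρ μ₁ μ₂ K κ ν

/-- The eigenvalues of `𝓐_K` (at `k² = κ`) in increasing order, repeated by multiplicity:
`eigenvalue … n` is the least `x` such that at least `n + 1` eigenvalues are `≤ x`. The numbering
starts at `n = 0`, so this is the eigenvalue `ω²_{n+1}` in a numbering that starts at `1`. -/
def eigenvalue (ρ μ₁ μ₂ : ℝ → ℝ) (K : ℝ) (n : ℕ) (κ : ℝ) : ℝ :=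
  sInf {x : ℝ | ((n + 1 : ℕ) : Cardinal) ≤ Module.rank ℂ (spectralSubspace ρ μ₁ μ₂ K κ x)}

/-- The dispersion branch `k ↦ ω_n(K,k) = √(ω_n²(K,k))`, at fixed `K`. -/
def omega (ρ μ₁ μ₂ : ℝ → ℝ) (K : ℝ) (n : ℕ) (k : ℝ) : ℝ :=
  Real.sqrt (eigenvalue ρ μ₁ μ₂ K n (k ^ 2))

/-- The quotient `∫₀¹ μ₂ |u|² dy / ∫₀¹ ρ |u|² dy`. -/
def slope (ρ μ₂ : ℝ → ℝ) (u : ℝ → ℂ) : ℝ :=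
  (∫ y in (0 : ℝ)..1, μ₂ y * ‖u y‖ ^ 2) / ∫ y in (0 : ℝ)..1, ρ y * ‖u y‖ ^ 2

/-- Orthogonality in the weighted space `L²_ρ(0,1)`. -/
def Orthogonal (ρ : ℝ → ℝ) (u v : ℝ → ℂ) : Prop :=
  ∫ y in (0 : ℝ)..1, (ρ y : ℂ) * u y * (starRingEnd ℂ) (v y) = 0

end FloquetSH

end

/-! The boundary value problem is turned into a bounded self-adjoint operator pencil, and everything
is proved for the pencil. Put `β = K + π` and `u = e^{iβy} v`. The quasi-periodic condition becomes
`v(1) = -v(0)`, the same for every `K`, and an antiperiodic `v` is recovered from its derivative `f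
= v'` by a primitive `V` (`primOp`) which is compact, injective and skew-adjoint on `L²(0,1)`. With
`G = 1 + iβV` the weak form of the eigenvalue problem is `G* μ₁ G f + κ V* μ₂ V f = ν V* ρ V f`,
that is, `(A + κW - ν S*S) f = 0` with `S = √ρ V`. The domain, the absolute continuity and the
boundary conditions are all encoded in the fact that `μ₁ G f` lies in the range of `V`
(`mem_eig_floquetPencil`).

For large `c` the operator `A + κW + c S*S` is coercive, and `S (A + κW + c S*S)⁻¹ S*` is compact,
self-adjoint and analytic in `κ`; its eigenvalue `1/(ν + c)` corresponds to the eigenvalue `ν` of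
the pencil. Hence a min-max principle (`SpectralPencil.le_finrank_sp_iff`): at least `n` eigenvalues
are `≤ x` exactly when the form of `A + κW` is `≤ x ‖S w‖²` on some subspace of dimension at least
`n`. Since `lo ‖S w‖² ≤ ⟨w, W w⟩ ≤ hi ‖S w‖²` with `lo > 0`, the same trial subspaces at `κ` and `κ
+ h` show that every ordered eigenvalue increases by an amount between `lo h` and `hi h`. This gives
strict monotonicity and a Lipschitz constant common to all curves.

Locally, Rellich's theorem (`exists_eigenframe`) provides analytic eigenvalues and eigenvectors. A
Riccati equation carries the eigenspace of an isolated eigenvalue along analytically, which leaves a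
matrix family; that family is treated by induction on the size, splitting the leading coefficient of
its trace-free part. Pairing the eigenvalue equation at `κ` with the eigenvector at `κ₀` gives the
slope formula (`SpectralPencil.hasDerivAt_of_mem_eig`); at a simple eigenvalue the only germ through
it is the ordered eigenvalue itself.

Globally, the germs are continued along the real line. The common Lipschitz bound prevents escape to
infinity at a finite `κ`, and the number of germs at `κ` that continue to a given global branch does
not depend on `κ`. So the branches started at one point enumerate the spectrum, with multiplicity,
everywhere (`IsLocalBranching.exists_global_branches`). -/

noncomputable section

open scoped ContDiff

/-! ### Analytic implicit functions: Riccati equation and square root -/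

/-- An analytic equation `f (e, x) = f (e₀, x₀)` whose partial derivative in `x` is a nonzero
multiple of the identity has a unique analytic local solution. -/
theorem exists_implicit_of_hasFDerivAt_smul_id {E X : Type*} [NormedAddCommGroup E]
    [NormedSpace ℝ E] [CompleteSpace E] [NormedAddCommGroup X] [NormedSpace ℝ X] [CompleteSpace X]
    {f : E × X → X} {e₀ : E} {x₀ : X} (hf : ContDiffAt ℝ ω f (e₀, x₀)) {c : ℝ} (hc : c ≠ 0)
    (hd : HasFDerivAt (fun x => f (e₀, x)) (c • ContinuousLinearMap.id ℝ X) x₀) :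
    ∃ ψ : E → X, ContDiffAt ℝ ω ψ e₀ ∧ ψ e₀ = x₀ ∧ (∀ᶠ e in 𝓝 e₀, f (e, ψ e) = f (e₀, x₀)) ∧
      ∀ᶠ v in 𝓝 (e₀, x₀), f v = f (e₀, x₀) ↔ ψ v.1 = v.2 := by
  have pn : (ω : WithTop ℕ∞) ≠ 0 := by simp
  have h1 : fderiv ℝ f (e₀, x₀) ∘L ContinuousLinearMap.inr ℝ E X
      = c • ContinuousLinearMap.id ℝ X := by
    have h2 : HasFDerivAt f (fderiv ℝ f (e₀, x₀)) (e₀, x₀) :=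
      (hf.differentiableAt pn).hasFDerivAt
    exact (h2.comp x₀ (hasFDerivAt_prodMk_right e₀ x₀)).unique hd
  have hi : (fderiv ℝ f (e₀, x₀) ∘L ContinuousLinearMap.inr ℝ E X).IsInvertible := by
    rw [h1]
    refine ⟨ContinuousLinearEquiv.smulLeft (Units.mk0 c hc), ?_⟩
    ext x
    simp
  exact ⟨hf.implicitFunction pn hi, hf.contDiffAt_implicitFunction pn hi,
    hf.implicitFunction_apply_self pn hi, hf.eventually_apply_implicitFunction pn hi,
    hf.eventually_apply_eq_iff_implicitFunction pn hi⟩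

/-- Analytic solution of the Riccati equation of an invariant subspace. -/
theorem exists_riccati {𝔸 : Type*} [NormedRing 𝔸] [NormedAlgebra ℝ 𝔸] [CompleteSpace 𝔸]
    (P S : 𝔸) {D : ℝ → 𝔸} {x₀ : ℝ} (hD : ContDiffAt ℝ ω D x₀) (h0 : D x₀ = 0) :
    ∃ Z : ℝ → 𝔸, ContDiffAt ℝ ω Z x₀ ∧ Z x₀ = P ∧
      ∀ᶠ x in 𝓝 x₀, Z x = P - S * (D x * Z x - Z x * P * D x * Z x) := by
  -- As `D x₀ = 0`, the map `f (x₀, ·)` is the translation `Z - P`, whose derivative is the identity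
  -- whatever `P` and `S` are.
  let f : ℝ × 𝔸 → 𝔸 := fun v => v.2 - P + S * (D v.1 * v.2 - v.2 * P * D v.1 * v.2)
  have hf : ContDiffAt ℝ ω f (x₀, P) := by
    have hD' : ContDiffAt ℝ ω (fun v : ℝ × 𝔸 => D v.1) (x₀, P) :=
      ContDiffAt.comp (x₀, P) hD contDiffAt_fst
    have h2 : ContDiffAt ℝ ω (fun v : ℝ × 𝔸 => v.2) (x₀, P) := contDiffAt_snd
    exact (h2.sub contDiffAt_const).add (contDiffAt_const.mul
      ((hD'.mul h2).sub (((h2.mul contDiffAt_const).mul hD').mul h2)))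
  have hd : HasFDerivAt (fun Z => f (x₀, Z)) ((1 : ℝ) • ContinuousLinearMap.id ℝ 𝔸) P := by
    have : (fun Z => f (x₀, Z)) = fun Z => Z - P := by
      funext Z; simp [f, h0]
    rw [this, one_smul]
    exact (hasFDerivAt_id P).sub_const P
  obtain ⟨ψ, h1, h2, h3, -⟩ := exists_implicit_of_hasFDerivAt_smul_id hf one_ne_zero hd
  refine ⟨ψ, h1, h2, ?_⟩
  filter_upwards [h3] with x hx
  have : f (x₀, P) = 0 := by simp [f, h0]
  rw [this] at hx
  simp only [f] at hx
  rw [eq_sub_iff_add_eq, ← sub_eq_zero, ← hx]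
  abel

/-- Analytic self-adjoint square roots near `1`. -/
theorem exists_sqrt_near_one {𝔸 : Type*} [NormedRing 𝔸] [NormedAlgebra ℝ 𝔸] [CompleteSpace 𝔸]
    [StarRing 𝔸] [ContinuousStar 𝔸] {G : ℝ → 𝔸} {x₀ : ℝ} (hG : ContDiffAt ℝ ω G x₀)
    (h0 : G x₀ = 1) (hs : ∀ᶠ x in 𝓝 x₀, star (G x) = G x) :
    ∃ X : ℝ → 𝔸, ContDiffAt ℝ ω X x₀ ∧ X x₀ = 1 ∧
      ∀ᶠ x in 𝓝 x₀, X x * X x = G x ∧ star (X x) = X x := by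
  let f : 𝔸 × 𝔸 → 𝔸 := fun v => v.2 * v.2 - v.1
  have hf : ContDiffAt ℝ ω f (1, 1) :=
    (contDiffAt_snd.mul contDiffAt_snd).sub contDiffAt_fst
  have hd : HasFDerivAt (fun Z => f (1, Z)) ((2 : ℝ) • ContinuousLinearMap.id ℝ 𝔸) 1 := by
    have := ((hasFDerivAt_id (𝕜 := ℝ) (1 : 𝔸)).mul' (hasFDerivAt_id (𝕜 := ℝ) (1 : 𝔸))).sub_const 1
    refine this.congr_fderiv ?_
    ext x
    simp [two_smul]
  obtain ⟨ψ, h1, h2, h3, h4⟩ := exists_implicit_of_hasFDerivAt_smul_id hf two_ne_zero hd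
  have f1 : f (1, 1) = 0 := by simp [f]
  simp only [f1] at h3 h4
  have hGt : Tendsto G (𝓝 x₀) (𝓝 1) := h0 ▸ hG.continuousAt
  have hψt : Tendsto (fun x => ψ (G x)) (𝓝 x₀) (𝓝 1) := by
    have := h1.continuousAt.tendsto.comp hGt
    rwa [h2] at this
  -- The adjoint of the root also squares to `G x` and also tends to `1`, so local uniqueness of the
  -- root makes the root self-adjoint.
  have hst : Tendsto (fun x => star (ψ (G x))) (𝓝 x₀) (𝓝 1) := by
    have := (continuous_star.tendsto (1 : 𝔸)).comp hψt
    rwa [star_one] at this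
  refine ⟨fun x => ψ (G x), ?_, by simp only [h0, h2], ?_⟩
  · exact ContDiffAt.comp x₀ (h0 ▸ h1) hG
  · filter_upwards [hGt.eventually h3, (hGt.prodMk_nhds hst).eventually h4, hs] with x a b c
    have ha : ψ (G x) * ψ (G x) = G x := by simpa [f, sub_eq_zero] using a
    refine ⟨ha, ?_⟩
    refine (b.mp ?_).symm
    simp only [f, ← star_mul, ha, c, sub_self]

/-! ### Real analytic calculus for complex operators -/

section RealAnalyticOperators

variable {E F G : Type*} [NormedAddCommGroup E] [NormedAddCommGroup F] [NormedAddCommGroup G]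

/-- The parameter is real while the operators are complex linear, so composition is used as a
bounded bilinear map over `ℝ`. -/
theorem ContDiffAt.complexClm_comp [NormedSpace ℂ E] [NormedSpace ℂ F] [NormedSpace ℂ G]
    {n : WithTop ℕ∞} {a : ℝ → F →L[ℂ] G} {b : ℝ → E →L[ℂ] F} {x : ℝ} (ha : ContDiffAt ℝ n a x)
    (hb : ContDiffAt ℝ n b x) : ContDiffAt ℝ n (fun y => (a y).comp (b y)) x := by
  have h : IsBoundedBilinearMap ℝ (fun p : (F →L[ℂ] G) × (E →L[ℂ] F) => p.1.comp p.2) :=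
    { add_left := fun _ _ _ => ContinuousLinearMap.add_comp _ _ _
      smul_left := fun _ _ _ => ContinuousLinearMap.smul_comp _ _ _
      add_right := fun _ _ _ => ContinuousLinearMap.comp_add _ _ _
      smul_right := fun _ f _ => by ext; simp
      bound := ⟨1, one_pos, fun f g => by
        rw [one_mul]; exact ContinuousLinearMap.opNorm_comp_le f g⟩ }
  exact h.contDiff.contDiffAt.comp x (ha.prodMk hb)

theorem ContDiffAt.complexClm_apply [NormedSpace ℂ E] [NormedSpace ℂ F]
    {n : WithTop ℕ∞} {a : ℝ → E →L[ℂ] F} {b : ℝ → E} {x : ℝ} (ha : ContDiffAt ℝ n a x)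
    (hb : ContDiffAt ℝ n b x) : ContDiffAt ℝ n (fun y => a y (b y)) x := by
  have h : IsBoundedBilinearMap ℝ (fun p : (E →L[ℂ] F) × E => p.1 p.2) :=
    { add_left := fun _ _ _ => rfl
      smul_left := fun _ _ _ => rfl
      add_right := fun _ _ _ => by simp
      smul_right := fun _ f _ => by simp
      bound := ⟨1, one_pos, fun f g => by
        rw [one_mul]; exact f.le_opNorm g⟩ }
  exact h.contDiff.contDiffAt.comp x (ha.prodMk hb)

/-- Taking adjoints is conjugate-linear, hence linear over `ℝ` and isometric; it preserves
analyticity in a real parameter. -/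
theorem ContDiffAt.complexAdjoint [InnerProductSpace ℂ E] [InnerProductSpace ℂ F]
    [CompleteSpace E] [CompleteSpace F]
    {n : WithTop ℕ∞} {a : ℝ → E →L[ℂ] F} {x : ℝ} (ha : ContDiffAt ℝ n a x) :
    ContDiffAt ℝ n (fun y => (ContinuousLinearMap.adjoint (a y))) x := by
  have h : IsBoundedLinearMap ℝ (fun p : (E →L[ℂ] F) => ContinuousLinearMap.adjoint p) :=
    { map_add := fun _ _ => map_add _ _ _
      map_smul := fun c f => by
        have := map_smulₛₗ (ContinuousLinearMap.adjoint (𝕜 := ℂ) (E := E) (F := F)) (c : ℂ) f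
        simpa using this
      bound := ⟨1, one_pos, fun f => by
        rw [one_mul]; exact (LinearIsometryEquiv.norm_map _ f).le⟩ }
  exact h.contDiff.contDiffAt.comp x ha

end RealAnalyticOperators

/-! ### Reduction at an isolated eigenvalue -/

/-- A solution of the Riccati equation has an invariant range. -/
theorem intertwine_of_riccati {R : Type*} [Ring R] {A P S D Z : R} (hAS : A * S = 1 - P)
    (hPS : P * S = 0) (hPP : P * P = P) (hAP : A * P = 0)
    (hZ : Z = P - S * (D * Z - Z * P * D * Z)) : (A + D) * Z = Z * P * D * Z := by
  -- The normalization `P Z = P` makes `P` annihilate `D Z - Z P D Z`. So the factor `1 - P` in `A Z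
  -- = -(1 - P)(D Z - Z P D Z)` can be dropped, and adding `D Z` leaves `Z P D Z`.
  have hPZ : P * Z = P := by
    rw [hZ, mul_sub, ← mul_assoc, hPS, zero_mul, sub_zero, hPP]
  have hAZ : A * Z = -((1 - P) * (D * Z - Z * P * D * Z)) := by
    conv_lhs => rw [hZ]
    rw [mul_sub, hAP, ← mul_assoc, hAS, zero_sub]
  have h2 : P * (D * Z - Z * P * D * Z) = 0 := by
    rw [mul_sub]
    simp only [← mul_assoc]
    rw [hPZ, hPP, sub_self]
  rw [add_mul, hAZ, sub_mul, h2]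
  noncomm_ring

open ContinuousLinearMap in
/-- Analytic reduction to the eigenspace of an isolated eigenvalue: an analytic family of
isometries `J` onto invariant subspaces. -/
theorem exists_analytic_isometry {H : Type*} [NormedAddCommGroup H] [InnerProductSpace ℂ H]
    [CompleteSpace H] {T : ℝ → H →L[ℂ] H} {x₀ : ℝ} (hT : ContDiffAt ℝ ω T x₀) {τ : ℝ}
    {N : Submodule ℂ H} [FiniteDimensional ℂ N] {m : ℕ} (hm : Module.finrank ℂ N = m)
    (hTP : T x₀ * N.starProjection = (τ : ℂ) • N.starProjection)
    (hPT : N.starProjection * T x₀ = (τ : ℂ) • N.starProjection)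
    (hU : IsUnit (T x₀ - (τ : ℂ) • 1 + N.starProjection)) :
    ∃ J : ℝ → EuclideanSpace ℂ (Fin m) →L[ℂ] H, ContDiffAt ℝ ω J x₀ ∧
      T x₀ ∘L J x₀ = (τ : ℂ) • J x₀ ∧
      ∀ᶠ x in 𝓝 x₀, adjoint (J x) ∘L J x = 1 ∧
        T x ∘L J x = J x ∘L (adjoint (J x) ∘L T x ∘L J x) := by
  set P := N.starProjection with hP
  have hPP : P * P = P := by
    ext v; simp [P, N.starProjection_eq_self_iff.2 (Submodule.starProjection_apply_mem _ _)]
  set A := T x₀ - (τ : ℂ) • (1 : H →L[ℂ] H) with hA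
  have hAP : A * P = 0 := by rw [hA, sub_mul, hTP, smul_mul_assoc, one_mul, sub_self]
  have hPA : P * A = 0 := by rw [hA, mul_sub, hPT, mul_smul_comm, mul_one, sub_self]
  obtain ⟨U, hUe⟩ := hU
  have hUP : (U⁻¹ : (H →L[ℂ] H)ˣ) * P = P := by
    have : (U : H →L[ℂ] H) * P = P := by rw [hUe, add_mul, hAP, hPP, zero_add]
    rw [Units.inv_mul_eq_iff_eq_mul, this]
  have hPU : P * (U⁻¹ : (H →L[ℂ] H)ˣ) = P := by
    have : P * (U : H →L[ℂ] H) = P := by rw [hUe, mul_add, hPA, hPP, zero_add]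
    rw [Units.mul_inv_eq_iff_eq_mul, this]
  -- `S` is the reduced resolvent of `T x₀` at `τ`: it inverts `A` on the orthogonal complement of
  -- `N` and vanishes on `N`.
  set S : H →L[ℂ] H := (U⁻¹ : (H →L[ℂ] H)ˣ) * (1 - P) with hS
  have hPS : P * S = 0 := by rw [hS, ← mul_assoc, hPU, mul_sub, hPP, mul_one, sub_self]
  have hAS : A * S = 1 - P := by
    have : A = U - P := by rw [hUe]; abel
    rw [this, hS, ← mul_assoc, sub_mul, hPU, Units.mul_inv, sub_mul, mul_sub P, hPP]
    simp
  set D : ℝ → H →L[ℂ] H := fun x => T x - T x₀ with hD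
  obtain ⟨Z, hZ, hZ0, hZe⟩ := exists_riccati P S (hT.sub contDiffAt_const : ContDiffAt ℝ ω D x₀)
    (by simp)
  -- an isometry onto `N`
  subst hm
  let b := stdOrthonormalBasis ℂ N
  let J₀ : EuclideanSpace ℂ (Fin (Module.finrank ℂ N)) →L[ℂ] H :=
    (N.subtypeₗᵢ.comp b.repr.symm.toLinearIsometry).toContinuousLinearMap
  have hJJ : adjoint J₀ ∘L J₀ = 1 := by
    exact (norm_map_iff_adjoint_comp_self J₀).1
      (N.subtypeₗᵢ.comp b.repr.symm.toLinearIsometry).norm_map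
  have hPJ : P ∘L J₀ = J₀ := by
    ext1 c
    exact N.starProjection_eq_self_iff.2 (Submodule.coe_mem _)
  have hPs : adjoint P = P := (isSelfAdjoint_starProjection N).star_eq
  have hJP : adjoint J₀ ∘L P = adjoint J₀ := by
    rw [← hPs, ← adjoint_comp, hPJ]
  have hP2 : J₀ ∘L adjoint J₀ = P := by
    ext1 v
    obtain ⟨c, hc⟩ : ∃ c, J₀ c = P v :=
      ⟨b.repr ⟨P v, Submodule.starProjection_apply_mem _ _⟩, by simp [J₀]⟩
    have h1 : adjoint J₀ v = c := by
      rw [← hJP, comp_apply, ← hc, ← comp_apply, hJJ]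
      rfl
    rw [comp_apply, h1, hc]
  set Y : ℝ → EuclideanSpace ℂ (Fin (Module.finrank ℂ N)) →L[ℂ] H := fun x => Z x ∘L J₀ with hYd
  have hYc : ContDiffAt ℝ ω Y x₀ := hZ.complexClm_comp contDiffAt_const
  have hY0 : Y x₀ = J₀ := by rw [hYd]; simp only [hZ0, hPJ]
  -- `Y x` maps onto the invariant subspace but is isometric only at `x₀`. Dividing by the square
  -- root of its Gram operator `Y*Y` is the polar decomposition and makes it an isometry.
  obtain ⟨X, hXc, hX0, hXe⟩ := exists_sqrt_near_one (hYc.complexAdjoint.complexClm_comp hYc)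
    (by rw [hY0, hJJ]) (Eventually.of_forall fun x => by
      rw [star_eq_adjoint, adjoint_comp, adjoint_adjoint])
  have hXu : ∀ᶠ x in 𝓝 x₀, IsUnit (X x) := by
    have : Tendsto X (𝓝 x₀) (𝓝 1) := hX0 ▸ hXc.continuousAt
    exact this.eventually (Units.isOpen.mem_nhds isUnit_one)
  have hic : ContDiffAt ℝ ω (fun x => Ring.inverse (X x)) x₀ := by
    have : ContDiffAt ℝ ω Ring.inverse (X x₀) := hX0 ▸ contDiffAt_ringInverse ℝ 1
    exact this.comp x₀ hXc
  refine ⟨fun x => Y x ∘L Ring.inverse (X x), hYc.complexClm_comp hic, ?_, ?_⟩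
  · simp only [hY0, hX0, Ring.inverse_one]
    ext1 c
    have h2 : T x₀ (P (J₀ c)) = (τ : ℂ) • P (J₀ c) := congrArg (fun f => f (J₀ c)) hTP
    have h3 : P (J₀ c) = J₀ c := congrArg (fun f => f c) hPJ
    rw [h3] at h2
    exact h2
  · filter_upwards [hZe, hXe, hXu] with x h1 h2 h3
    have h4 := intertwine_of_riccati hAS hPS hPP hAP h1
    have h5 : A + D x = T x - (τ : ℂ) • 1 := by simp only [hA, hD]; abel
    -- `T Y = Y M`
    have h6 : T x ∘L Y x = Y x ∘L ((τ : ℂ) • 1 + adjoint J₀ ∘L D x ∘L Z x ∘L J₀) := by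
      ext1 c
      rw [h5] at h4
      have h7 : T x (Z x (J₀ c)) - (τ : ℂ) • Z x (J₀ c) = Z x (P (D x (Z x (J₀ c)))) :=
        congrArg (fun f => f (J₀ c)) h4
      rw [← hP2] at h7
      have h8 : T x (Z x (J₀ c)) = (τ : ℂ) • Z x (J₀ c) +
          Z x (J₀ (adjoint J₀ (D x (Z x (J₀ c))))) := by
        rw [← sub_eq_iff_eq_add']; exact h7
      simp only [hYd, comp_apply, add_apply, smul_apply, map_add, map_smul, h8]
      rfl
    set M := (τ : ℂ) • (1 : EuclideanSpace ℂ (Fin (Module.finrank ℂ N)) →L[ℂ] _) +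
      adjoint J₀ ∘L D x ∘L Z x ∘L J₀
    have hr1 : X x * Ring.inverse (X x) = 1 := Ring.mul_inverse_cancel _ h3
    have hr2 : Ring.inverse (X x) * X x = 1 := Ring.inverse_mul_cancel _ h3
    have hrs : adjoint (Ring.inverse (X x)) = Ring.inverse (X x) := by
      rw [← star_eq_adjoint, ← Ring.inverse_star, h2.2]
    have hiso : adjoint (Y x ∘L Ring.inverse (X x)) ∘L (Y x ∘L Ring.inverse (X x)) = 1 := by
      rw [adjoint_comp, hrs]
      have : Ring.inverse (X x) * (X x * X x) * Ring.inverse (X x) = 1 := by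
        rw [← mul_assoc, hr2, one_mul, hr1]
      rw [h2.1] at this
      exact this
    have hint : T x ∘L (Y x ∘L Ring.inverse (X x)) =
        (Y x ∘L Ring.inverse (X x)) ∘L (X x ∘L M ∘L Ring.inverse (X x)) := by
      have e1 : T x ∘L (Y x ∘L Ring.inverse (X x)) = (T x ∘L Y x) ∘L Ring.inverse (X x) := rfl
      have e2 : (Y x ∘L Ring.inverse (X x)) ∘L (X x ∘L M ∘L Ring.inverse (X x)) =
        (Y x ∘L (Ring.inverse (X x) * X x)) ∘L (M ∘L Ring.inverse (X x)) := rfl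
      rw [e1, h6, e2, hr2]
      rfl
    refine ⟨hiso, ?_⟩
    -- From `T J = J B` and `J*J = 1` it follows that `B = J* T J`.
    rw [hint, ← comp_assoc (adjoint _), hiso]
    rfl

/-- Analytic eigenvalues `lam i` and orthonormal analytic eigenvectors `w i` of the family `T`
near `x₀`. -/
structure IsAnalyticEigenframe {H : Type*} [NormedAddCommGroup H] [InnerProductSpace ℂ H]
    (T : ℝ → H →L[ℂ] H) (x₀ : ℝ) {ι : Type*} (lam : ι → ℝ → ℝ) (w : ι → ℝ → H) : Prop where
  contDiffAt_lam : ∀ i, ContDiffAt ℝ ω (lam i) x₀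
  contDiffAt_w : ∀ i, ContDiffAt ℝ ω (w i) x₀
  orthonormal : ∀ᶠ x in 𝓝 x₀, Orthonormal ℂ (fun i => w i x)
  eigen : ∀ᶠ x in 𝓝 x₀, ∀ i, T x (w i x) = (lam i x : ℂ) • w i x

section

variable {H : Type*} [NormedAddCommGroup H] [InnerProductSpace ℂ H] [CompleteSpace H]

open ContinuousLinearMap

theorem inner_map_map_of_adjoint_comp_eq_one {E : Type*} [NormedAddCommGroup E]
    [InnerProductSpace ℂ E] [CompleteSpace E] {J : E →L[ℂ] H} (hJ : adjoint J ∘L J = 1) (a b : E) :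
    inner ℂ (J a) (J b) = inner ℂ a b := by
  rw [← adjoint_inner_right, ← comp_apply, hJ]; rfl

theorem IsAnalyticEigenframe.lift {T : ℝ → H →L[ℂ] H} {x₀ : ℝ} {m : ℕ}
    {J : ℝ → EuclideanSpace ℂ (Fin m) →L[ℂ] H} (hJ : ContDiffAt ℝ ω J x₀)
    (hJe : ∀ᶠ x in 𝓝 x₀, adjoint (J x) ∘L J x = 1 ∧
        T x ∘L J x = J x ∘L (adjoint (J x) ∘L T x ∘L J x))
    {lam : Fin m → ℝ → ℝ} {w : Fin m → ℝ → EuclideanSpace ℂ (Fin m)}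
    (h : IsAnalyticEigenframe (fun x => adjoint (J x) ∘L T x ∘L J x) x₀ lam w) :
    IsAnalyticEigenframe T x₀ lam (fun i x => J x (w i x)) where
  contDiffAt_lam := h.contDiffAt_lam
  contDiffAt_w := fun i => hJ.complexClm_apply (h.contDiffAt_w i)
  orthonormal := by
    filter_upwards [hJe, h.orthonormal] with x h1 h2
    rw [orthonormal_iff_ite] at h2 ⊢
    intro i j
    rw [inner_map_map_of_adjoint_comp_eq_one h1.1, h2]
  eigen := by
    filter_upwards [hJe, h.eigen] with x h1 h2 i
    have h3 := congrArg (fun f => f (w i x)) h1.2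
    have h4 : T x (J x (w i x)) = J x ((adjoint (J x) ∘L T x ∘L J x) (w i x)) := h3
    rw [h4, h2, map_smul]

/-- Self-adjointness makes the projection `P` commute with `T`. If `(T - τ + P) v = 0`, applying `P`
gives `P v = 0`; then `v` is an eigenvector for `τ`, so `v = P v = 0`. This injectivity is the
source of the invertibility of `T - τ + P`. -/
theorem starProjection_eigenspace {T : H →L[ℂ] H} (hT : IsSelfAdjoint T) (τ : ℝ)
    [FiniteDimensional ℂ (Module.End.eigenspace (T : Module.End ℂ H) (τ : ℂ))] :
    T * (Module.End.eigenspace (T : Module.End ℂ H) (τ : ℂ)).starProjection =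
      (τ : ℂ) • (Module.End.eigenspace (T : Module.End ℂ H) (τ : ℂ)).starProjection ∧
    (Module.End.eigenspace (T : Module.End ℂ H) (τ : ℂ)).starProjection * T =
      (τ : ℂ) • (Module.End.eigenspace (T : Module.End ℂ H) (τ : ℂ)).starProjection ∧
    ∀ v, (T - (τ : ℂ) • 1 +
      (Module.End.eigenspace (T : Module.End ℂ H) (τ : ℂ)).starProjection) v = 0 → v = 0 := by
  set N := Module.End.eigenspace (T : Module.End ℂ H) (τ : ℂ) with hN
  have h1 : T * N.starProjection = (τ : ℂ) • N.starProjection := by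
    ext v
    have := Submodule.starProjection_apply_mem N v
    exact Module.End.mem_eigenspace_iff.1 this
  have h2 : N.starProjection * T = (τ : ℂ) • N.starProjection := by
    have := congrArg star h1
    rw [star_mul, star_smul, hT.star_eq, (isSelfAdjoint_starProjection N).star_eq] at this
    simpa using this
  refine ⟨h1, h2, fun v hv => ?_⟩
  have h3 : T v - (τ : ℂ) • v + N.starProjection v = 0 := hv
  have h4 : N.starProjection (T v) = (τ : ℂ) • N.starProjection v := congrArg (fun f => f v) h2
  have h5 : N.starProjection (N.starProjection v) = N.starProjection v :=
    N.starProjection_eq_self_iff.2 (Submodule.starProjection_apply_mem _ _)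
  have h6 := congrArg N.starProjection h3
  rw [map_add, map_sub, map_smul, h4, h5, sub_self, zero_add, map_zero] at h6
  rw [h6, add_zero, sub_eq_zero] at h3
  rw [← h6]
  exact (N.starProjection_eq_self_iff.2 (Module.End.mem_eigenspace_iff.2 h3)).symm

/-- Rellich's theorem at an isolated eigenvalue of multiplicity `m`, given the case of
`m × m` matrices. -/
theorem exists_eigenframe_of_finite {T : ℝ → H →L[ℂ] H} {x₀ : ℝ} (hT : ContDiffAt ℝ ω T x₀)
    (hs : ∀ᶠ x in 𝓝 x₀, IsSelfAdjoint (T x)) {τ : ℝ}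
    [FiniteDimensional ℂ (Module.End.eigenspace (T x₀ : Module.End ℂ H) (τ : ℂ))] {m : ℕ}
    (hm : Module.finrank ℂ (Module.End.eigenspace (T x₀ : Module.End ℂ H) (τ : ℂ)) = m)
    (hU : IsUnit (T x₀ - (τ : ℂ) • 1 +
      (Module.End.eigenspace (T x₀ : Module.End ℂ H) (τ : ℂ)).starProjection))
    (hF : ∀ A : ℝ → EuclideanSpace ℂ (Fin m) →L[ℂ] EuclideanSpace ℂ (Fin m),
      ContDiffAt ℝ ω A x₀ → (∀ᶠ x in 𝓝 x₀, IsSelfAdjoint (A x)) →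
      ∃ (lam : Fin m → ℝ → ℝ) (w : Fin m → ℝ → EuclideanSpace ℂ (Fin m)),
        IsAnalyticEigenframe A x₀ lam w) :
    ∃ (lam : Fin m → ℝ → ℝ) (w : Fin m → ℝ → H), IsAnalyticEigenframe T x₀ lam w ∧
      ∀ i, lam i x₀ = τ := by
  obtain ⟨h1, h2, -⟩ := starProjection_eigenspace hs.self_of_nhds τ
  obtain ⟨J, hJ, hJ0, hJe⟩ := exists_analytic_isometry hT hm h1 h2 hU
  obtain ⟨lam, w, hw⟩ := hF (fun x => adjoint (J x) ∘L T x ∘L J x)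
    (hJ.complexAdjoint.complexClm_comp (hT.complexClm_comp hJ)) (by
      filter_upwards [hs] with x hx
      rw [IsSelfAdjoint, star_eq_adjoint, adjoint_comp, adjoint_comp, adjoint_adjoint,
        ← star_eq_adjoint (T x), hx.star_eq]
      rfl)
  refine ⟨lam, _, hw.lift hJ hJe, fun i => ?_⟩
  have e1 := hw.eigen.self_of_nhds i
  have e2 := hw.orthonormal.self_of_nhds
  have e3 := hJe.self_of_nhds.1
  -- At `x₀` the compression `J* T J` is `τ` times the identity, so every analytic eigenvalue starts
  -- at `τ`.
  rw [hJ0, comp_smul, e3] at e1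
  have e4 : ((τ : ℂ) - (lam i x₀ : ℂ)) • w i x₀ = 0 := by
    rw [sub_smul, ← e1, sub_eq_zero]; rfl
  rcases smul_eq_zero.1 e4 with h | h
  · exact_mod_cast (sub_eq_zero.1 h).symm
  · exact absurd h (e2.ne_zero i)

end

/-! ### Rellich's theorem for matrices -/

section FiniteDimension

/-- The real part of the trace, as a real functional. -/
def reTrace (E : Type*) [NormedAddCommGroup E] [InnerProductSpace ℂ E] [FiniteDimensional ℂ E] :
    (E →L[ℂ] E) →L[ℝ] ℝ :=
  Complex.reCLM ∘L (LinearMap.toContinuousLinearMap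
    ((LinearMap.trace ℂ E) ∘ₗ ContinuousLinearMap.coeLM ℂ)).restrictScalars ℝ

theorem reTrace_smul_one (E : Type*) [NormedAddCommGroup E] [InnerProductSpace ℂ E]
    [FiniteDimensional ℂ E] (c : ℝ) : reTrace E ((c : ℂ) • 1) = c * Module.finrank ℂ E := by
  simp [reTrace]

/-- **Rellich's theorem** in finite dimension: an analytic family of self-adjoint operators has
analytic eigenvalues and analytic orthonormal eigenvectors. -/
theorem exists_eigenframe_finite (m : ℕ) (x₀ : ℝ) :
    ∀ (E : Type) [NormedAddCommGroup E] [InnerProductSpace ℂ E] [FiniteDimensional ℂ E]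
      [CompleteSpace E] (_ : Module.finrank ℂ E = m) (A : ℝ → E →L[ℂ] E),
      ContDiffAt ℝ ω A x₀ → (∀ᶠ x in 𝓝 x₀, IsSelfAdjoint (A x)) →
      ∃ (lam : Fin m → ℝ → ℝ) (w : Fin m → ℝ → E), IsAnalyticEigenframe A x₀ lam w := by
  induction m using Nat.strong_induction_on with
  | _ m ih =>
  intro E _ _ _ _ hE A hA hs
  rcases Nat.eq_zero_or_pos m with rfl | hm
  · exact ⟨fun i => i.elim0, fun i => i.elim0, fun i => i.elim0, fun i => i.elim0,
      Eventually.of_forall fun x => ⟨fun i => i.elim0, fun i => i.elim0⟩,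
      Eventually.of_forall fun x i => i.elim0⟩
  have hm' : (m : ℝ) ≠ 0 := by positivity
  -- Subtracting the mean eigenvalue `t` makes the family trace-free, so its leading coefficient
  -- cannot be a nonzero scalar.
  let t : ℝ → ℝ := fun x => reTrace E (A x) / m
  have ht : ContDiffAt ℝ ω t x₀ :=
    ((reTrace E).contDiff.contDiffAt.comp x₀ hA).div_const _
  let D : ℝ → E →L[ℂ] E :=
    fun x => A x - (t x : ℂ) • 1
  have hD : ContDiffAt ℝ ω D x₀ := by
    exact hA.sub ((Complex.ofRealCLM.contDiff.contDiffAt.comp x₀ ht).fun_smul contDiffAt_const)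
  have hDt : ∀ x, reTrace E (D x) = 0 := fun x => by
    simp only [D, map_sub, reTrace_smul_one, hE, t]
    field_simp
    simp
  have hDs : ∀ᶠ x in 𝓝 x₀, IsSelfAdjoint (D x) := by
    filter_upwards [hs] with x hx
    refine hx.sub ?_
    rw [IsSelfAdjoint, star_smul, star_one]
    simp
  by_cases h0 : ∀ᶠ x in 𝓝 x₀, D x = 0
  · let b := (stdOrthonormalBasis ℂ E).reindex (finCongr hE)
    refine ⟨fun _ => t, fun i _ => b i, fun _ => ht,
      fun _ => contDiffAt_const,
      Eventually.of_forall fun x => b.orthonormal, ?_⟩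
    filter_upwards [h0] with x hx i
    have : A x = (t x : ℂ) • 1 := sub_eq_zero.1 hx
    rw [this]; rfl
  -- `D x = (x - x₀)^n g x` with `g x₀ ≠ 0`. Trace zero and self-adjointness pass to `g`, at `x₀` by
  -- continuity. A nonzero trace-free `g x₀` has no eigenvalue of full multiplicity, so the
  -- induction applies to each of its eigenspaces.
  obtain ⟨n, g, hg, hg0, hge⟩ := hD.analyticAt.exists_eventuallyEq_pow_smul_nonzero_iff.2 h0
  have hgc := hg.continuousAt
  have hne : ∀ᶠ x in 𝓝[≠] x₀, x ≠ x₀ := eventually_mem_nhdsWithin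
  have hgt0 : reTrace E (g x₀) = 0 := by
    have h1 : Tendsto (fun x => reTrace E (g x)) (𝓝[≠] x₀) (𝓝 (reTrace E (g x₀))) :=
      ((reTrace E).continuous.continuousAt.comp hgc).tendsto.mono_left nhdsWithin_le_nhds
    have h2 : (fun x => reTrace E (g x)) =ᶠ[𝓝[≠] x₀] fun _ => 0 := by
      filter_upwards [hne, hge.filter_mono nhdsWithin_le_nhds] with x hx hx2
      have := hDt x
      rw [hx2, map_smul, smul_eq_mul, mul_eq_zero] at this
      exact this.resolve_left (pow_ne_zero _ (sub_ne_zero.2 hx))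
    exact tendsto_nhds_unique (h1.congr' h2) tendsto_const_nhds
  have hgs' : ∀ᶠ x in 𝓝[≠] x₀, IsSelfAdjoint (g x) := by
    filter_upwards [hne, (hge.and hDs).filter_mono nhdsWithin_le_nhds] with x hx hx2
    have h1 := hx2.2
    rw [hx2.1, IsSelfAdjoint, star_smul, star_trivial] at h1
    exact smul_right_injective _ (pow_ne_zero n (sub_ne_zero.2 hx)) h1
  have hgs0 : IsSelfAdjoint (g x₀) := by
    have h1 := hgc.tendsto.mono_left (nhdsWithin_le_nhds (s := {x₀}ᶜ))
    have h2 := ((continuous_star.tendsto _).comp h1).congr' hgs'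
    exact tendsto_nhds_unique h2 h1
  have hgs : ∀ᶠ x in 𝓝 x₀, IsSelfAdjoint (g x) := by
    rw [eventually_nhdsWithin_iff] at hgs'
    filter_upwards [hgs'] with x hx
    by_cases h : x = x₀
    · rw [h]; exact hgs0
    · exact hx h
  have hsym : (g x₀ : Module.End ℂ (E)).IsSymmetric := hgs0.isSymmetric
  -- every eigenvalue of `g x₀` has smaller multiplicity
  let V : Module.End.Eigenvalues (g x₀ : Module.End ℂ (E)) →
    Submodule ℂ (E) := fun μ =>
    Module.End.eigenspace (g x₀ : Module.End ℂ E) (μ : ℂ)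
  have hre : ∀ μ : Module.End.Eigenvalues (g x₀ : Module.End ℂ (E)),
      ((μ : ℂ).re : ℂ) = (μ : ℂ) := fun μ =>
    Complex.conj_eq_iff_re.1 (hsym.conj_eigenvalue_eq_self μ.2)
  have hlt : ∀ μ, Module.finrank ℂ (V μ) < m := fun μ => by
    refine lt_of_le_of_ne ((Submodule.finrank_le _).trans_eq hE) fun h => ?_
    have htop : V μ = ⊤ := Submodule.eq_top_of_finrank_eq (h.trans hE.symm)
    have h1 : g x₀ = (((μ : ℂ).re : ℝ) : ℂ) • 1 := by
      ext1 v
      have : v ∈ V μ := htop ▸ Submodule.mem_top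
      rw [hre]
      exact Module.End.mem_eigenspace_iff.1 this
    have h2 := hgt0
    rw [h1, reTrace_smul_one, hE, mul_eq_zero, or_iff_left hm'] at h2
    exact hg0 (by rw [h1, h2]; simp)
  have key : ∀ μ, ∃ (lam : Fin (Module.finrank ℂ (V μ)) → ℝ → ℝ)
      (w : Fin (Module.finrank ℂ (V μ)) → ℝ → E),
      IsAnalyticEigenframe g x₀ lam w ∧ ∀ i, lam i x₀ = (μ : ℂ).re := by
    intro μ
    have hV : V μ = Module.End.eigenspace (g x₀ : Module.End ℂ (E))
      (((μ : ℂ).re : ℝ) : ℂ) := by rw [hre]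
    refine exists_eigenframe_of_finite hg.contDiffAt hgs (by rw [hV]) ?_ ?_
    · rw [ContinuousLinearMap.isUnit_iff_bijective]
      have hinj := (starProjection_eigenspace hgs0 (μ : ℂ).re).2.2
      have := (injective_iff_map_eq_zero _).2 hinj
      exact ⟨this, LinearMap.injective_iff_surjective.1 this⟩
    · exact ih _ (hlt μ) _ finrank_euclideanSpace_fin
  choose lam w hw hlam using key
  have hcard : Fintype.card (Σ μ, Fin (Module.finrank ℂ (V μ))) = Fintype.card (Fin m) := by
    have hI : DirectSum.IsInternal V := hsym.direct_sum_isInternal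
    rw [← Module.finrank_eq_card_basis (hI.collectedBasis fun μ => Module.finBasis ℂ (V μ)),
      hE, Fintype.card_fin]
  let e := (Fintype.equivOfCardEq hcard).symm
  have hlc : ∀ (i : Σ μ, Fin (Module.finrank ℂ (V μ))), ContDiffAt ℝ ω (lam i.1 i.2) x₀ :=
    fun i => (hw i.1).contDiffAt_lam i.2
  have hev : ∀ᶠ x in 𝓝 x₀, ∀ i : Σ μ, Fin (Module.finrank ℂ (V μ)),
      g x (w i.1 i.2 x) = (lam i.1 i.2 x : ℂ) • w i.1 i.2 x := by
    rw [eventually_all]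
    exact fun i => (hw i.1).eigen.mono fun x hx => hx i.2
  refine ⟨fun i x => t x + (x - x₀) ^ n * lam (e i).1 (e i).2 x, fun i => w (e i).1 (e i).2,
    fun i => ?_, fun i => (hw _).contDiffAt_w _, ?_, ?_⟩
  · exact ht.add (((contDiffAt_id.sub contDiffAt_const).pow n).mul (hlc _))
  -- Eigenvalues issuing from different eigenvalues of `g x₀` stay distinct nearby, which forces
  -- orthogonality between the frames of different eigenspaces.
  · have hdist : ∀ᶠ x in 𝓝 x₀, ∀ i j : Σ μ, Fin (Module.finrank ℂ (V μ)), i.1 ≠ j.1 →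
        lam i.1 i.2 x ≠ lam j.1 j.2 x := by
      simp only [eventually_all]
      intro i j hij
      refine (((hlc i).continuousAt.sub (hlc j).continuousAt).eventually_ne (y := 0) ?_).mono
        fun x hx => sub_ne_zero.1 hx
      change lam i.1 i.2 x₀ - lam j.1 j.2 x₀ ≠ 0
      rw [hlam, hlam, sub_ne_zero]
      intro h
      exact hij (Subtype.ext ((hre i.1).symm.trans ((congrArg Complex.ofReal h).trans (hre j.1))))
    have hon : ∀ᶠ x in 𝓝 x₀, ∀ μ, Orthonormal ℂ (fun i => w μ i x) := by
      rw [eventually_all]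
      exact fun μ => (hw μ).orthonormal
    filter_upwards [hdist, hon, hev, hgs] with x h1 h2 h3 h4
    have : Orthonormal ℂ (fun i : Σ μ, Fin (Module.finrank ℂ (V μ)) => w i.1 i.2 x) := by
      refine ⟨fun i => (h2 i.1).1 i.2, ?_⟩
      rintro ⟨μ, i⟩ ⟨ν, j⟩ hij
      by_cases hμ : μ = ν
      · subst hμ
        exact (h2 μ).2 fun h => hij (by rw [show i = j from h])
      · have a := h4.isSymmetric (w μ i x) (w ν j x)
        have b1 := h3 ⟨μ, i⟩
        have b2 := h3 ⟨ν, j⟩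
        simp only [ContinuousLinearMap.coe_coe] at a b1 b2
        rw [b1, b2, inner_smul_left, inner_smul_right, Complex.conj_ofReal, ← sub_eq_zero,
          ← sub_mul, mul_eq_zero] at a
        refine a.resolve_left ?_
        have := h1 ⟨μ, i⟩ ⟨ν, j⟩ hμ
        exact sub_ne_zero.2 (by exact_mod_cast this)
    exact this.comp _ e.injective
  · filter_upwards [hev, hge] with x h1 h2 i
    have h3 : A x = D x + (t x : ℂ) • 1 := by simp [D]
    rw [h3, h2]
    change (x - x₀) ^ n • g x _ + (t x : ℂ) • _ = _
    rw [h1 (e i), Complex.ofReal_add, add_smul, add_comm, Complex.ofReal_mul, mul_smul]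
    congr 1

end FiniteDimension

/-! ### Rellich's theorem for compact operators -/

/-- **Rellich's theorem** at an isolated eigenvalue of finite multiplicity. -/
theorem exists_eigenframe {H : Type*} [NormedAddCommGroup H] [InnerProductSpace ℂ H]
    [CompleteSpace H] {T : ℝ → H →L[ℂ] H} {x₀ : ℝ} (hT : ContDiffAt ℝ ω T x₀)
    (hs : ∀ᶠ x in 𝓝 x₀, IsSelfAdjoint (T x)) (hc : IsCompactOperator (T x₀)) {τ : ℝ} (hτ : τ ≠ 0) :
    ∃ (lam : Fin (Module.finrank ℂ (Module.End.eigenspace (T x₀ : Module.End ℂ H) (τ : ℂ))) →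
        ℝ → ℝ) (w : _ → ℝ → H), IsAnalyticEigenframe T x₀ lam w ∧ ∀ i, lam i x₀ = τ := by
  have hτ' : (τ : ℂ) ≠ 0 := by exact_mod_cast hτ
  have hfin : FiniteDimensional ℂ (Module.End.eigenspace (T x₀ : Module.End ℂ H) (τ : ℂ)) :=
    ContinuousLinearMap.finite_dimensional_eigenspace hc _ hτ'
  refine exists_eigenframe_of_finite hT hs rfl ?_
    (exists_eigenframe_finite _ x₀ _ finrank_euclideanSpace_fin)
  set P := (Module.End.eigenspace (T x₀ : Module.End ℂ H) (τ : ℂ)).starProjection with hP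
  have hPc : IsCompactOperator P := by
    have h1 : IsCompactOperator
        (Module.End.eigenspace (T x₀ : Module.End ℂ H) (τ : ℂ)).subtypeL :=
      (isCompactOperator_id_iff_finiteDimensional.2 hfin).clm_comp (Submodule.subtypeL _)
    exact h1.comp_clm (Submodule.orthogonalProjectionOnto _)
  -- Fredholm alternative for the compact operator `T x₀ + P`: its value `τ ≠ 0` is not an
  -- eigenvalue, hence lies in the resolvent set.
  have hcomp : IsCompactOperator (T x₀ + P) := hc.add hPc
  have hinj := (starProjection_eigenspace hs.self_of_nhds τ).2.2
  rcases IsCompactOperator.hasEigenvalue_or_mem_resolventSet hcomp hτ' with h | h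
  · obtain ⟨v, hv⟩ := h.exists_hasEigenvector
    refine absurd (hinj v ?_) hv.2
    have : T x₀ v + P v = (τ : ℂ) • v := hv.apply_eq_smul
    change T x₀ v - (τ : ℂ) • v + P v = 0
    rw [← this]; abel
  · rw [spectrum.mem_resolventSet_iff, ← IsUnit.neg_iff] at h
    convert h using 1
    rw [Algebra.algebraMap_eq_smul_one]
    abel

/-! ### Spectral subspaces and min-max for compact self-adjoint operators -/

section CompactSelfAdjoint

variable {H : Type*} [NormedAddCommGroup H] [InnerProductSpace ℂ H] [CompleteSpace H]
  {T : H →L[ℂ] H}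

open Module.End

/-- Expansion of a vector into eigenvectors of a compact self-adjoint operator. -/
theorem exists_spectral_expansion (hT : IsSelfAdjoint T) (hc : IsCompactOperator T) (g : H) :
    ∃ v : ℂ → H, (∀ μ, v μ ∈ eigenspace (T : Module.End ℂ H) μ) ∧
      (∀ μ, ∀ x ∈ eigenspace (T : Module.End ℂ H) μ, inner ℂ x g = inner ℂ x (v μ)) ∧
      HasSum (fun μ => ‖v μ‖ ^ 2) (‖g‖ ^ 2) ∧
      HasSum (fun μ => μ.re * ‖v μ‖ ^ 2) (inner ℂ g (T g)).re := by
  have hs : (T : H →ₗ[ℂ] H).IsSymmetric := hT.isSymmetric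
  have hcomplete : ∀ μ, CompleteSpace (eigenspace (T : Module.End ℂ H) μ) := fun μ => by
    have : IsClosed (eigenspace (T : Module.End ℂ H) μ : Set H) := by
      have h2 : (eigenspace (T : Module.End ℂ H) μ : Set H) = {x | T x = μ • x} := by
        ext x; exact mem_eigenspace_iff
      rw [h2]
      exact isClosed_eq T.continuous (continuous_const_smul μ)
    exact this.completeSpace_coe
  -- The Hilbert sum runs over all complex `μ`, with zero summands off the point spectrum; the
  -- kernel is included as `μ = 0`.
  have hsum : IsHilbertSum ℂ (fun μ => eigenspace (T : Module.End ℂ H) μ)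
      fun μ => (eigenspace (T : Module.End ℂ H) μ).subtypeₗᵢ := by
    refine IsHilbertSum.mkInternal _ hs.orthogonalFamily_eigenspaces ?_
    rw [Submodule.topologicalClosure_eq_top_iff.2
      (ContinuousLinearMap.orthogonalComplement_iSup_eigenspaces_eq_bot hc hs)]
  have hg := hsum.hasSum_linearIsometryEquiv_symm (hsum.linearIsometryEquiv g)
  rw [LinearIsometryEquiv.symm_apply_apply] at hg
  set v : ℂ → H := fun μ => (hsum.linearIsometryEquiv g μ : H) with hv
  have hg' : HasSum v g := hg
  have hmem : ∀ μ, v μ ∈ eigenspace (T : Module.End ℂ H) μ := fun μ => Submodule.coe_mem _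
  have hin : ∀ μ, ∀ x ∈ eigenspace (T : Module.End ℂ H) μ, inner ℂ x g = inner ℂ x (v μ) := by
    intro μ x hx
    have h1 : HasSum (fun ν => inner ℂ x (v ν)) (inner ℂ x g) := hg'.mapL (innerSL ℂ x)
    refine h1.unique (hasSum_single μ fun ν hν => ?_)
    exact hs.orthogonalFamily_eigenspaces (Ne.symm hν) ⟨x, hx⟩ ⟨v ν, hmem ν⟩
  have hvg : ∀ μ, inner ℂ g (v μ) = ((‖v μ‖ ^ 2 : ℝ) : ℂ) := fun μ => by
    rw [← inner_conj_symm, hin μ _ (hmem μ), inner_self_eq_norm_sq_to_K]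
    simp
  refine ⟨v, hmem, hin, ?_, ?_⟩
  · have h1 : HasSum (fun ν => inner ℂ g (v ν)) (inner ℂ g g) := hg'.mapL (innerSL ℂ g)
    simp only [hvg, inner_self_eq_norm_sq_to_K] at h1
    have h3 := h1.mapL Complex.reCLM
    norm_cast at h3
  · have h1 : HasSum (fun ν => inner ℂ g (T (v ν))) (inner ℂ g (T g)) :=
      (hg'.mapL T).mapL (innerSL ℂ g)
    have h2 : ∀ μ, inner ℂ g (T (v μ)) = μ * ((‖v μ‖ ^ 2 : ℝ) : ℂ) := fun μ => by
      have : T (v μ) = μ • v μ := mem_eigenspace_iff.1 (hmem μ)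
      rw [this, inner_smul_right, hvg]
    simp only [h2] at h1
    have h3 := h1.mapL Complex.reCLM
    simpa only [Complex.reCLM_apply, Complex.re_mul_ofReal] using h3

/-- The span of the eigenvectors with eigenvalue at least `t`. -/
def upperSpectralSubspace (T : H →L[ℂ] H) (t : ℝ) : Submodule ℂ H :=
  ⨆ τ ∈ Ici t, eigenspace (T : Module.End ℂ H) ((τ : ℝ) : ℂ)

omit [CompleteSpace H] in
theorem eigenspace_le_upperSpectralSubspace {t τ : ℝ} (h : t ≤ τ) :
    eigenspace (T : Module.End ℂ H) ((τ : ℝ) : ℂ) ≤ upperSpectralSubspace T t :=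
  le_iSup₂_of_le τ h le_rfl

theorem eigenvalue_real_of_mem (hT : IsSelfAdjoint T) {μ : ℂ} {v : H}
    (hv : v ∈ eigenspace (T : Module.End ℂ H) μ) (h0 : v ≠ 0) : ((μ.re : ℝ) : ℂ) = μ := by
  have hs : (T : H →ₗ[ℂ] H).IsSymmetric := hT.isSymmetric
  exact Complex.conj_eq_iff_re.1 (hs.conj_eigenvalue_eq_self
    (hasEigenvalue_of_hasEigenvector ⟨hv, h0⟩))

/-- Only eigencomponents with eigenvalue below `t` survive in `g`, and at least one is nonzero;
comparing the two series termwise gives the strict inequality. -/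
theorem inner_map_lt_of_orthogonal (hT : IsSelfAdjoint T) (hc : IsCompactOperator T) {t : ℝ} {g : H}
    (h0 : g ≠ 0) (hg : ∀ x ∈ upperSpectralSubspace T t, inner ℂ x g = 0) :
    (inner ℂ g (T g)).re < t * ‖g‖ ^ 2 := by
  obtain ⟨v, h1, h2, h3, h4⟩ := exists_spectral_expansion hT hc g
  have key : ∀ μ, v μ ≠ 0 → μ.re < t := by
    intro μ hμ
    by_contra! h
    have hr := eigenvalue_real_of_mem hT (h1 μ) hμ
    have hm : v μ ∈ eigenspace (T : Module.End ℂ H) ((μ.re : ℝ) : ℂ) := by rw [hr]; exact h1 μ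
    have := hg _ (eigenspace_le_upperSpectralSubspace h hm)
    rw [h2 μ _ (h1 μ), inner_self_eq_zero] at this
    exact hμ this
  obtain ⟨μ, hμ⟩ : ∃ μ, v μ ≠ 0 := by
    by_contra! h
    simp only [h, norm_zero, ne_eq, OfNat.ofNat_ne_zero, not_false_eq_true, zero_pow] at h3
    have := h3.unique hasSum_zero
    exact h0 (norm_eq_zero.1 (pow_eq_zero_iff two_ne_zero |>.1 this))
  refine hasSum_lt (i := μ) (fun ν => ?_) ?_ h4 (h3.mul_left t)
  · by_cases h : v ν = 0
    · simp [h]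
    · exact mul_le_mul_of_nonneg_right (key ν h).le (by positivity)
  · exact mul_lt_mul_of_pos_right (key μ hμ) (by positivity)

/-- An eigencomponent of `g` with eigenvalue below `t` is orthogonal to the whole upper subspace,
hence to `g`, hence zero. The remaining terms of the series are compared one by one. -/
theorem le_inner_map_of_mem (hT : IsSelfAdjoint T) (hc : IsCompactOperator T) {t : ℝ} {g : H}
    (hg : g ∈ upperSpectralSubspace T t) : t * ‖g‖ ^ 2 ≤ (inner ℂ g (T g)).re := by
  have hs : (T : H →ₗ[ℂ] H).IsSymmetric := hT.isSymmetric
  obtain ⟨v, h1, h2, h3, h4⟩ := exists_spectral_expansion hT hc g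
  have key : ∀ μ, v μ ≠ 0 → t ≤ μ.re := by
    intro μ hμ
    by_contra! h
    have hr := eigenvalue_real_of_mem hT (h1 μ) hμ
    have : upperSpectralSubspace T t ≤ (ℂ ∙ v μ)ᗮ := by
      refine iSup₂_le fun τ hτ x hx => ?_
      rw [Submodule.mem_orthogonal_singleton_iff_inner_right]
      refine hs.orthogonalFamily_eigenspaces (i := μ) (j := τ) ?_ ⟨v μ, h1 μ⟩ ⟨x, hx⟩
      rintro rfl
      exact absurd hτ (not_le.2 h)
    have := Submodule.mem_orthogonal_singleton_iff_inner_right.1 (this hg)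
    rw [h2 μ _ (h1 μ), inner_self_eq_zero] at this
    exact hμ this
  refine hasSum_le (fun ν => ?_) (h3.mul_left t) h4
  by_cases h : v ν = 0
  · simp [h]
  · exact mul_le_mul_of_nonneg_right (key ν h) (by positivity)

/-- A compact operator is bounded below only on finite-dimensional subspaces. -/
theorem finiteDimensional_of_le_norm_map (hc : IsCompactOperator T) {t : ℝ} (ht : 0 < t)
    {F : Submodule ℂ H} (hF : ∀ g ∈ F, t * ‖g‖ ≤ ‖T g‖) : FiniteDimensional ℂ F := by
  -- The lower bound extends to the closure of `F`, where `T` becomes a closed embedding;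
  -- compactness of `T` then makes the unit ball compact, and Riesz's theorem applies.
  have hF' : ∀ g ∈ F.topologicalClosure, t * ‖g‖ ≤ ‖T g‖ := by
    intro g hg
    have hcl : IsClosed {g : H | t * ‖g‖ ≤ ‖T g‖} :=
      isClosed_le (by fun_prop) (by fun_prop)
    exact closure_minimal hF hcl hg
  have hcomp : CompleteSpace F.topologicalClosure :=
    F.isClosed_topologicalClosure.completeSpace_coe
  let R : F.topologicalClosure →L[ℂ] H := T ∘L F.topologicalClosure.subtypeL
  have hanti : AntilipschitzWith (Real.toNNReal t⁻¹) R := by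
    refine R.antilipschitz_of_bound fun x => ?_
    rw [Real.coe_toNNReal _ (by positivity)]
    have := hF' x x.2
    rw [inv_mul_eq_div, le_div_iff₀ ht, mul_comm]
    exact this
  have hR : IsCompactOperator R := hc.comp_clm _
  have hcl := hanti.isClosedEmbedding R.uniformContinuous
  obtain ⟨K, hK, hKs⟩ := hR.image_closedBall_subset_compact 1
  have hball : IsCompact (Metric.closedBall (0 : F.topologicalClosure) 1) :=
    (hcl.isCompact_preimage hK).of_isClosed_subset Metric.isClosed_closedBall
      fun x hx => hKs ⟨x, hx, rfl⟩
  have : FiniteDimensional ℂ F.topologicalClosure :=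
    FiniteDimensional.of_isCompact_closedBall ℂ one_pos hball
  exact Submodule.finiteDimensional_of_le F.le_topologicalClosure

theorem finiteDimensional_of_le_inner_map (hc : IsCompactOperator T) {t : ℝ} (ht : 0 < t)
    {F : Submodule ℂ H} (hF : ∀ g ∈ F, t * ‖g‖ ^ 2 ≤ (inner ℂ g (T g)).re) :
    FiniteDimensional ℂ F := by
  refine finiteDimensional_of_le_norm_map hc ht fun g hg => ?_
  rcases eq_or_ne g 0 with rfl | h0
  · simp
  have h1 := (hF g hg).trans ((Complex.re_le_norm _).trans (norm_inner_le_norm g (T g)))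
  have : 0 < ‖g‖ := norm_pos_iff.2 h0
  nlinarith

theorem finiteDimensional_upperSpectralSubspace (hT : IsSelfAdjoint T) (hc : IsCompactOperator T)
    {t : ℝ} (ht : 0 < t) : FiniteDimensional ℂ (upperSpectralSubspace T t) :=
  finiteDimensional_of_le_inner_map hc ht fun _ hg => le_inner_map_of_mem hT hc hg

/-- The min-max principle for compact self-adjoint operators. -/
theorem finrank_le_of_le_inner_map (hT : IsSelfAdjoint T) (hc : IsCompactOperator T)
    {t : ℝ} (ht : 0 < t) {F : Submodule ℂ H}
    (hF : ∀ g ∈ F, t * ‖g‖ ^ 2 ≤ (inner ℂ g (T g)).re) :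
    Module.finrank ℂ F ≤ Module.finrank ℂ (upperSpectralSubspace T t) := by
  have := finiteDimensional_of_le_inner_map hc ht hF
  have := finiteDimensional_upperSpectralSubspace hT hc ht
  by_contra! hlt
  -- If `F` had larger dimension, the projection of `F` to the upper subspace would kill some
  -- nonzero `g`, on which the form is `< t ‖g‖²`.
  let p : F →ₗ[ℂ] upperSpectralSubspace T t :=
    ((upperSpectralSubspace T t).orthogonalProjectionOnto.toLinearMap).comp F.subtype
  obtain ⟨g, hg, hg0⟩ := (Submodule.ne_bot_iff _).1 (LinearMap.ker_ne_bot_of_finrank_lt (f := p) hlt)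
  have hgo : (g : H) ∈ (upperSpectralSubspace T t)ᗮ := by
    have : (upperSpectralSubspace T t).orthogonalProjectionOnto (g : H) = 0 := hg
    exact Submodule.orthogonalProjectionOnto_eq_zero_iff.1 this
  have h1 := inner_map_lt_of_orthogonal (t := t) hT hc (g := (g : H))
    (fun h => hg0 (Subtype.ext h)) ((Submodule.mem_orthogonal _ _).1 hgo)
  exact absurd (hF g g.2) (not_le.2 h1)

end CompactSelfAdjoint

/-! ### The abstract linear pencil and its resolvent -/

open ContinuousLinearMap in
/-- A self-adjoint linear pencil `A + κ W - ν S†S` with `S` compact and injective, `A` nonnegative,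
`A + S†S` coercive and `W` comparable to `S†S`. -/
structure SpectralPencil (H : Type*) [NormedAddCommGroup H] [InnerProductSpace ℂ H]
    [CompleteSpace H] where
  A : H →L[ℂ] H
  W : H →L[ℂ] H
  S : H →L[ℂ] H
  δ : ℝ
  lo : ℝ
  hi : ℝ
  selfAdjoint_A : IsSelfAdjoint A
  selfAdjoint_W : IsSelfAdjoint W
  A_nonneg : ∀ w, 0 ≤ (inner ℂ w (A w)).re
  δ_pos : 0 < δ
  coercive : ∀ w, δ * ‖w‖ ^ 2 ≤ (inner ℂ w (A w)).re + ‖S w‖ ^ 2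
  S_injective : Function.Injective S
  S_compact : IsCompactOperator S
  lo_pos : 0 < lo
  lo_le_hi : lo ≤ hi
  lo_le : ∀ w, lo * ‖S w‖ ^ 2 ≤ (inner ℂ w (W w)).re
  le_hi : ∀ w, (inner ℂ w (W w)).re ≤ hi * ‖S w‖ ^ 2

namespace SpectralPencil

open ContinuousLinearMap Module.End

variable {H : Type*} [NormedAddCommGroup H] [InnerProductSpace ℂ H] [CompleteSpace H]
  (P : SpectralPencil H)

/-- The operator `A + κ W - ν S†S`. -/
def op (κ ν : ℝ) : H →L[ℂ] H := P.A + (κ : ℂ) • P.W - (ν : ℂ) • (adjoint P.S ∘L P.S)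

/-- The eigenspace of the pencil. -/
def eig (κ ν : ℝ) : Submodule ℂ H := LinearMap.ker (P.op κ ν : H →ₗ[ℂ] H)

/-- The sum of the eigenspaces with eigenvalue at most `x`. -/
def sp (κ x : ℝ) : Submodule ℂ H := ⨆ ν ∈ Iic x, P.eig κ ν

/-- The quadratic form of `A + κ W`. -/
def form (κ : ℝ) (w : H) : ℝ := (inner ℂ w (P.A w)).re + κ * (inner ℂ w (P.W w)).re

theorem mem_eig {κ ν : ℝ} {w : H} :
    w ∈ P.eig κ ν ↔ P.A w + (κ : ℂ) • P.W w = (ν : ℂ) • adjoint P.S (P.S w) := by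
  rw [← sub_eq_zero]; rfl

theorem selfAdjoint_op (κ ν : ℝ) : IsSelfAdjoint (P.op κ ν) := by
  rw [IsSelfAdjoint, op, star_sub, star_add, star_smul, star_smul, P.selfAdjoint_A.star_eq,
    P.selfAdjoint_W.star_eq, star_eq_adjoint (adjoint P.S ∘L P.S), adjoint_comp, adjoint_adjoint]
  simp

theorem inner_adjoint_S (v w : H) : inner ℂ v (adjoint P.S (P.S w)) = inner ℂ (P.S v) (P.S w) :=
  adjoint_inner_right _ _ _

theorem re_inner_op (κ ν : ℝ) (w : H) :
    (inner ℂ w (P.op κ ν w)).re = P.form κ w - ν * ‖P.S w‖ ^ 2 := by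
  have : P.op κ ν w = P.A w + (κ : ℂ) • P.W w - (ν : ℂ) • adjoint P.S (P.S w) := rfl
  rw [this, inner_sub_right, inner_add_right, inner_smul_right, inner_smul_right,
    inner_adjoint_S, inner_self_eq_norm_sq_to_K]
  norm_cast
  simp only [Complex.sub_re, Complex.add_re, Complex.re_ofReal_mul, form]
  norm_cast

theorem hi_pos : 0 < P.hi := P.lo_pos.trans_le P.lo_le_hi

theorem re_inner_W_nonneg (w : H) : 0 ≤ (inner ℂ w (P.W w)).re :=
  (mul_nonneg P.lo_pos.le (sq_nonneg _)).trans (P.lo_le w)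

theorem neg_le_form (κ : ℝ) (w : H) :
    (inner ℂ w (P.A w)).re - |κ| * P.hi * ‖P.S w‖ ^ 2 ≤ P.form κ w := by
  have h1 := P.le_hi w
  have h2 := P.re_inner_W_nonneg w
  have h3 := neg_abs_le κ
  rw [form]
  nlinarith [abs_nonneg κ]

/-- A shift that makes the pencil coercive. -/
def IsShift (κ c : ℝ) : Prop := 1 + |κ| * P.hi ≤ c

variable {P}

/-- The term `|κ| * hi` absorbs `κ W` for either sign of `κ`, and the remaining `1` supplies the `‖S
w‖²` that makes `A` coercive. -/
theorem IsShift.coercive {κ c : ℝ} (h : P.IsShift κ c) (w : H) :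
    P.δ * ‖w‖ ^ 2 ≤ (inner ℂ w (P.op κ (-c) w)).re := by
  rw [re_inner_op]
  have h1 := P.neg_le_form κ w
  have h2 := P.coercive w
  have h3 : (1 + |κ| * P.hi) * ‖P.S w‖ ^ 2 ≤ c * ‖P.S w‖ ^ 2 :=
    mul_le_mul_of_nonneg_right h (sq_nonneg _)
  linarith

theorem IsShift.isUnit {κ c : ℝ} (h : P.IsShift κ c) : IsUnit (P.op κ (-c)) := by
  refine ContinuousLinearMap.isUnit_of_forall_le_norm_inner_map _ (c := ⟨P.δ, P.δ_pos.le⟩)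
    P.δ_pos fun x => ?_
  rw [mul_comm, ← inner_conj_symm, RCLike.norm_conj]
  exact (h.coercive x).trans (Complex.re_le_norm _)

variable (P)

/-- The operator `S (A + κ W + c S†S)⁻¹ S†`, the resolvent of the pencil. -/
def res (c κ : ℝ) : H →L[ℂ] H := P.S ∘L Ring.inverse (P.op κ (-c)) ∘L adjoint P.S

theorem selfAdjoint_res (c κ : ℝ) : IsSelfAdjoint (P.res c κ) := by
  have : adjoint (Ring.inverse (P.op κ (-c))) = Ring.inverse (P.op κ (-c)) := by
    rw [← star_eq_adjoint, ← Ring.inverse_star, (P.selfAdjoint_op κ (-c)).star_eq]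
  rw [IsSelfAdjoint, star_eq_adjoint, res, adjoint_comp, adjoint_comp, adjoint_adjoint, this]
  rfl

theorem compact_res (c κ : ℝ) : IsCompactOperator (P.res c κ) :=
  P.S_compact.comp_clm (Ring.inverse (P.op κ (-c)) ∘L adjoint P.S)

theorem contDiff_op (ν : ℝ) : ContDiff ℝ ω (fun κ => P.op κ ν) := by
  have : ContDiff ℝ ω (fun κ : ℝ => (κ : ℂ) • P.W) :=
    Complex.ofRealCLM.contDiff.fun_smul contDiff_const
  exact (contDiff_const.add this).sub contDiff_const

variable {P}

theorem IsShift.contDiffAt_inverse {κ c : ℝ} (h : P.IsShift κ c) :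
    ContDiffAt ℝ ω (fun x => Ring.inverse (P.op x (-c))) κ := by
  obtain ⟨u, hu⟩ := h.isUnit
  have : ContDiffAt ℝ ω Ring.inverse (P.op κ (-c)) := hu ▸ contDiffAt_ringInverse ℝ u
  exact this.comp κ (P.contDiff_op _).contDiffAt

theorem IsShift.contDiffAt_res {κ c : ℝ} (h : P.IsShift κ c) :
    ContDiffAt ℝ ω (P.res c) κ :=
  contDiffAt_const.complexClm_comp (h.contDiffAt_inverse.complexClm_comp contDiffAt_const)

theorem op_eq_add (P : SpectralPencil H) (κ ν c : ℝ) (w : H) :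
    P.op κ (-c) w = P.op κ ν w + ((ν + c : ℝ) : ℂ) • adjoint P.S (P.S w) := by
  simp only [op, _root_.sub_apply, _root_.add_apply, _root_.smul_apply,
    ContinuousLinearMap.comp_apply]
  push_cast
  module

theorem IsShift.inverse_op {κ c : ℝ} (h : P.IsShift κ c) (w : H) :
    Ring.inverse (P.op κ (-c)) (P.op κ (-c) w) = w :=
  congrArg (fun f => f w) (Ring.inverse_mul_cancel _ h.isUnit)

theorem IsShift.op_inverse {κ c : ℝ} (h : P.IsShift κ c) (w : H) :
    P.op κ (-c) (Ring.inverse (P.op κ (-c)) w) = w :=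
  congrArg (fun f => f w) (Ring.mul_inverse_cancel _ h.isUnit)

theorem IsShift.smul_inverse_of_mem_eig {κ c ν : ℝ} (h : P.IsShift κ c) {w : H}
    (hw : w ∈ P.eig κ ν) :
    ((ν + c : ℝ) : ℂ) • Ring.inverse (P.op κ (-c)) (adjoint P.S (P.S w)) = w := by
  have h1 := P.op_eq_add κ ν c w
  rw [show P.op κ ν w = 0 from hw, zero_add] at h1
  rw [← map_smul, ← h1, h.inverse_op]

/-- On an eigenvector coercivity reads `δ ‖w‖² ≤ (ν + c) ‖S w‖²`. -/
theorem IsShift.pos_of_mem_eig {κ c ν : ℝ} (h : P.IsShift κ c) {w : H} (hw : w ∈ P.eig κ ν)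
    (h0 : w ≠ 0) : 0 < ν + c := by
  have h1 := h.coercive w
  have h2 : P.form κ w - ν * ‖P.S w‖ ^ 2 = 0 := by
    rw [← re_inner_op, show P.op κ ν w = 0 from hw, inner_zero_right]; rfl
  rw [re_inner_op] at h1
  have h3 : 0 < P.δ * ‖w‖ ^ 2 := mul_pos P.δ_pos (by positivity)
  by_contra! h4
  nlinarith [sq_nonneg ‖P.S w‖]

theorem IsShift.mem_eig_of_mem_eigenspace {κ c τ : ℝ} (h : P.IsShift κ c) (hτ : τ ≠ 0) {f : H}
    (hf : P.res c κ f = (τ : ℂ) • f) :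
    P.S (Ring.inverse (P.op κ (-c)) (adjoint P.S f)) = (τ : ℂ) • f ∧
    Ring.inverse (P.op κ (-c)) (adjoint P.S f) ∈ P.eig κ (τ⁻¹ - c) := by
  refine ⟨hf, ?_⟩
  set w := Ring.inverse (P.op κ (-c)) (adjoint P.S f)
  have h1 : P.S w = (τ : ℂ) • f := hf
  have h2 := P.op_eq_add κ (τ⁻¹ - c) c w
  rw [h.op_inverse, h1, map_smul, smul_smul, sub_add_cancel, ← Complex.ofReal_mul,
    inv_mul_cancel₀ hτ, Complex.ofReal_one, one_smul] at h2
  exact right_eq_add.1 h2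

/-- Write `L = A + κW + c S*S`. The pencil equation says `L w = (ν + c) S*S w`; applying `S L⁻¹`
gives the resolvent equation for `f = S w`, and `w = (ν + c) L⁻¹ S* f` goes back. -/
theorem IsShift.map_eig {κ c ν : ℝ} (h : P.IsShift κ c) (hν : 0 < ν + c) :
    (P.eig κ ν).map (P.S : H →ₗ[ℂ] H) =
      eigenspace (P.res c κ : Module.End ℂ H) (((ν + c)⁻¹ : ℝ) : ℂ) := by
  have hc : ((ν + c : ℝ) : ℂ) ≠ 0 := by exact_mod_cast hν.ne'
  ext f
  constructor
  · rintro ⟨w, hw, rfl⟩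
    refine mem_eigenspace_iff.2 ?_
    have h1 := h.smul_inverse_of_mem_eig hw
    change P.S (Ring.inverse (P.op κ (-c)) (adjoint P.S (P.S w))) = _ • P.S w
    conv_rhs => rw [← h1]
    rw [map_smul, smul_smul, Complex.ofReal_inv, inv_mul_cancel₀ hc, one_smul]
  · intro hf
    obtain ⟨h1, h2⟩ := h.mem_eig_of_mem_eigenspace (inv_pos.2 hν).ne' (mem_eigenspace_iff.1 hf)
    rw [inv_inv, add_sub_cancel_right] at h2
    refine ⟨((ν + c : ℝ) : ℂ) • _, Submodule.smul_mem _ _ h2, ?_⟩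
    simp only [ContinuousLinearMap.coe_coe, map_smul]
    rw [h1, smul_smul, Complex.ofReal_inv, mul_inv_cancel₀ hc, one_smul]

theorem IsShift.eig_eq_bot {κ c ν : ℝ} (h : P.IsShift κ c) (hν : ν + c ≤ 0) : P.eig κ ν = ⊥ :=
  (Submodule.eq_bot_iff _).2 fun w hw => by
    by_contra h0
    exact absurd (h.pos_of_mem_eig hw h0) (not_lt.2 hν)

/-- The map `ν ↦ 1/(ν + c)` reverses the order on `ν > -c`, and there are no eigenvalues `ν ≤ -c`.
Lower spectral subspaces of the pencil thus become upper ones of the resolvent. -/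
theorem IsShift.map_sp {κ c x : ℝ} (h : P.IsShift κ c) (hx : 0 < x + c) :
    (P.sp κ x).map (P.S : H →ₗ[ℂ] H) = upperSpectralSubspace (P.res c κ) (x + c)⁻¹ := by
  rw [sp, Submodule.map_iSup]
  simp_rw [Submodule.map_iSup]
  refine le_antisymm (iSup₂_le fun ν hν => ?_) (iSup₂_le fun τ hτ => ?_)
  · rcases le_or_gt (ν + c) 0 with h0 | h0
    · rw [h.eig_eq_bot h0]; simp
    · rw [h.map_eig h0]
      refine eigenspace_le_upperSpectralSubspace (inv_anti₀ h0 ?_)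
      have : ν ≤ x := hν
      linarith
  · have h1 : 0 < τ := (inv_pos.2 hx).trans_le hτ
    have h2 : τ⁻¹ - c ≤ x := by
      have : τ⁻¹ ≤ x + c := by
        rw [← inv_inv (x + c)]; exact inv_anti₀ (inv_pos.2 hx) hτ
      linarith
    refine le_iSup₂_of_le (τ⁻¹ - c) h2 ?_
    rw [h.map_eig (by simpa using h1), sub_add_cancel, inv_inv]

variable (P)

theorem exists_isShift (κ x : ℝ) : ∃ c, P.IsShift κ c ∧ 0 < x + c :=
  ⟨1 + |κ| * P.hi + |x|, le_add_of_nonneg_right (abs_nonneg x), by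
    have h1 := neg_abs_le x
    have h2 : 0 ≤ |κ| * P.hi := mul_nonneg (abs_nonneg κ) P.hi_pos.le
    linarith⟩

/-- Restricting `S` to a subspace is an isomorphism onto the image. -/
def equivMap (F : Submodule ℂ H) : F ≃ₗ[ℂ] F.map (P.S : H →ₗ[ℂ] H) :=
  Submodule.equivMapOfInjective _ P.S_injective F

theorem finiteDimensional_sp (κ x : ℝ) : FiniteDimensional ℂ (P.sp κ x) := by
  obtain ⟨c, h, hx⟩ := P.exists_isShift κ x
  have := finiteDimensional_upperSpectralSubspace (P.selfAdjoint_res c κ) (P.compact_res c κ)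
    (inv_pos.2 hx)
  rw [← h.map_sp hx] at this
  exact (P.equivMap (P.sp κ x)).symm.finiteDimensional

/-- The min-max principle for the pencil. -/
theorem le_finrank_sp_iff (κ x : ℝ) (n : ℕ) : n ≤ Module.finrank ℂ (P.sp κ x) ↔
    ∃ F : Submodule ℂ H, n ≤ Module.finrank ℂ F ∧ ∀ w ∈ F, P.form κ w ≤ x * ‖P.S w‖ ^ 2 := by
  obtain ⟨c, h, hx⟩ := P.exists_isShift κ x
  set t := (x + c)⁻¹ with ht
  have ht0 : 0 < t := inv_pos.2 hx
  have hfr : Module.finrank ℂ (P.sp κ x) =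
      Module.finrank ℂ (upperSpectralSubspace (P.res c κ) t) := by
    rw [← h.map_sp hx]; exact (P.equivMap _).finrank_eq
  have hfd := finiteDimensional_upperSpectralSubspace (P.selfAdjoint_res c κ) (P.compact_res c κ)
    ht0
  rw [hfr]
  constructor
  · intro hn
    -- The trial subspace is the image under `L⁻¹ S*`, with `L = P.op κ (-c)`, of the upper spectral
    -- subspace of the resolvent.
    let B : H →ₗ[ℂ] H := (Ring.inverse (P.op κ (-c)) ∘L adjoint P.S).toLinearMap
    have hB : ∀ f, P.S (B f) = P.res c κ f := fun f => rfl
    have hlow : ∀ f ∈ upperSpectralSubspace (P.res c κ) t,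
        t * ‖f‖ ^ 2 ≤ (inner ℂ f (P.res c κ f)).re := fun f hf =>
      le_inner_map_of_mem (P.selfAdjoint_res c κ) (P.compact_res c κ) hf
    refine ⟨(upperSpectralSubspace (P.res c κ) t).map B, ?_, ?_⟩
    · have hinj : Function.Injective (B.domRestrict (upperSpectralSubspace (P.res c κ) t)) := by
        rw [injective_iff_map_eq_zero]
        intro f hf
        have h1 : P.res c κ f = 0 := by rw [← hB, show B f = 0 from hf, map_zero]
        have h2 := hlow f f.2
        rw [h1, inner_zero_right, Complex.zero_re] at h2
        have : ‖(f : H)‖ ^ 2 ≤ 0 := nonpos_of_mul_nonpos_right h2 ht0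
        have h3 : ‖(f : H)‖ = 0 := pow_eq_zero_iff two_ne_zero |>.1 (le_antisymm this (sq_nonneg _))
        exact Subtype.ext (norm_eq_zero.1 h3)
      rw [← LinearMap.range_domRestrict]
      exact hn.trans (LinearMap.finrank_range_of_inj hinj).ge
    · rintro _ ⟨f, hf, rfl⟩
      have h1 : (inner ℂ (B f) (P.op κ (-c) (B f))).re = (inner ℂ f (P.res c κ f)).re := by
        have : P.op κ (-c) (B f) = adjoint P.S f := h.op_inverse _
        rw [this, adjoint_inner_right, hB, ← inner_conj_symm, Complex.conj_re]
      rw [re_inner_op, hB] at h1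
      rw [hB]
      have h2 := hlow f hf
      have h3 : (inner ℂ f (P.res c κ f)).re ≤ ‖f‖ * ‖P.res c κ f‖ :=
        (Complex.re_le_norm _).trans (norm_inner_le_norm _ _)
      -- With `R` the resolvent, `t ‖f‖² ≤ ⟨f, R f⟩ ≤ ‖f‖ ‖R f‖` gives `‖f‖ ≤ (x + c) ‖R f‖`; a
      -- second use of Cauchy–Schwarz gives the claim.
      suffices hs : (inner ℂ f (P.res c κ f)).re ≤ (x + c) * ‖P.res c κ f‖ ^ 2 by linarith
      set a := (inner ℂ f (P.res c κ f)).re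
      rcases eq_or_ne f 0 with rfl | hf0
      · simp [a]
      have hfp : 0 < ‖f‖ := norm_pos_iff.2 hf0
      have h4 : t * ‖f‖ ≤ ‖P.res c κ f‖ := by
        have := h2.trans h3
        nlinarith
      have h5 : ‖f‖ ≤ (x + c) * ‖P.res c κ f‖ := by
        rwa [ht, inv_mul_le_iff₀ hx] at h4
      nlinarith [norm_nonneg (P.res c κ f)]
  · rintro ⟨F, hn, hF⟩
    have := (P.equivMap F).finrank_eq
    refine (hn.trans this.le).trans (finrank_le_of_le_inner_map (P.selfAdjoint_res c κ)
      (P.compact_res c κ) ht0 ?_)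
    rintro _ ⟨w, hw, rfl⟩
    have h0 := hF w hw
    set f := P.S w with hfd
    change t * ‖f‖ ^ 2 ≤ (inner ℂ f (P.res c κ f)).re
    set z := Ring.inverse (P.op κ (-c)) (adjoint P.S f) with hz
    have hz1 : P.op κ (-c) z = adjoint P.S f := h.op_inverse _
    have hz2 : P.S z = P.res c κ f := rfl
    have e1 : (inner ℂ w (P.op κ (-c) z)).re = ‖f‖ ^ 2 := by
      rw [hz1, adjoint_inner_right, ← hfd, inner_self_eq_norm_sq_to_K]
      norm_cast
    have e2 : (inner ℂ z (P.op κ (-c) w)).re = ‖f‖ ^ 2 := by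
      have := (P.selfAdjoint_op κ (-c)).isSymmetric w z
      simp only [ContinuousLinearMap.coe_coe] at this
      rw [← inner_conj_symm, Complex.conj_re, this, e1]
    have e3 : (inner ℂ z (P.op κ (-c) z)).re = (inner ℂ f (P.res c κ f)).re := by
      rw [hz1, adjoint_inner_right, hz2, ← inner_conj_symm, Complex.conj_re]
    have e4 : (inner ℂ w (P.op κ (-c) w)).re ≤ (x + c) * ‖f‖ ^ 2 := by
      rw [re_inner_op, ← hfd]; linarith
    -- Positivity of the shifted form at `w - (x + c) z` gives `0 ≤ ⟨w, L w⟩ - 2 (x + c) ‖f‖² + (x +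
    -- c)² ⟨f, R f⟩`, and the first term is at most `(x + c) ‖f‖²`.
    have e5 := (mul_nonneg P.δ_pos.le (sq_nonneg _)).trans
      (h.coercive (w - ((x + c : ℝ) : ℂ) • z))
    rw [map_sub, map_smul, inner_sub_left, inner_sub_right, inner_sub_right, inner_smul_left,
      inner_smul_left, inner_smul_right, inner_smul_right, Complex.conj_ofReal] at e5
    simp only [Complex.sub_re, Complex.re_ofReal_mul, e1, e2, e3] at e5
    have e6 : ‖f‖ ^ 2 ≤ (x + c) * (inner ℂ f (P.res c κ f)).re := by
      have : 0 ≤ (x + c) * ((x + c) * (inner ℂ f (P.res c κ f)).re - ‖f‖ ^ 2) := by nlinarith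
      have := nonneg_of_mul_nonneg_right this hx
      linarith
    rw [ht, inv_mul_le_iff₀ hx]
    exact e6

/-- The trial subspace for `κ` serves for `κ + h`, since the form grows by at most `hi h ‖S w‖²`. -/
theorem le_finrank_sp_add {κ x h : ℝ} (hh : 0 ≤ h) {n : ℕ}
    (hn : n ≤ Module.finrank ℂ (P.sp κ x)) :
    n ≤ Module.finrank ℂ (P.sp (κ + h) (x + P.hi * h)) := by
  rw [le_finrank_sp_iff] at hn ⊢
  obtain ⟨F, h1, h2⟩ := hn
  refine ⟨F, h1, fun w hw => ?_⟩
  have h3 := h2 w hw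
  have h4 := mul_le_mul_of_nonneg_left (P.le_hi w) hh
  rw [form] at h3 ⊢
  linarith

/-- The trial subspace for `κ + h` serves for `κ`, where the form is smaller by at least `lo h ‖S
w‖²`. This is the source of strict monotonicity. -/
theorem le_finrank_sp_sub {κ x h : ℝ} (hh : 0 ≤ h) {n : ℕ}
    (hn : n ≤ Module.finrank ℂ (P.sp (κ + h) x)) :
    n ≤ Module.finrank ℂ (P.sp κ (x - P.lo * h)) := by
  rw [le_finrank_sp_iff] at hn ⊢
  obtain ⟨F, h1, h2⟩ := hn
  refine ⟨F, h1, fun w hw => ?_⟩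
  have h3 := h2 w hw
  have h4 := mul_le_mul_of_nonneg_left (P.lo_le w) hh
  rw [form] at h3 ⊢
  linarith

/-- One nonzero trial vector suffices: its form is at least `-|κ| hi ‖S w‖²`, and is nonnegative for
`κ ≥ 0`. -/
theorem neg_le_of_one_le_finrank_sp {κ x : ℝ} (hn : 1 ≤ Module.finrank ℂ (P.sp κ x)) :
    -(|κ| * P.hi) ≤ x ∧ (0 ≤ κ → 0 ≤ x) := by
  rw [le_finrank_sp_iff] at hn
  obtain ⟨F, h1, h2⟩ := hn
  have : Nontrivial F := Module.nontrivial_of_finrank_pos (R := ℂ) h1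
  obtain ⟨w, hw⟩ := exists_ne (0 : F)
  have h3 := h2 w w.2
  have h4 : 0 < ‖P.S w‖ ^ 2 := by
    have : P.S w ≠ 0 := fun h => hw (Subtype.ext (P.S_injective (by rw [h]; simp)))
    positivity
  have h5 := P.neg_le_form κ w
  have h6 := P.A_nonneg w
  refine ⟨?_, fun hκ => ?_⟩
  · by_contra! h; nlinarith
  · have h7 : 0 ≤ P.form κ w := add_nonneg h6 (mul_nonneg hκ (P.re_inner_W_nonneg w))
    by_contra! h; nlinarith

/-- On an `n`-dimensional subspace the injective `S` is bounded below, so the bounded form of `A +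
κW` is dominated there by a multiple of `‖S w‖²`. -/
theorem exists_le_finrank_sp (hinf : ¬ FiniteDimensional ℂ H) (κ : ℝ) (n : ℕ) :
    ∃ x, n ≤ Module.finrank ℂ (P.sp κ x) := by
  obtain ⟨F, hF⟩ : ∃ F : Submodule ℂ H, Module.finrank ℂ F = n ∧ FiniteDimensional ℂ F := by
    have hr : (n : Cardinal) ≤ Module.rank ℂ H := by
      refine (Cardinal.natCast_lt_aleph0 (n := n)).le.trans ?_
      rw [← not_lt, Module.rank_lt_aleph0_iff]
      exact hinf
    obtain ⟨f, hf⟩ := exists_linearIndependent_of_le_rank hr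
    exact ⟨Submodule.span ℂ (range f), by
      rw [finrank_span_eq_card hf, Fintype.card_fin],
      FiniteDimensional.span_of_finite ℂ (finite_range f)⟩
  obtain ⟨h1, h2⟩ := hF
  obtain ⟨K, hK, hKa⟩ := LinearMap.exists_antilipschitzWith
    ((P.S : H →ₗ[ℂ] H).domRestrict F) (LinearMap.ker_eq_bot.2 fun a b hab =>
      Subtype.ext (P.S_injective hab))
  refine ⟨(‖P.A‖ + |κ| * ‖P.W‖) * K ^ 2, (P.le_finrank_sp_iff _ _ _).2 ⟨F, h1.ge, fun w hw => ?_⟩⟩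
  have h3 : ‖w‖ ≤ K * ‖P.S w‖ := by
    have := hKa.le_mul_norm_sub ⟨w, hw⟩ 0
    simpa using this
  have h4 : (inner ℂ w (P.A w)).re ≤ ‖P.A‖ * ‖w‖ ^ 2 := by
    refine (Complex.re_le_norm _).trans ((norm_inner_le_norm _ _).trans ?_)
    have := P.A.le_opNorm w
    nlinarith [norm_nonneg w]
  have h5 : (inner ℂ w (P.W w)).re ≤ ‖P.W‖ * ‖w‖ ^ 2 := by
    refine (Complex.re_le_norm _).trans ((norm_inner_le_norm _ _).trans ?_)
    have := P.W.le_opNorm w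
    nlinarith [norm_nonneg w]
  have h6 : κ * (inner ℂ w (P.W w)).re ≤ |κ| * (‖P.W‖ * ‖w‖ ^ 2) :=
    mul_le_mul (le_abs_self κ) h5 (P.re_inner_W_nonneg w) (abs_nonneg κ)
  have h7 : ‖w‖ ^ 2 ≤ K ^ 2 * ‖P.S w‖ ^ 2 := by
    rw [← mul_pow]; exact pow_le_pow_left₀ (norm_nonneg w) h3 2
  calc P.form κ w ≤ (‖P.A‖ + |κ| * ‖P.W‖) * ‖w‖ ^ 2 := by rw [form]; linarith
    _ ≤ (‖P.A‖ + |κ| * ‖P.W‖) * (K ^ 2 * ‖P.S w‖ ^ 2) := by gcongr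
    _ = _ := by ring

/-- For a suitable shift, eigenspaces of the pencil lie in eigenspaces of the single operator `(A +
κW + c S*S)⁻¹ S*S`, at distinct values `1/(ν + c)`. -/
theorem iSupIndep_eig (κ : ℝ) : iSupIndep (P.eig κ) := by
  obtain ⟨c, h, -⟩ := P.exists_isShift κ 0
  have h1 := Module.End.eigenspaces_iSupIndep
    ((Ring.inverse (P.op κ (-c)) ∘L adjoint P.S ∘L P.S : H →L[ℂ] H) : Module.End ℂ H)
  refine (h1.comp (f := fun ν : ℝ => ((ν + c : ℝ) : ℂ)⁻¹) fun a b hab => ?_).mono fun ν => ?_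
  · simpa using hab
  · intro w hw
    rcases eq_or_ne w 0 with rfl | h0
    · simp
    have h2 := h.smul_inverse_of_mem_eig hw
    have hc : ((ν + c : ℝ) : ℂ) ≠ 0 := by exact_mod_cast (h.pos_of_mem_eig hw h0).ne'
    refine mem_eigenspace_iff.2 ?_
    change Ring.inverse (P.op κ (-c)) (adjoint P.S (P.S w)) = _ • w
    conv_rhs => rw [← h2]
    rw [smul_smul, inv_mul_cancel₀ hc, one_smul]

/-- Symmetry of the pencil at `ν`, tested on `w` and `w'`, gives `(ν' - ν) ⟨S w, S w'⟩ = 0`. -/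
theorem inner_S_eq_zero {κ ν ν' : ℝ} (hν : ν ≠ ν') {w w' : H} (hw : w ∈ P.eig κ ν)
    (hw' : w' ∈ P.eig κ ν') : inner ℂ (P.S w) (P.S w') = 0 := by
  have h1 := (P.selfAdjoint_op κ ν).isSymmetric w w'
  simp only [ContinuousLinearMap.coe_coe] at h1
  have h2 := P.op_eq_add κ ν' (-ν) w'
  rw [neg_neg, show P.op κ ν' w' = 0 from hw', zero_add] at h2
  rw [show P.op κ ν w = 0 from hw, inner_zero_left, h2, inner_smul_right, inner_adjoint_S] at h1
  rcases mul_eq_zero.1 h1.symm with h3 | h3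
  · exact absurd (by exact_mod_cast h3) (by rw [← sub_eq_add_neg]; exact sub_ne_zero.2 hν.symm)
  · exact h3

end SpectralPencil

/-! ### Counting eigenvalues with multiplicity -/

/-- The spectral subspace of a family `V` of eigenspaces. -/
def partialSup {X : Type*} [AddCommGroup X] [Module ℂ X] (V : ℝ → Submodule ℂ X) (x : ℝ) :
    Submodule ℂ X := ⨆ ν ∈ Iic x, V ν

/-- The eigenvalues in increasing order. -/
def sortedEigenvalue {X : Type*} [AddCommGroup X] [Module ℂ X] (V : ℝ → Submodule ℂ X) (n : ℕ) :
    ℝ := sInf {x : ℝ | ((n + 1 : ℕ) : Cardinal) ≤ Module.rank ℂ (partialSup V x)}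

/-- A family of eigenspaces of an operator that is bounded below, with discrete spectrum tending
to infinity. -/
structure IsDiscreteSpectrum {X : Type*} [AddCommGroup X] [Module ℂ X] (V : ℝ → Submodule ℂ X) :
    Prop where
  indep : iSupIndep V
  finite : ∀ x, FiniteDimensional ℂ (partialSup V x)
  exists_le : ∀ n : ℕ, ∃ x, n ≤ Module.finrank ℂ (partialSup V x)
  bounded : ∃ b, ∀ x, 1 ≤ Module.finrank ℂ (partialSup V x) → b ≤ x

namespace IsDiscreteSpectrum

variable {X : Type*} [AddCommGroup X] [Module ℂ X] {V : ℝ → Submodule ℂ X}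

theorem partialSup_mono (V : ℝ → Submodule ℂ X) {x y : ℝ} (h : x ≤ y) :
    partialSup V x ≤ partialSup V y :=
  iSup₂_le fun ν hν => le_iSup₂_of_le ν (le_trans hν h) le_rfl

/-- Nonzero vectors chosen from independent eigenspaces are linearly independent, and these all lie
in a finite-dimensional space. -/
theorem finite_setOf_ne_bot (h : IsDiscreteSpectrum V) (x : ℝ) :
    {ν | ν ≤ x ∧ V ν ≠ ⊥}.Finite := by
  have := h.finite x
  have hc : ∀ ν : {ν | ν ≤ x ∧ V ν ≠ ⊥}, ∃ v ∈ V ν, v ≠ 0 := fun ν =>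
    (Submodule.ne_bot_iff _).1 ν.2.2
  choose v hv hv0 using hc
  have hli : LinearIndependent ℂ v := by
    have := (h.indep.comp (f := fun ν : {ν | ν ≤ x ∧ V ν ≠ ⊥} => (ν : ℝ)) Subtype.val_injective)
    exact this.linearIndependent _ hv hv0
  have hm : ∀ ν, v ν ∈ partialSup V x := fun ν =>
    (le_iSup₂_of_le (ν : ℝ) ν.2.1 le_rfl : V ν ≤ partialSup V x) (hv ν)
  have hli' : LinearIndependent ℂ (fun ν => (⟨v ν, hm ν⟩ : partialSup V x)) :=
    LinearIndependent.of_comp (partialSup V x).subtype hli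
  have := hli'.finite
  exact Set.toFinite _

/-- This is right-continuity of the counting function, which makes the infimum defining the sorted
eigenvalues a minimum. -/
theorem exists_gt_partialSup_eq (h : IsDiscreteSpectrum V) (x : ℝ) :
    ∃ y > x, partialSup V y = partialSup V x := by
  have hf : {ν | x < ν ∧ ν ≤ x + 1 ∧ V ν ≠ ⊥}.Finite :=
    (h.finite_setOf_ne_bot (x + 1)).subset fun ν hν => hν.2
  have h1 : ∀ᶠ y in 𝓝[>] x, y < x + 1 ∧ ∀ ν ∈ {ν | x < ν ∧ ν ≤ x + 1 ∧ V ν ≠ ⊥}, y < ν := by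
    refine (eventually_nhdsWithin_of_eventually_nhds (eventually_lt_nhds (by linarith))).and ?_
    rw [eventually_all_finite hf]
    exact fun ν hν => eventually_nhdsWithin_of_eventually_nhds (eventually_lt_nhds hν.1)
  obtain ⟨y, ⟨h2, h3⟩, h4⟩ := (h1.and eventually_mem_nhdsWithin).exists
  refine ⟨y, h4, le_antisymm (iSup₂_le fun ν hν => ?_) (partialSup_mono V (le_of_lt h4))⟩
  by_cases hx : ν ≤ x
  · exact le_iSup₂_of_le ν hx le_rfl
  · have hνy : ν ≤ y := hν
    by_cases hb : V ν = ⊥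
    · rw [hb]; exact bot_le
    · exact absurd (h3 ν ⟨not_le.1 hx, by linarith, hb⟩) (not_lt.2 hνy)

theorem exists_lt_partialSup_eq (h : IsDiscreteSpectrum V) (x : ℝ) :
    ∃ y < x, partialSup V x = partialSup V y ⊔ V x ∧ ∀ z, y < z → z < x → V z = ⊥ := by
  have hf : {ν | ν < x ∧ V ν ≠ ⊥}.Finite :=
    (h.finite_setOf_ne_bot x).subset fun ν hν => ⟨hν.1.le, hν.2⟩
  have h1 : ∀ᶠ y in 𝓝[<] x, ∀ ν ∈ {ν | ν < x ∧ V ν ≠ ⊥}, ν < y := by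
    rw [eventually_all_finite hf]
    exact fun ν hν => eventually_nhdsWithin_of_eventually_nhds (eventually_gt_nhds hν.1)
  obtain ⟨y, h3, h4⟩ := (h1.and eventually_mem_nhdsWithin).exists
  have h5 : ∀ z, y < z → z < x → V z = ⊥ := fun z hz1 hz2 => by
    by_contra hb
    exact absurd (h3 z ⟨hz2, hb⟩) (not_lt.2 hz1.le)
  refine ⟨y, h4, le_antisymm (iSup₂_le fun ν hν => ?_) (sup_le (partialSup_mono V (le_of_lt h4))
    (le_iSup₂_of_le x self_mem_Iic le_rfl)), h5⟩
  have hνx : ν ≤ x := hν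
  rcases hνx.eq_or_lt with rfl | hx
  · exact le_sup_right
  rcases le_or_gt ν y with hy | hy
  · exact le_sup_of_le_left (le_iSup₂_of_le ν hy le_rfl)
  · rw [h5 ν hy hx]; exact bot_le

theorem disjoint_partialSup (h : IsDiscreteSpectrum V) {y x : ℝ} (hxy : y < x) :
    Disjoint (partialSup V y) (V x) := by
  refine ((h.indep x).mono_right (iSup₂_le fun ν hν => ?_)).symm
  have hν' : ν ≤ y := hν
  exact le_iSup₂_of_le ν (by linarith) le_rfl

theorem finiteDimensional (h : IsDiscreteSpectrum V) (x : ℝ) : FiniteDimensional ℂ (V x) := by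
  have := h.finite x
  have hle : V x ≤ partialSup V x := le_iSup₂_of_le x self_mem_Iic le_rfl
  exact Submodule.finiteDimensional_of_le hle

/-- The numbering and the counting function are inverse to each other. The set in the definition is
nonempty and bounded below, so `sInf` is not its default value `0`, and right-continuity of the
count shows that the infimum is attained. -/
theorem sortedEigenvalue_le_iff (h : IsDiscreteSpectrum V) {n : ℕ} {x : ℝ} :
    sortedEigenvalue V n ≤ x ↔ n + 1 ≤ Module.finrank ℂ (partialSup V x) := by
  have hset : {x : ℝ | ((n + 1 : ℕ) : Cardinal) ≤ Module.rank ℂ (partialSup V x)} =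
      {x | n + 1 ≤ Module.finrank ℂ (partialSup V x)} := by
    ext x
    have := h.finite x
    simp only [Set.mem_ofPred_eq, ← Module.finrank_eq_rank, Nat.cast_le]
  have hmono : ∀ {x y : ℝ}, x ≤ y → n + 1 ≤ Module.finrank ℂ (partialSup V x) →
      n + 1 ≤ Module.finrank ℂ (partialSup V y) := fun {x y} hxy hx => by
    have := h.finite y
    exact hx.trans (Submodule.finrank_mono (partialSup_mono V hxy))
  obtain ⟨b, hb⟩ := h.bounded
  have hbd : BddBelow {x | n + 1 ≤ Module.finrank ℂ (partialSup V x)} :=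
    ⟨b, fun x hx => hb x (le_trans (by omega) hx)⟩
  rw [sortedEigenvalue, hset]
  constructor
  · intro hle
    obtain ⟨y, hy, hyx⟩ := h.exists_gt_partialSup_eq x
    obtain ⟨z, hz, hzy⟩ := exists_lt_of_csInf_lt (h.exists_le (n + 1)) (lt_of_le_of_lt hle hy)
    rw [← hyx]
    exact hmono hzy.le hz
  · exact fun hx => csInf_le hbd hx

theorem setOf_sortedEigenvalue_le (h : IsDiscreteSpectrum V) (x : ℝ) :
    {n | sortedEigenvalue V n ≤ x} = Iio (Module.finrank ℂ (partialSup V x)) := by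
  ext n
  exact h.sortedEigenvalue_le_iff.trans Nat.succ_le_iff

theorem finite_setOf_sortedEigenvalue_le (h : IsDiscreteSpectrum V) (x : ℝ) :
    {n | sortedEigenvalue V n ≤ x}.Finite := by
  rw [h.setOf_sortedEigenvalue_le]; exact finite_Iio _

/-- Every eigenvalue is repeated according to its multiplicity. -/
theorem ncard_setOf_sortedEigenvalue_eq (h : IsDiscreteSpectrum V) (x : ℝ) :
    {n | sortedEigenvalue V n = x}.ncard = Module.finrank ℂ (V x) := by
  obtain ⟨y, hy, hyx, hgap⟩ := h.exists_lt_partialSup_eq x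
  -- No eigenvalue lies strictly between `y` and `x`, so the indices with value `x` are those from
  -- the count at `y` up to the count at `x`; the difference of the counts is the dimension of `V
  -- x`.
  have hset : {n | sortedEigenvalue V n = x} = Iio (Module.finrank ℂ (partialSup V x)) \
      Iio (Module.finrank ℂ (partialSup V y)) := by
    rw [← h.setOf_sortedEigenvalue_le, ← h.setOf_sortedEigenvalue_le]
    ext n
    simp only [Set.mem_ofPred_eq, Set.mem_sdiff, not_le]
    refine ⟨fun hn => ⟨hn.le, hn ▸ hy⟩, fun ⟨h1, h2⟩ => ?_⟩
    by_contra hne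
    have h3 : sortedEigenvalue V n < x := lt_of_le_of_ne h1 hne
    set z := sortedEigenvalue V n with hz
    have h4 : partialSup V z = partialSup V y := by
      refine le_antisymm (iSup₂_le fun ν hν => ?_) (partialSup_mono V h2.le)
      have hν' : ν ≤ z := hν
      rcases le_or_gt ν y with hy' | hy'
      · exact le_iSup₂_of_le ν hy' le_rfl
      · rw [hgap ν hy' (by linarith)]; exact bot_le
    have h5 := h.sortedEigenvalue_le_iff.1 (le_refl z)
    rw [h4, ← h.sortedEigenvalue_le_iff] at h5
    exact absurd h5 (not_le.2 h2)
  have := h.finite y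
  have := h.finiteDimensional x
  have h6 := Submodule.finrank_sup_add_finrank_inf_eq (partialSup V y) (V x)
  rw [← hyx, (h.disjoint_partialSup hy).eq_bot, finrank_bot, add_zero] at h6
  rw [hset, Set.ncard_sdiff (Iio_subset_Iio (by omega)) (finite_Iio _), h6]
  simp [Set.ncard_eq_toFinset_card']

end IsDiscreteSpectrum

/-! ### Continuation of analytic germs to global branches -/

/-- Curves `E n` with a common Lipschitz constant, finitely many of them below any level. -/
structure IsLipschitzFamily (E : ℕ → ℝ → ℝ) (M : ℝ) : Prop where
  lipschitz : ∀ n x y, |E n x - E n y| ≤ M * |x - y|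
  finite : ∀ x c, {n | E n x ≤ c}.Finite

namespace IsLipschitzFamily

variable {E : ℕ → ℝ → ℝ} {M : ℝ} (h : IsLipschitzFamily E M)
include h

theorem exists_gap (x a : ℝ) (ha : ∀ n, E n x ≠ a) : ∃ ε > 0, ∀ n, ε ≤ |E n x - a| := by
  have h1 : ∀ᶠ ε : ℝ in 𝓝[>] 0, ε < 1 ∧ ∀ n ∈ {n | E n x ≤ a + 1}, ε < |E n x - a| := by
    refine (eventually_nhdsWithin_of_eventually_nhds (eventually_lt_nhds one_pos)).and ?_
    rw [eventually_all_finite (h.finite x (a + 1))]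
    exact fun n _ => eventually_nhdsWithin_of_eventually_nhds
      (eventually_lt_nhds (abs_pos.2 (sub_ne_zero.2 (ha n))))
  obtain ⟨ε, ⟨h2, h3⟩, h4⟩ := (h1.and eventually_mem_nhdsWithin).exists
  refine ⟨ε, h4, fun n => ?_⟩
  rcases le_or_gt (E n x) (a + 1) with h5 | h5
  · exact (h3 n h5).le
  · exact le_trans (by linarith) (le_abs_self _)

theorem exists_not_mem (x : ℝ) {c d : ℝ} (hcd : c < d) : ∃ b ∈ Ioo c d, ∀ n, E n x ≠ b := by
  have hf : ((fun n => E n x) '' {n | E n x ≤ d}).Finite := (h.finite x d).image _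
  obtain ⟨b, hb, hb'⟩ := ((Ioo_infinite hcd).sdiff hf).nonempty
  exact ⟨b, hb, fun n hn => hb' ⟨n, by rw [Set.mem_ofPred_eq, hn]; exact hb.2.le, hn⟩⟩

/-- At `x` all curves keep a positive distance from `a` and `b`, and the common Lipschitz constant
prevents every one of the infinitely many curves from crossing these levels nearby. -/
theorem eventually_window {x a b : ℝ} (ha : ∀ n, E n x ≠ a) (hb : ∀ n, E n x ≠ b) :
    ∀ᶠ y in 𝓝 x, (∀ n, E n y ∈ Ioo a b ↔ E n x ∈ Ioo a b) ∧ (∀ n, E n y ≠ a) ∧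
      ∀ n, E n y ≠ b := by
  obtain ⟨ε, hε, h1⟩ := h.exists_gap x a ha
  obtain ⟨δ, hδ, h2⟩ := h.exists_gap x b hb
  have ht : Tendsto (fun y => M * |y - x|) (𝓝 x) (𝓝 0) := by
    have : Continuous fun y => M * |y - x| := by fun_prop
    simpa using this.tendsto x
  filter_upwards [ht.eventually (eventually_lt_nhds hε), ht.eventually (eventually_lt_nhds hδ)]
    with y hy1 hy2
  have e1 : ∀ n, a < E n y ↔ a < E n x := fun n => by
    have := abs_le.1 (h.lipschitz n y x)
    have := le_abs.1 (h1 n)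
    constructor <;> intro h0 <;> rcases this with h' | h' <;> linarith
  have e2 : ∀ n, E n y < b ↔ E n x < b := fun n => by
    have := abs_le.1 (h.lipschitz n y x)
    have := le_abs.1 (h2 n)
    constructor <;> intro h0 <;> rcases this with h' | h' <;> linarith
  refine ⟨fun n => and_congr (e1 n) (e2 n), fun n h0 => ?_, fun n h0 => ?_⟩
  · have := abs_le.1 (h.lipschitz n y x)
    have := le_abs.1 (h1 n)
    rcases this with h' | h' <;> linarith
  · have := abs_le.1 (h.lipschitz n y x)
    have := le_abs.1 (h2 n)
    rcases this with h' | h' <;> linarith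

theorem finite_window (x a b : ℝ) : Finite {n // E n x ∈ Ioo a b} :=
  ((h.finite x b).subset fun _ (hn : _ ∈ Ioo a b) => hn.2.le : {n | E n x ∈ Ioo a b}.Finite)

end IsLipschitzFamily

/-- A Lipschitz family of curves `E n`, together with analytic germs `ℓ x n` at every point `x`
which locally rearrange the curves. -/
structure IsLocalBranching (E : ℕ → ℝ → ℝ) (ℓ : ℝ → ℕ → ℝ → ℝ) (M : ℝ) : Prop extends
    IsLipschitzFamily E M where
  analyticAt : ∀ x n, AnalyticAt ℝ (ℓ x n) x
  base : ∀ x n, ℓ x n x = E n x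
  deriv_le : ∀ x n, |deriv (ℓ x n) x| ≤ M
  rearrange : ∀ x a b, (∀ n, E n x ≠ a) → (∀ n, E n x ≠ b) → ∀ᶠ y in 𝓝 x,
    ∃ σ : Equiv.Perm {n // E n x ∈ Ioo a b}, ∀ n : {n // E n x ∈ Ioo a b}, ℓ x n y = E (σ n) y

/-- A function which coincides locally with one of the germs. -/
def IsBranchOn (ℓ : ℝ → ℕ → ℝ → ℝ) (f : ℝ → ℝ) (U : Set ℝ) : Prop :=
  ∀ x ∈ U, ∃ n, f =ᶠ[𝓝 x] ℓ x n

namespace IsLocalBranching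

variable {E : ℕ → ℝ → ℝ} {ℓ : ℝ → ℕ → ℝ → ℝ} {M : ℝ} (h : IsLocalBranching E ℓ M)
include h

theorem bound_nonneg : 0 ≤ M := (abs_nonneg _).trans (h.deriv_le 0 0)

theorem rearrange' {x a b : ℝ} (ha : ∀ n, E n x ≠ a) (hb : ∀ n, E n x ≠ b) {p : ℕ → Prop}
    (hp : ∀ n, E n x ∈ Ioo a b ↔ p n) :
    ∀ᶠ y in 𝓝 x, ∃ σ : Equiv.Perm {n // p n}, ∀ n : {n // p n}, ℓ x n y = E (σ n) y := by
  obtain rfl : (fun n => E n x ∈ Ioo a b) = p := funext fun n => propext (hp n)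
  exact h.rearrange x a b ha hb

/-- The germs at neighbouring points agree up to a permutation. -/
theorem eventually_germ_perm {x a b : ℝ} (ha : ∀ n, E n x ≠ a) (hb : ∀ n, E n x ≠ b) :
    ∀ᶠ y in 𝓝 x, ∃ σ : Equiv.Perm {n // E n x ∈ Ioo a b},
      ∀ n : {n // E n x ∈ Ioo a b}, ℓ x n =ᶠ[𝓝 y] ℓ y (σ n) := by
  have := h.finite_window x a b
  have han : ∀ᶠ y in 𝓝 x, ∀ n : {n // E n x ∈ Ioo a b}, AnalyticAt ℝ (ℓ x n) y := by
    rw [eventually_all]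
    exact fun n => (h.analyticAt x n).eventually_analyticAt
  filter_upwards [(h.rearrange x a b ha hb).eventually_nhds, h.eventually_window ha hb, han]
    with y h1 h2 h3
  have h4 := h.rearrange' h2.2.1 h2.2.2 h2.1
  have h5 : ∀ᶠ z in 𝓝 y, ∃ ρ : Equiv.Perm {n // E n x ∈ Ioo a b},
      ∀ n : {n // E n x ∈ Ioo a b}, ℓ x n z = ℓ y (ρ n) z := by
    filter_upwards [h1, h4] with z ⟨σ, hσ⟩ ⟨τ, hτ⟩
    exact ⟨σ.trans τ.symm, fun n => by rw [hσ, hτ]; simp⟩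
  have h6 : ∃ᶠ z in 𝓝[≠] y, ∃ ρ : Equiv.Perm {n // E n x ∈ Ioo a b},
      ∀ n : {n // E n x ∈ Ioo a b}, ℓ x n z = ℓ y (ρ n) z := (h5.filter_mono nhdsWithin_le_nhds).frequently
  -- The permutation depends on `z`, but there are only finitely many, so one of them occurs for `z`
  -- accumulating at `y`; the identity theorem then makes the germs equal.
  obtain ⟨ρ, hρ⟩ : ∃ ρ : Equiv.Perm {n // E n x ∈ Ioo a b},
      ∃ᶠ z in 𝓝[≠] y, ∀ n : {n // E n x ∈ Ioo a b}, ℓ x n z = ℓ y (ρ n) z := by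
    by_contra! hc
    exact h6 ((eventually_all.2 hc).mono fun z hz ⟨ρ, hρ⟩ => (hz ρ).elim fun n hn => hn (hρ n))
  exact ⟨ρ, fun n => ((h3 n).frequently_eq_iff_eventually_eq (h.analyticAt y _)).1
    (hρ.mono fun z hz => hz n)⟩

theorem analyticOnNhd_of_isBranchOn {f : ℝ → ℝ} {U : Set ℝ} (hf : IsBranchOn ℓ f U) :
    AnalyticOnNhd ℝ f U := fun x hx => by
  obtain ⟨n, hn⟩ := hf x hx
  exact (h.analyticAt x n).congr hn.symm

theorem norm_sub_le_of_isBranchOn {f : ℝ → ℝ} {U : Set ℝ} (hf : IsBranchOn ℓ f U)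
    (hU : U.OrdConnected) {x y : ℝ} (hx : x ∈ U) (hy : y ∈ U) : |f y - f x| ≤ M * |y - x| := by
  refine Convex.norm_image_sub_le_of_norm_deriv_le (𝕜 := ℝ)
    (fun z hz => (h.analyticOnNhd_of_isBranchOn hf z hz).differentiableAt) (fun z hz => ?_)
    hU.convex hx hy
  obtain ⟨n, hn⟩ := hf z hz
  rw [hn.deriv_eq]
  exact h.deriv_le z n

theorem eqOn_of_isBranchOn {f g : ℝ → ℝ} {U : Set ℝ} (hf : IsBranchOn ℓ f U)
    (hg : IsBranchOn ℓ g U) (hU : U.OrdConnected) {x : ℝ} (hx : x ∈ U) (hfg : f =ᶠ[𝓝 x] g) :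
    EqOn f g U :=
  (h.analyticOnNhd_of_isBranchOn hf).eqOn_of_preconnected_of_eventuallyEq
    (h.analyticOnNhd_of_isBranchOn hg) hU.isPreconnected hx hfg

/-- A germ with values in a bounded window continues to a uniform neighbourhood. -/
theorem exists_uniform_radius (b Q : ℝ) : ∃ r > 0, r ≤ 1 ∧ ∀ x ∈ Metric.ball b r, ∀ n,
    |E n x| ≤ Q → ∃ m, ℓ x n =ᶠ[𝓝 x] ℓ b m ∧ IsBranchOn ℓ (ℓ b m) (Metric.ball b r) := by
  -- The window has to contain `[-Q, Q]` and its end levels must avoid all the values `E n b`.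
  obtain ⟨a₁, ha₁, ha⟩ := h.exists_not_mem b (show -Q - 1 < -Q by linarith)
  obtain ⟨a₂, ha₂, hb⟩ := h.exists_not_mem b (show Q < Q + 1 by linarith)
  obtain ⟨r, hr, hball⟩ := Metric.eventually_nhds_iff_ball.1
    ((h.eventually_germ_perm ha hb).and (h.eventually_window ha hb))
  refine ⟨min r 1, lt_min hr one_pos, min_le_right _ _, fun x hx n hn => ?_⟩
  have hsub : Metric.ball b (min r 1) ⊆ Metric.ball b r := Metric.ball_subset_ball (min_le_left _ _)
  obtain ⟨⟨σ, hσ⟩, hw, -⟩ := hball x (hsub hx)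
  have hn' : E n b ∈ Ioo a₁ a₂ := (hw n).1
    ⟨by linarith [(abs_le.1 hn).1, ha₁.2], by linarith [(abs_le.1 hn).2, ha₂.1]⟩
  refine ⟨σ.symm ⟨n, hn'⟩, ?_, fun y hy => ?_⟩
  · have := hσ (σ.symm ⟨n, hn'⟩)
    rw [Equiv.apply_symm_apply] at this
    exact this.symm
  · obtain ⟨⟨τ, hτ⟩, -⟩ := hball y (hsub hy)
    exact ⟨_, hτ _⟩

/-- Every germ continues to a branch on the whole line. -/
theorem exists_global_branch (x₀ : ℝ) (n₀ : ℕ) :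
    ∃ f : ℝ → ℝ, f =ᶠ[𝓝 x₀] ℓ x₀ n₀ ∧ IsBranchOn ℓ f univ := by
  -- `C x` says that the germ continues along an interval from `x₀` to `x`. It is shown to be a
  -- clopen condition.
  let C : ℝ → Prop := fun x => ∃ (U : Set ℝ) (f : ℝ → ℝ), IsOpen U ∧ U.OrdConnected ∧ x₀ ∈ U ∧
    x ∈ U ∧ f =ᶠ[𝓝 x₀] ℓ x₀ n₀ ∧ IsBranchOn ℓ f U
  have step : ∀ b, ∃ r > 0, ∀ x ∈ Metric.ball b r, ∀ y ∈ Metric.ball b r, C x → C y := by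
    intro b
    -- By the derivative bound, no continuation can exceed this value at a point within distance `1`
    -- of `b`. Therefore the radius depends on `b` only, and the step works in both directions,
    -- giving openness and closedness.
    obtain ⟨r, hr, hr1, hrad⟩ := h.exists_uniform_radius b (|E n₀ x₀| + M * (|b - x₀| + 1))
    refine ⟨r, hr, fun x hx y hy ⟨U, f, hUo, hUc, hx₀, hxU, hf, hfU⟩ => ?_⟩
    obtain ⟨n, hn⟩ := hfU x hxU
    have hfx : f x = E n x := hn.self_of_nhds.trans (h.base x n)
    have hfx₀ : f x₀ = E n₀ x₀ := hf.self_of_nhds.trans (h.base x₀ n₀)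
    have hb : |E n x| ≤ |E n₀ x₀| + M * (|b - x₀| + 1) := by
      have h1 := h.norm_sub_le_of_isBranchOn hfU hUc hx₀ hxU
      rw [hfx, hfx₀] at h1
      have h2 : |x - x₀| ≤ |b - x₀| + 1 := by
        have h3 : |x - b| < r := by rwa [Metric.mem_ball, Real.dist_eq] at hx
        have := abs_sub_le x b x₀
        linarith
      have h3 := mul_le_mul_of_nonneg_left h2 h.bound_nonneg
      have h4 := abs_sub_abs_le_abs_sub (E n x) (E n₀ x₀)
      linarith
    obtain ⟨m, hm, hmb⟩ := hrad x hx n hb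
    have hVc : (Metric.ball b r).OrdConnected := by
      rw [Real.ball_eq_Ioo]; exact ordConnected_Ioo
    have hagree : EqOn f (ℓ b m) (U ∩ Metric.ball b r) :=
      h.eqOn_of_isBranchOn (fun z hz => hfU z hz.1) (fun z hz => hmb z hz.2) (hUc.inter hVc)
        ⟨hxU, hx⟩ (hn.trans hm)
    classical
    let F : ℝ → ℝ := fun z => if z ∈ U then f z else ℓ b m z
    have hF1 : ∀ z ∈ U, F =ᶠ[𝓝 z] f := fun z hz => by
      filter_upwards [hUo.mem_nhds hz] with t ht
      simp [F, ht]
    have hF2 : ∀ z ∈ Metric.ball b r, F =ᶠ[𝓝 z] ℓ b m := fun z hz => by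
      filter_upwards [Metric.isOpen_ball.mem_nhds hz] with t ht
      by_cases htU : t ∈ U
      · simp only [F, htU, if_true]; exact hagree ⟨htU, ht⟩
      · simp [F, htU]
    refine ⟨U ∪ Metric.ball b r, F, hUo.union Metric.isOpen_ball, ?_, Or.inl hx₀, Or.inr hy,
      (hF1 x₀ hx₀).trans hf, ?_⟩
    · exact (IsPreconnected.union x hxU hx hUc.isPreconnected hVc.isPreconnected).ordConnected
    · rintro z (hz | hz)
      · obtain ⟨k, hk⟩ := hfU z hz
        exact ⟨k, (hF1 z hz).trans hk⟩
      · obtain ⟨k, hk⟩ := hmb z hz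
        exact ⟨k, (hF2 z hz).trans hk⟩
  have hC0 : C x₀ := by
    obtain ⟨r, hr, -, hrad⟩ := h.exists_uniform_radius x₀ |E n₀ x₀|
    obtain ⟨m, hm, hmb⟩ := hrad x₀ (Metric.mem_ball_self hr) n₀ le_rfl
    exact ⟨Metric.ball x₀ r, ℓ x₀ m, Metric.isOpen_ball, by
      rw [Real.ball_eq_Ioo]; exact ordConnected_Ioo, Metric.mem_ball_self hr,
      Metric.mem_ball_self hr, hm.symm, hmb⟩
  have hclopen : IsClopen {x | C x} := by
    refine ⟨⟨Metric.isOpen_iff.2 fun b hb => ?_⟩, Metric.isOpen_iff.2 fun b hb => ?_⟩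
    · obtain ⟨r, hr, hs⟩ := step b
      exact ⟨r, hr, fun y hy hCy => hb (hs y hy b (Metric.mem_ball_self hr) hCy)⟩
    · obtain ⟨r, hr, hs⟩ := step b
      exact ⟨r, hr, fun y hy => hs b (Metric.mem_ball_self hr) y hy hb⟩
  have hall : ∀ x, C x := fun x => by
    have : {x | C x} = univ := hclopen.eq_univ ⟨x₀, hC0⟩
    exact this.ge (mem_univ x)
  -- Continuations to different points agree on the intersection of their intervals, which contains
  -- `x₀`; the diagonal `y ↦ f y y` glues them.
  choose U f hUo hUc hx₀ hxU hf hfU using hall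
  have hglue : ∀ x, ∀ y ∈ U x, f y y = f x y := fun x y hy =>
    h.eqOn_of_isBranchOn (fun z hz => hfU y z hz.1) (fun z hz => hfU x z hz.2)
      ((hUc y).inter (hUc x)) ⟨hx₀ y, hx₀ x⟩ ((hf y).trans (hf x).symm) ⟨hxU y, hy⟩
  have hF : ∀ x, (fun y => f y y) =ᶠ[𝓝 x] f x := fun x => by
    filter_upwards [(hUo x).mem_nhds (hxU x)] with y hy using hglue x y hy
  refine ⟨fun y => f y y, (hF x₀).trans (hf x₀), fun x _ => ?_⟩
  obtain ⟨n, hn⟩ := hfU x x (hxU x)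
  exact ⟨n, (hF x).trans hn⟩

/-- Global analytic branches which, at every point, are a rearrangement of the given germs. -/
theorem exists_global_branches : ∃ Λ : ℕ → ℝ → ℝ, (∀ n, AnalyticOnNhd ℝ (Λ n) univ) ∧
    ∀ x, ∃ σ : Equiv.Perm ℕ, ∀ n, Λ n =ᶠ[𝓝 x] ℓ x (σ n) := by
  choose ext hext hbr using h.exists_global_branch
  have huniq : ∀ {f g : ℝ → ℝ}, IsBranchOn ℓ f univ → IsBranchOn ℓ g univ → ∀ {x : ℝ},
      f =ᶠ[𝓝 x] g → f = g := fun hf hg x hfg =>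
    funext fun y => h.eqOn_of_isBranchOn hf hg ordConnected_univ (mem_univ x) hfg (mem_univ y)
  have hval : ∀ x n, ext x n x = E n x := fun x n => (hext x n).self_of_nhds.trans (h.base x n)
  have hfin : ∀ x g, {n | ext x n = g}.Finite := fun x g =>
    (h.finite x (g x)).subset fun n (hn : ext x n = g) => by
      rw [Set.mem_ofPred_eq, ← hval, hn]
  -- Several germs at `x` may continue to the same `g`. Their number is locally constant in `x`,
  -- since nearby germs agree up to a permutation of the indices in a window around `g b`.
  have hcount : ∀ g, IsBranchOn ℓ g univ → ∀ x y,
      {n | ext x n = g}.ncard = {n | ext y n = g}.ncard := by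
    intro g hg
    have hlc : IsLocallyConstant fun x => {n | ext x n = g}.ncard := by
      rw [IsLocallyConstant.iff_eventually_eq]
      intro b
      obtain ⟨a₁, ha₁, ha⟩ := h.exists_not_mem b (show g b - 1 < g b by linarith)
      obtain ⟨a₂, ha₂, hb⟩ := h.exists_not_mem b (show g b < g b + 1 by linarith)
      have := h.finite_window b a₁ a₂
      have hgc : ∀ᶠ y in 𝓝 b, g y ∈ Ioo a₁ a₂ :=
        (h.analyticOnNhd_of_isBranchOn hg b (mem_univ b)).continuousAt.eventually
          (Ioo_mem_nhds ha₁.2 ha₂.1)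
      have hexb : ∀ᶠ y in 𝓝 b, ∀ n : {n // E n b ∈ Ioo a₁ a₂}, ext b n =ᶠ[𝓝 y] ℓ b n := by
        rw [eventually_all]
        exact fun n => (hext b n).eventually_nhds
      filter_upwards [h.eventually_germ_perm ha hb, h.eventually_window ha hb, hgc, hexb]
        with y ⟨σ, hσ⟩ ⟨hw, _⟩ hgy hy
      have hσ' : ∀ n, ext y (σ n) = ext b n := fun n =>
        huniq (hbr _ _) (hbr _ _) ((hext y _).trans ((hσ n).symm.trans (hy n).symm))
      have hmem : ∀ n, ext b n = g → E n b ∈ Ioo a₁ a₂ := fun n hn => by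
        rw [← hval, hn]; exact ⟨ha₁.2, ha₂.1⟩
      refine (Set.ncard_congr (fun n hn => (σ ⟨n, hmem n hn⟩ : ℕ)) ?_ ?_ ?_).symm
      · intro n hn
        exact (hσ' _).trans hn
      · intro n m hn hm hnm
        have := σ.injective (Subtype.ext hnm)
        exact congrArg Subtype.val this
      · intro n hn
        have hnw : E n b ∈ Ioo a₁ a₂ := by
          rw [← hw, ← hval, show ext y n = g from hn]; exact hgy
        refine ⟨σ.symm ⟨n, hnw⟩, ?_, by simp⟩
        have := hσ' (σ.symm ⟨n, hnw⟩)
        rw [Equiv.apply_symm_apply] at this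
        exact this.symm.trans hn
    exact fun x y => hlc.apply_eq_of_preconnectedSpace x y
  refine ⟨ext 0, fun n => h.analyticOnNhd_of_isBranchOn (hbr 0 n), fun x => ?_⟩
  -- The branches started at the arbitrary base point `0` are matched with those started at `x`
  -- fibre by fibre; the fibre bijections assemble to a permutation of `ℕ`.
  have hequiv : ∀ g, Nonempty ({n // ext 0 n = g} ≃ {n // ext x n = g}) := fun g => by
    by_cases hg : IsBranchOn ℓ g univ
    · have e1 : Finite {n // ext 0 n = g} := hfin 0 g
      have e2 : Finite {n // ext x n = g} := hfin x g
      exact Finite.card_eq.1 (hcount g hg 0 x)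
    · have e1 : IsEmpty {n // ext 0 n = g} := ⟨fun n => hg (n.2 ▸ hbr 0 n)⟩
      have e2 : IsEmpty {n // ext x n = g} := ⟨fun n => hg (n.2 ▸ hbr x n)⟩
      exact ⟨Equiv.equivOfIsEmpty _ _⟩
  let e := fun g => (hequiv g).some
  let σ : ℕ ≃ ℕ := (Equiv.sigmaFiberEquiv (ext 0)).symm.trans
    ((Equiv.sigmaCongrRight e).trans (Equiv.sigmaFiberEquiv (ext x)))
  have hσ : ∀ n, ext x (σ n) = ext 0 n := fun n => (e (ext 0 n) ⟨n, rfl⟩).2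
  exact ⟨σ, fun n => by rw [← hσ n]; exact hext x (σ n)⟩

end IsLocalBranching

/-! ### Eigenvalue branches of the pencil -/

/-- Injections between the fibres assemble to an injective self-map of a finite set, hence a
permutation. An inequality of fibre sizes suffices, and orthonormal families of eigenvectors yield
precisely such an inequality. -/
theorem exists_perm_of_card_fiber_le {ι β : Type*} [Finite ι] (f g : ι → β)
    (h : ∀ b, Nat.card {i // f i = b} ≤ Nat.card {i // g i = b}) :
    ∃ σ : Equiv.Perm ι, ∀ i, f i = g (σ i) := by
  have hinj : ∀ b, ∃ e : {i // f i = b} → {i // g i = b}, Function.Injective e := fun b => by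
    have := Fintype.ofFinite {i // f i = b}
    have := Fintype.ofFinite {i // g i = b}
    have h1 := h b
    rw [Nat.card_eq_fintype_card, Nat.card_eq_fintype_card] at h1
    obtain ⟨e⟩ := Function.Embedding.nonempty_of_card_le h1
    exact ⟨e, e.injective⟩
  choose e he using hinj
  let s : ι → ι := fun i => e (f i) ⟨i, rfl⟩
  have hs : ∀ i, g (s i) = f i := fun i => (e (f i) ⟨i, rfl⟩).2
  have hsi : Function.Injective s := by
    intro i j hij
    have h1 : f i = f j := by rw [← hs i, ← hs j, hij]
    have h2 : ∀ b (hi : f i = b) (hj : f j = b), e b ⟨i, hi⟩ = e b ⟨j, hj⟩ := by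
      rintro b rfl hj
      refine Subtype.ext (hij.trans ?_)
      have : ∀ c (hc : f j = c), (e (f j) ⟨j, rfl⟩ : ι) = e c ⟨j, hc⟩ := by rintro c rfl; rfl
      exact this _ hj
    exact congrArg Subtype.val (he _ (h2 (f j) h1 rfl))
  exact ⟨Equiv.ofBijective s (Finite.injective_iff_bijective.1 hsi), fun i => (hs i).symm⟩

namespace SpectralPencil

open ContinuousLinearMap Module.End

variable {H : Type*} [NormedAddCommGroup H] [InnerProductSpace ℂ H] [CompleteSpace H]
  (P : SpectralPencil H)

/-- The Rayleigh quotient of `W` with respect to `S†S`. -/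
def rayleigh (w : H) : ℝ := (inner ℂ w (P.W w)).re / ‖P.S w‖ ^ 2

theorem norm_S_pos {w : H} (hw : w ≠ 0) : 0 < ‖P.S w‖ :=
  norm_pos_iff.2 fun h => hw (P.S_injective (by rw [h, map_zero]))

theorem rayleigh_mem_Icc {w : H} (hw : w ≠ 0) : P.rayleigh w ∈ Icc P.lo P.hi := by
  have h := pow_pos (P.norm_S_pos hw) 2
  exact ⟨(le_div_iff₀ h).2 (P.lo_le w), (div_le_iff₀ h).2 (P.le_hi w)⟩

theorem rayleigh_smul {a : ℂ} (ha : a ≠ 0) (w : H) : P.rayleigh (a • w) = P.rayleigh w := by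
  have h1 : 0 < ‖a‖ := norm_pos_iff.2 ha
  have h2 : (inner ℂ (a • w) (P.W (a • w))).re = ‖a‖ ^ 2 * (inner ℂ w (P.W w)).re := by
    rw [map_smul, inner_smul_left, inner_smul_right, ← mul_assoc, mul_comm _ a,
      Complex.mul_conj, Complex.normSq_eq_norm_sq, Complex.re_ofReal_mul]
  rw [rayleigh, h2, map_smul, norm_smul, mul_pow,
    mul_div_mul_left _ _ (pow_pos h1 2).ne', rayleigh]

theorem op_apply_eq_add (κ κ₀ ν ν₀ : ℝ) (w : H) :
    P.op κ ν w = P.op κ₀ ν₀ w + ((κ - κ₀ : ℝ) : ℂ) • P.W w -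
      ((ν - ν₀ : ℝ) : ℂ) • adjoint P.S (P.S w) := by
  simp only [op, _root_.sub_apply, _root_.add_apply, _root_.smul_apply,
    ContinuousLinearMap.comp_apply]
  push_cast
  module

/-- The Hellmann–Feynman formula. -/
theorem hasDerivAt_of_mem_eig {lam : ℝ → ℝ} {w : ℝ → H} {κ₀ : ℝ} (hw : ContinuousAt w κ₀)
    (hmem : ∀ᶠ κ in 𝓝 κ₀, w κ ∈ P.eig κ (lam κ)) (h0 : w κ₀ ≠ 0) :
    HasDerivAt lam (P.rayleigh (w κ₀)) κ₀ := by
  have hpos := pow_pos (P.norm_S_pos h0) 2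
  have hb : w κ₀ ∈ P.eig κ₀ (lam κ₀) := hmem.self_of_nhds
  have hd : ContinuousAt (fun κ => (inner ℂ (w κ₀) (P.W (w κ))).re) κ₀ := by fun_prop
  have hs : ContinuousAt (fun κ => (inner ℂ (P.S (w κ₀)) (P.S (w κ))).re) κ₀ := by fun_prop
  have hs0 : (inner ℂ (P.S (w κ₀)) (P.S (w κ₀))).re = ‖P.S (w κ₀)‖ ^ 2 := by
    rw [inner_self_eq_norm_sq_to_K]; norm_cast
  have hq : Tendsto (fun κ => (inner ℂ (w κ₀) (P.W (w κ))).re /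
      (inner ℂ (P.S (w κ₀)) (P.S (w κ))).re) (𝓝 κ₀) (𝓝 (P.rayleigh (w κ₀))) := by
    have := (hd.div hs (by rw [hs0]; exact hpos.ne')).tendsto
    simp only [Pi.div_apply, hs0] at this
    exact this
  rw [hasDerivAt_iff_tendsto_slope]
  refine (hq.mono_left nhdsWithin_le_nhds).congr' ?_
  have hne : ∀ᶠ κ in 𝓝 κ₀, (inner ℂ (P.S (w κ₀)) (P.S (w κ))).re ≠ 0 :=
    hs.eventually_ne (by rw [hs0]; exact hpos.ne')
  filter_upwards [eventually_nhdsWithin_of_eventually_nhds hmem,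
    eventually_nhdsWithin_of_eventually_nhds hne, eventually_mem_nhdsWithin] with κ h1 h2 h3
  have h4 : κ - κ₀ ≠ 0 := sub_ne_zero.2 h3
  -- Pairing with `w κ₀` removes the pencil at `κ₀` by self-adjointness and leaves `(κ - κ₀) ⟨w κ₀,
  -- W w κ⟩ = (lam κ - lam κ₀) ⟨S w κ₀, S w κ⟩` in real parts. The difference quotient is exact, so
  -- continuity of `w` is enough.
  have h5 := P.op_apply_eq_add κ κ₀ (lam κ) (lam κ₀) (w κ)
  rw [show P.op κ (lam κ) (w κ) = 0 from h1] at h5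
  have h6 := congrArg (fun v => (inner ℂ (w κ₀) v).re) h5
  have h7 := (P.selfAdjoint_op κ₀ (lam κ₀)).isSymmetric (w κ₀) (w κ)
  simp only [ContinuousLinearMap.coe_coe] at h7
  rw [show P.op κ₀ (lam κ₀) (w κ₀) = 0 from hb, inner_zero_left] at h7
  simp only [inner_zero_right, inner_sub_right, inner_add_right, inner_smul_right,
    inner_adjoint_S, ← h7, Complex.sub_re, Complex.add_re, Complex.re_ofReal_mul,
    Complex.zero_re] at h6
  rw [slope_def_field, div_eq_div_iff h2 h4]
  linarith

/-- Analytic eigenvalue curves through an eigenvalue, with an orthonormal frame of eigenvectors. -/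
theorem exists_local_frame (κ₀ ν₀ : ℝ) :
    ∃ (lam : Fin (Module.finrank ℂ (P.eig κ₀ ν₀)) → ℝ → ℝ)
      (w : Fin (Module.finrank ℂ (P.eig κ₀ ν₀)) → ℝ → H),
      (∀ i, AnalyticAt ℝ (lam i) κ₀) ∧ (∀ i, lam i κ₀ = ν₀) ∧ (∀ i, ContinuousAt (w i) κ₀) ∧
      (∀ᶠ κ in 𝓝 κ₀, ∀ i, w i κ ∈ P.eig κ (lam i κ)) ∧
      ∀ᶠ κ in 𝓝 κ₀, Orthonormal ℂ (fun i => P.S (w i κ)) := by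
  -- A shift valid for `|κ₀| + 1` is valid near `κ₀`, so a single resolvent family can be used.
  obtain ⟨c, h₀, hc, hsh⟩ : ∃ c, P.IsShift κ₀ c ∧ 0 < ν₀ + c ∧ ∀ᶠ κ in 𝓝 κ₀, P.IsShift κ c := by
    obtain ⟨c, h1, h2⟩ := P.exists_isShift (|κ₀| + 1) ν₀
    have h3 : ∀ κ, |κ| < |κ₀| + 1 → P.IsShift κ c := fun κ hκ => by
      rw [IsShift] at h1 ⊢
      have := mul_le_mul_of_nonneg_right (hκ.le.trans (le_abs_self _)) P.hi_pos.le
      linarith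
    refine ⟨c, h3 κ₀ (by linarith), h2, ?_⟩
    exact (continuous_abs.continuousAt.eventually_lt continuousAt_const (by simp)).mono h3
  have hτ : (ν₀ + c)⁻¹ ≠ 0 := (inv_pos.2 hc).ne'
  have hframe := exists_eigenframe h₀.contDiffAt_res
    (Eventually.of_forall fun κ => P.selfAdjoint_res c κ) (P.compact_res c κ₀) hτ
  rw [← h₀.map_eig hc, ← (P.equivMap _).finrank_eq] at hframe
  obtain ⟨τ, f, hf, hτ0⟩ := hframe
  have hne : ∀ᶠ κ in 𝓝 κ₀, ∀ i, τ i κ ≠ 0 := eventually_all.2 fun i =>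
    (hf.contDiffAt_lam i).continuousAt.eventually_ne (by rw [hτ0]; exact hτ)
  have hS : ∀ᶠ κ in 𝓝 κ₀, ∀ i, P.S ((((τ i κ)⁻¹ : ℝ) : ℂ) •
      Ring.inverse (P.op κ (-c)) (adjoint P.S (f i κ))) = f i κ ∧
      Ring.inverse (P.op κ (-c)) (adjoint P.S (f i κ)) ∈ P.eig κ ((τ i κ)⁻¹ - c) := by
    filter_upwards [hne, hf.eigen, hsh] with κ h1 h2 h3 i
    obtain ⟨h4, h5⟩ := h3.mem_eig_of_mem_eigenspace (h1 i) (h2 i)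
    refine ⟨?_, h5⟩
    rw [map_smul, h4, smul_smul, ← Complex.ofReal_mul, inv_mul_cancel₀ (h1 i), Complex.ofReal_one,
      one_smul]
  -- Inverting `τ = 1/(ν + c)` gives the eigenvalue; the factor `1/τ` normalizes the eigenvector so
  -- that `S` maps it exactly to the unit vector `f i κ`.
  refine ⟨fun i κ => (τ i κ)⁻¹ - c, fun i κ => (((τ i κ)⁻¹ : ℝ) : ℂ) •
    Ring.inverse (P.op κ (-c)) (adjoint P.S (f i κ)), fun i => ?_, fun i => ?_, fun i => ?_, ?_, ?_⟩
  · exact (((hf.contDiffAt_lam i).analyticAt).inv (by rw [hτ0]; exact hτ)).sub analyticAt_const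
  · change (τ i κ₀)⁻¹ - c = ν₀
    rw [hτ0]; simp
  · have h1 : ContinuousAt (fun κ => (((τ i κ)⁻¹ : ℝ) : ℂ)) κ₀ :=
      Complex.continuous_ofReal.continuousAt.comp
        ((hf.contDiffAt_lam i).continuousAt.inv₀ (by rw [hτ0]; exact hτ))
    exact h1.smul (h₀.contDiffAt_inverse.complexClm_apply
      ((contDiffAt_const (c := adjoint P.S)).complexClm_apply (hf.contDiffAt_w i))).continuousAt
  · filter_upwards [hS] with κ h1 i
    exact Submodule.smul_mem _ _ (h1 i).2
  · filter_upwards [hS, hf.orthonormal] with κ h1 h2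
    simpa only [fun i => (h1 i).1] using h2

/-- The eigenvalues of the pencil in increasing order. -/
def ev (n : ℕ) (κ : ℝ) : ℝ := sortedEigenvalue (P.eig κ) n

variable {P} (hinf : ¬ FiniteDimensional ℂ H)
include hinf

theorem isDiscreteSpectrum (κ : ℝ) : IsDiscreteSpectrum (P.eig κ) where
  indep := P.iSupIndep_eig κ
  finite := P.finiteDimensional_sp κ
  exists_le := P.exists_le_finrank_sp hinf κ
  bounded := ⟨_, fun _ hx => (P.neg_le_of_one_le_finrank_sp hx).1⟩

theorem ev_le_iff {n : ℕ} {κ x : ℝ} : P.ev n κ ≤ x ↔ n + 1 ≤ Module.finrank ℂ (P.sp κ x) :=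
  (isDiscreteSpectrum hinf κ).sortedEigenvalue_le_iff

theorem ev_add_le (n : ℕ) {κ h : ℝ} (hh : 0 ≤ h) : P.ev n (κ + h) ≤ P.ev n κ + P.hi * h :=
  (ev_le_iff hinf).2 (P.le_finrank_sp_add hh ((ev_le_iff hinf).1 le_rfl))

theorem le_ev_add (n : ℕ) {κ h : ℝ} (hh : 0 ≤ h) : P.ev n κ + P.lo * h ≤ P.ev n (κ + h) :=
  le_sub_iff_add_le.1 ((ev_le_iff hinf).2 (P.le_finrank_sp_sub hh ((ev_le_iff hinf).1 le_rfl)))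

theorem ev_nonneg (n : ℕ) {κ : ℝ} (hκ : 0 ≤ κ) : 0 ≤ P.ev n κ :=
  (P.neg_le_of_one_le_finrank_sp (le_trans (by omega) ((ev_le_iff hinf).1 le_rfl))).2 hκ

theorem ev_strictMono (n : ℕ) : StrictMono (P.ev n) := fun x y hxy => by
  have := le_ev_add (P := P) hinf n (κ := x) (sub_nonneg.2 hxy.le)
  rw [add_sub_cancel] at this
  nlinarith [mul_pos P.lo_pos (sub_pos.2 hxy)]

theorem isLipschitzFamily : IsLipschitzFamily P.ev P.hi where
  lipschitz := by
    have key : ∀ n x y, x ≤ y → |P.ev n y - P.ev n x| ≤ P.hi * |y - x| := fun n x y hxy => by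
      have h1 := ev_add_le (P := P) hinf n (κ := x) (sub_nonneg.2 hxy)
      have h2 := (ev_strictMono (P := P) hinf n).monotone hxy
      rw [add_sub_cancel] at h1
      rw [abs_of_nonneg (sub_nonneg.2 h2), abs_of_nonneg (sub_nonneg.2 hxy)]
      linarith
    intro n x y
    rcases le_total x y with h | h
    · rw [abs_sub_comm, abs_sub_comm x]; exact key n x y h
    · exact key n y x h
  finite := fun x c => (isDiscreteSpectrum hinf x).finite_setOf_sortedEigenvalue_le c

theorem ncard_setOf_ev_eq (κ x : ℝ) :
    {n | P.ev n κ = x}.ncard = Module.finrank ℂ (P.eig κ x) :=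
  (isDiscreteSpectrum hinf κ).ncard_setOf_sortedEigenvalue_eq x

/-- Analytic eigenvalue germs at a point, with `S`-orthonormal eigenvectors. -/
theorem exists_germs (κ₀ : ℝ) : ∃ (l : ℕ → ℝ → ℝ) (w : ℕ → ℝ → H),
    (∀ n, AnalyticAt ℝ (l n) κ₀) ∧ (∀ n, l n κ₀ = P.ev n κ₀) ∧ (∀ n, ContinuousAt (w n) κ₀) ∧
    (∀ n, ∀ᶠ κ in 𝓝 κ₀, w n κ ∈ P.eig κ (l n κ)) ∧
    ∀ m n, ∀ᶠ κ in 𝓝 κ₀, inner ℂ (P.S (w m κ)) (P.S (w n κ)) = if m = n then 1 else 0 := by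
  choose lam w h1 h2 h3 h4 h5 using P.exists_local_frame κ₀
  -- The indices `n` with the same value `ν` at `κ₀` are as many as the members of the local frame
  -- at `ν`, so each `n` can be given its own germ.
  have he : ∀ ν, Nonempty ({n // P.ev n κ₀ = ν} ≃ Fin (Module.finrank ℂ (P.eig κ₀ ν))) := by
    intro ν
    have : Finite {n // P.ev n κ₀ = ν} := (((isLipschitzFamily hinf).finite κ₀ ν).subset
      fun n (hn : P.ev n κ₀ = ν) => hn.le : {n | P.ev n κ₀ = ν}.Finite)
    refine Finite.card_eq.1 ?_
    rw [Nat.card_fin]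
    exact ncard_setOf_ev_eq hinf κ₀ ν
  let e := fun ν => (he ν).some
  let idx : ∀ n, Fin (Module.finrank ℂ (P.eig κ₀ (P.ev n κ₀))) := fun n => e _ ⟨n, rfl⟩
  refine ⟨fun n => lam _ (idx n), fun n => w _ (idx n), fun n => h1 _ _, fun n => h2 _ _,
    fun n => h3 _ _, fun n => (h4 _).mono fun κ hκ => hκ _, fun m n => ?_⟩
  by_cases hmn : P.ev m κ₀ = P.ev n κ₀
  · have key : ∀ ν (hm : P.ev m κ₀ = ν) (hn : P.ev n κ₀ = ν), ∀ᶠ κ in 𝓝 κ₀,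
        inner ℂ (P.S (w ν (e ν ⟨m, hm⟩) κ)) (P.S (w ν (e ν ⟨n, hn⟩) κ)) =
          if m = n then 1 else 0 := fun ν hm hn => by
      filter_upwards [h5 ν] with κ hκ
      rw [orthonormal_iff_ite.1 hκ]
      simp [Subtype.ext_iff]
    have hm := key _ rfl hmn.symm
    have hcast : ∀ ν (hn : P.ev n κ₀ = ν), w ν (e ν ⟨n, hn⟩) = w _ (idx n) := by
      rintro ν rfl; rfl
    rwa [hcast] at hm
  · have hmn' : m ≠ n := fun h => hmn (by rw [h])
    have hne : ∀ᶠ κ in 𝓝 κ₀, lam _ (idx m) κ ≠ lam _ (idx n) κ := by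
      have hc := (h1 _ (idx m)).continuousAt.sub (h1 _ (idx n)).continuousAt
      refine (hc.eventually_ne (y := 0) ?_).mono fun κ hκ => sub_ne_zero.1 hκ
      rw [Pi.sub_apply, h2, h2]
      exact sub_ne_zero.2 hmn
    filter_upwards [hne, h4 (P.ev m κ₀), h4 (P.ev n κ₀)] with κ k1 k2 k3
    rw [if_neg hmn', P.inner_S_eq_zero k1 (k2 _) (k3 _)]

omit hinf in
/-- The number of `S`-orthonormal eigenvectors is at most the multiplicity. -/
theorem card_le_finrank_eig {ι : Type*} [Finite ι] {κ ν : ℝ} {w : ι → H}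
    [FiniteDimensional ℂ (P.eig κ ν)]
    (hw : ∀ i, w i ∈ P.eig κ ν) (ho : Orthonormal ℂ fun i => P.S (w i)) :
    Nat.card ι ≤ Module.finrank ℂ (P.eig κ ν) := by
  have := Fintype.ofFinite ι
  have h1 : LinearIndependent ℂ w :=
    LinearIndependent.of_comp (P.S : H →ₗ[ℂ] H) ho.linearIndependent
  have h2 : LinearIndependent ℂ (fun i => (⟨w i, hw i⟩ : P.eig κ ν)) :=
    LinearIndependent.of_comp (P.eig κ ν).subtype h1
  rw [Nat.card_eq_fintype_card]
  exact h2.fintype_card_le_finrank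

/-- Near `κ₀` the `S`-orthonormal eigenvectors show that a value `ν` in the window is taken by at
most as many germs as its multiplicity. That multiplicity is the number of ordered eigenvalues equal
to `ν`, and their indices all belong to the window of `κ₀`. -/
theorem eventually_rearrange {κ₀ : ℝ} {l : ℕ → ℝ → ℝ} {w : ℕ → ℝ → H}
    (h1 : ∀ n, AnalyticAt ℝ (l n) κ₀) (h2 : ∀ n, l n κ₀ = P.ev n κ₀)
    (h4 : ∀ n, ∀ᶠ κ in 𝓝 κ₀, w n κ ∈ P.eig κ (l n κ))
    (h5 : ∀ m n, ∀ᶠ κ in 𝓝 κ₀,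
      inner ℂ (P.S (w m κ)) (P.S (w n κ)) = if m = n then 1 else 0)
    {a b : ℝ} (ha : ∀ n, P.ev n κ₀ ≠ a) (hb : ∀ n, P.ev n κ₀ ≠ b) : ∀ᶠ κ in 𝓝 κ₀,
    ∃ σ : Equiv.Perm {n // P.ev n κ₀ ∈ Ioo a b}, ∀ n : {n // P.ev n κ₀ ∈ Ioo a b},
      l n κ = P.ev (σ n) κ := by
  have hL := isLipschitzFamily (P := P) hinf
  have hfin := hL.finite_window κ₀ a b
  have k1 : ∀ᶠ κ in 𝓝 κ₀, ∀ n : {n // P.ev n κ₀ ∈ Ioo a b}, l n κ ∈ Ioo a b :=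
    eventually_all.2 fun n => (h1 n).continuousAt.eventually
      (isOpen_Ioo.mem_nhds (by rw [h2]; exact n.2))
  have k2 : ∀ᶠ κ in 𝓝 κ₀, ∀ n : {n // P.ev n κ₀ ∈ Ioo a b}, w n κ ∈ P.eig κ (l n κ) :=
    eventually_all.2 fun n => h4 n
  have k3 : ∀ᶠ κ in 𝓝 κ₀, ∀ m n : {n // P.ev n κ₀ ∈ Ioo a b},
      inner ℂ (P.S (w m κ)) (P.S (w n κ)) = if (m : ℕ) = n then 1 else 0 :=
    eventually_all.2 fun m => eventually_all.2 fun n => h5 m n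
  filter_upwards [k1, k2, k3, hL.eventually_window ha hb] with κ k1 k2 k3 ⟨k4, _, _⟩
  refine exists_perm_of_card_fiber_le (fun n : {n // P.ev n κ₀ ∈ Ioo a b} => l n κ)
    (fun n => P.ev n κ) fun ν => ?_
  rcases isEmpty_or_nonempty {i : {n // P.ev n κ₀ ∈ Ioo a b} // l i κ = ν} with hem | ⟨⟨i₀, hi₀⟩⟩
  · rw [Nat.card_of_isEmpty]; exact Nat.zero_le _
  have hν : ν ∈ Ioo a b := hi₀ ▸ k1 i₀
  have := (isDiscreteSpectrum (P := P) hinf κ).finiteDimensional ν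
  have hle : Nat.card {i : {n // P.ev n κ₀ ∈ Ioo a b} // l i κ = ν} ≤
      Module.finrank ℂ (P.eig κ ν) := by
    refine card_le_finrank_eig (w := fun i => w i.1 κ) (fun i => by
      have := k2 i.1
      rwa [i.2] at this) ?_
    rw [orthonormal_iff_ite]
    intro i j
    rw [k3]
    simp [Subtype.ext_iff]
  refine hle.trans ?_
  rw [← ncard_setOf_ev_eq hinf κ ν]
  refine (Nat.card_congr ?_).le
  exact
    { toFun := fun n => ⟨⟨n.1, (k4 n.1).1 (by rw [show P.ev n.1 κ = ν from n.2]; exact hν)⟩, n.2⟩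
      invFun := fun n => ⟨n.1.1, n.2⟩
      left_inv := fun n => rfl
      right_inv := fun n => rfl }

/-- Differentiability of a simple eigenvalue. -/
theorem hasDerivAt_ev {n : ℕ} {κ₀ : ℝ} (h : Module.finrank ℂ (P.eig κ₀ (P.ev n κ₀)) = 1) {v : H}
    (hv : v ∈ P.eig κ₀ (P.ev n κ₀)) (hv0 : v ≠ 0) : HasDerivAt (P.ev n) (P.rayleigh v) κ₀ := by
  obtain ⟨l, w, h1, h2, h3, h4, h5⟩ := exists_germs (P := P) hinf κ₀
  have hL := isLipschitzFamily (P := P) hinf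
  have hone : ∀ m, P.ev m κ₀ = P.ev n κ₀ → m = n := fun m hm => by
    rw [← ncard_setOf_ev_eq hinf, Set.ncard_eq_one] at h
    obtain ⟨k, hk⟩ := h
    have e1 : m ∈ ({k} : Set ℕ) := hk ▸ hm
    have e2 : n ∈ ({k} : Set ℕ) := hk ▸ (rfl : P.ev n κ₀ = P.ev n κ₀)
    exact (mem_singleton_iff.1 e1).trans (mem_singleton_iff.1 e2).symm
  -- The window of radius `ε` around the simple eigenvalue contains the index `n` only, so the
  -- rearrangement is trivial and the ordered eigenvalue coincides with its analytic germ.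
  obtain ⟨ε, hε, hgap⟩ : ∃ ε > 0, ∀ m, m ≠ n → ε < |P.ev m κ₀ - P.ev n κ₀| := by
    have e1 : ∀ᶠ ε : ℝ in 𝓝[>] 0, ε < 1 ∧ ∀ m ∈ {m | P.ev m κ₀ ≤ P.ev n κ₀ + 1}, m ≠ n →
        ε < |P.ev m κ₀ - P.ev n κ₀| := by
      refine (eventually_nhdsWithin_of_eventually_nhds (eventually_lt_nhds one_pos)).and ?_
      rw [eventually_all_finite (hL.finite κ₀ _)]
      intro m _
      by_cases hm : m = n
      · simp [hm]
      · filter_upwards [eventually_nhdsWithin_of_eventually_nhds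
          (eventually_lt_nhds (abs_pos.2 (sub_ne_zero.2 (mt (hone m) hm))))] with ε hε _ using hε
    obtain ⟨ε, ⟨e2, e3⟩, e4⟩ := (e1.and eventually_mem_nhdsWithin).exists
    refine ⟨ε, e4, fun m hm => ?_⟩
    rcases le_or_gt (P.ev m κ₀) (P.ev n κ₀ + 1) with e5 | e5
    · exact e3 m e5 hm
    · exact lt_of_lt_of_le (by linarith) (le_abs_self _)
  have hne : ∀ c, |c - P.ev n κ₀| = ε → ∀ m, P.ev m κ₀ ≠ c := fun c hc m hm => by
    by_cases hmn : m = n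
    · rw [← hm, hmn, sub_self, abs_zero] at hc; exact hε.ne hc
    · have := hgap m hmn
      rw [hm, hc] at this
      exact lt_irrefl _ this
  have hr := eventually_rearrange hinf h1 h2 h4 h5
    (hne (P.ev n κ₀ - ε) (by rw [sub_sub_cancel_left, abs_neg, abs_of_pos hε]))
    (hne (P.ev n κ₀ + ε) (by rw [add_sub_cancel_left, abs_of_pos hε]))
  have hmem : P.ev n κ₀ ∈ Ioo (P.ev n κ₀ - ε) (P.ev n κ₀ + ε) :=
    ⟨by linarith, by linarith⟩
  have huniq : ∀ m : {m // P.ev m κ₀ ∈ Ioo (P.ev n κ₀ - ε) (P.ev n κ₀ + ε)}, (m : ℕ) = n :=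
    fun m => by
      by_contra hm
      have := hgap m hm
      exact absurd (abs_lt.2 ⟨by linarith [m.2.1], by linarith [m.2.2]⟩) (not_lt.2 this.le)
  have heq : P.ev n =ᶠ[𝓝 κ₀] l n := by
    filter_upwards [hr] with κ ⟨σ, hσ⟩
    have := hσ ⟨n, hmem⟩
    rw [huniq (σ _)] at this
    exact this.symm
  have hw0 : w n κ₀ ≠ 0 := fun h0 => by
    have := (h5 n n).self_of_nhds
    simp [h0] at this
  have hwm : w n κ₀ ∈ P.eig κ₀ (P.ev n κ₀) := h2 n ▸ (h4 n).self_of_nhds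
  have hd := (P.hasDerivAt_of_mem_eig (h3 n) (h4 n) hw0).congr_of_eventuallyEq heq
  obtain ⟨a, ha⟩ := (finrank_eq_one_iff_of_nonzero' (⟨w n κ₀, hwm⟩ : P.eig κ₀ (P.ev n κ₀))
    fun h0 => hw0 (congrArg Subtype.val h0)).1 h ⟨v, hv⟩
  have ha' : a • w n κ₀ = v := congrArg Subtype.val ha
  have ha0 : a ≠ 0 := by
    rintro rfl
    exact hv0 (by rw [← ha', zero_smul])
  rwa [← ha', P.rayleigh_smul ha0]

/-- Analytic parametrization of the whole spectrum of the pencil. -/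
theorem exists_analytic_branches : ∃ Λ : ℕ → ℝ → ℝ, (∀ n, AnalyticOnNhd ℝ (Λ n) univ) ∧
    ∀ κ, ∃ (σ : Equiv.Perm ℕ) (w : ℕ → H), (∀ n, Λ n κ = P.ev (σ n) κ) ∧
      (∀ n, w n ∈ P.eig κ (Λ n κ)) ∧ (∀ n, w n ≠ 0) ∧
      (∀ m n, m ≠ n → inner ℂ (P.S (w m)) (P.S (w n)) = 0) ∧
      ∀ n, HasDerivAt (Λ n) (P.rayleigh (w n)) κ := by
  choose l w h1 h2 h3 h4 h5 using exists_germs (P := P) hinf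
  have hw0 : ∀ κ n, w κ n κ ≠ 0 := fun κ n h0 => by
    have := (h5 κ n n).self_of_nhds
    simp [h0] at this
  have hd : ∀ κ n, HasDerivAt (l κ n) (P.rayleigh (w κ n κ)) κ := fun κ n =>
    P.hasDerivAt_of_mem_eig (h3 κ n) (h4 κ n) (hw0 κ n)
  have hbr : IsLocalBranching P.ev l P.hi :=
    { toIsLipschitzFamily := isLipschitzFamily hinf
      analyticAt := h1
      base := h2
      deriv_le := fun κ n => by
        have := P.rayleigh_mem_Icc (hw0 κ n)
        rw [(hd κ n).deriv, abs_of_nonneg (P.lo_pos.le.trans this.1)]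
        exact this.2
      rearrange := fun κ a b ha hb => eventually_rearrange hinf (h1 κ) (h2 κ) (h4 κ) (h5 κ) ha hb }
  obtain ⟨Λ, hΛ, hσ⟩ := hbr.exists_global_branches
  refine ⟨Λ, hΛ, fun κ => ?_⟩
  obtain ⟨σ, hσ⟩ := hσ κ
  have hval : ∀ n, Λ n κ = l κ (σ n) κ := fun n => (hσ n).self_of_nhds
  refine ⟨σ, fun n => w κ (σ n) κ, fun n => ?_, fun n => ?_, fun n => hw0 _ _, fun m n hmn => ?_,
    fun n => (hd κ (σ n)).congr_of_eventuallyEq (hσ n)⟩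
  · rw [hval, h2]
  · rw [hval]; exact (h4 κ _).self_of_nhds
  · rw [(h5 κ _ _).self_of_nhds, if_neg (σ.injective.ne hmn)]

end SpectralPencil

/-! ### Absolutely continuous complex functions -/

namespace AbsolutelyContinuousOnInterval

/-- The oscillation sums of `g` are dominated by those of `f`. This yields real and imaginary parts,
conjugates, and changes of a function outside the interval. -/
theorem of_dist_le {X Y : Type*} [PseudoMetricSpace X] [PseudoMetricSpace Y] {f : ℝ → X}
    {g : ℝ → Y} {a b : ℝ} (hf : AbsolutelyContinuousOnInterval f a b)
    (h : ∀ x ∈ uIcc a b, ∀ y ∈ uIcc a b, dist (g x) (g y) ≤ dist (f x) (f y)) :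
    AbsolutelyContinuousOnInterval g a b := by
  rw [absolutelyContinuousOnInterval_iff] at hf ⊢
  intro ε hε
  obtain ⟨δ, hδ, h1⟩ := hf ε hε
  refine ⟨δ, hδ, fun E hE hd => (Finset.sum_le_sum fun i hi => ?_).trans_lt (h1 E hE hd)⟩
  exact h _ (hE.1 i hi).1 _ (hE.1 i hi).2

theorem congr_of_eqOn {X : Type*} [PseudoMetricSpace X] {f g : ℝ → X} {a b : ℝ}
    (hf : AbsolutelyContinuousOnInterval f a b) (h : EqOn g f (uIcc a b)) :
    AbsolutelyContinuousOnInterval g a b :=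
  hf.of_dist_le fun x hx y hy => by rw [h hx, h hy]

theorem complex_re {f : ℝ → ℂ} {a b : ℝ} (hf : AbsolutelyContinuousOnInterval f a b) :
    AbsolutelyContinuousOnInterval (fun x => (f x).re) a b :=
  hf.of_dist_le fun x _ y _ => by
    rw [dist_eq_norm, dist_eq_norm, ← Complex.sub_re]; exact Complex.abs_re_le_norm _

theorem complex_im {f : ℝ → ℂ} {a b : ℝ} (hf : AbsolutelyContinuousOnInterval f a b) :
    AbsolutelyContinuousOnInterval (fun x => (f x).im) a b :=
  hf.of_dist_le fun x _ y _ => by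
    rw [dist_eq_norm, dist_eq_norm, ← Complex.sub_im]; exact Complex.abs_im_le_norm _

theorem complex_of_re_im {f : ℝ → ℂ} {a b : ℝ}
    (hr : AbsolutelyContinuousOnInterval (fun x => (f x).re) a b)
    (hi : AbsolutelyContinuousOnInterval (fun x => (f x).im) a b) :
    AbsolutelyContinuousOnInterval f a b := by
  have h1 : AbsolutelyContinuousOnInterval (fun x => ((f x).re : ℂ)) a b :=
    hr.of_dist_le fun x _ y _ => (Complex.isometry_ofReal.dist_eq _ _).le
  have h2 : AbsolutelyContinuousOnInterval (fun x => ((f x).im : ℂ)) a b :=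
    hi.of_dist_le fun x _ y _ => (Complex.isometry_ofReal.dist_eq _ _).le
  have h3 := h1.add (h2.const_smul Complex.I)
  refine h3.congr_of_eqOn fun x _ => ?_
  simp only [Pi.add_apply, smul_eq_mul]
  rw [mul_comm, Complex.re_add_im]

theorem ae_differentiableAt_complex {f : ℝ → ℂ} {a b : ℝ}
    (hf : AbsolutelyContinuousOnInterval f a b) :
    ∀ᵐ x, x ∈ uIcc a b → DifferentiableAt ℝ f x := by
  filter_upwards [hf.complex_re.ae_differentiableAt, hf.complex_im.ae_differentiableAt]
    with x h1 h2 hx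
  have h3 := (Complex.ofRealCLM.differentiableAt.comp x (h1 hx)).add
    ((Complex.ofRealCLM.differentiableAt.comp x (h2 hx)).mul_const Complex.I)
  refine h3.congr_of_eventuallyEq (Eventually.of_forall fun y => ?_)
  simp [Complex.re_add_im]

/-- The fundamental theorem of calculus for absolutely continuous complex functions. -/
theorem intervalIntegrable_and_eq_add_integral {f f' : ℝ → ℂ} {a b : ℝ}
    (hf : AbsolutelyContinuousOnInterval f a b)
    (hd : ∀ᵐ x, x ∈ uIcc a b → HasDerivAt f (f' x) x) :
    IntervalIntegrable f' volume a b ∧ ∀ x ∈ uIcc a b, f x = f a + ∫ t in a..x, f' t := by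
  have hsub : ∀ {x}, x ∈ uIoc a b → x ∈ uIcc a b := fun hx => uIoc_subset_uIcc hx
  have hre : ∀ᵐ x, x ∈ uIcc a b → HasDerivAt (fun x => (f x).re) (f' x).re x :=
    hd.mono fun x h hx => Complex.reCLM.hasFDerivAt.comp_hasDerivAt x (h hx)
  have him : ∀ᵐ x, x ∈ uIcc a b → HasDerivAt (fun x => (f x).im) (f' x).im x :=
    hd.mono fun x h hx => Complex.imCLM.hasFDerivAt.comp_hasDerivAt x (h hx)
  have ir : IntervalIntegrable (fun x => (f' x).re) volume a b := by
    refine hf.complex_re.intervalIntegrable_deriv.congr_ae ?_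
    rw [EventuallyEq, ae_restrict_iff' measurableSet_uIoc]
    exact hre.mono fun x h hx => (h (hsub hx)).deriv
  have ii : IntervalIntegrable (fun x => (f' x).im) volume a b := by
    refine hf.complex_im.intervalIntegrable_deriv.congr_ae ?_
    rw [EventuallyEq, ae_restrict_iff' measurableSet_uIoc]
    exact him.mono fun x h hx => (h (hsub hx)).deriv
  have hint : IntervalIntegrable f' volume a b := by
    have h1 : IntervalIntegrable (fun x => ((f' x).re : ℂ) + (f' x).im * Complex.I) volume a b :=
      (show IntervalIntegrable (fun x => ((f' x).re : ℂ)) volume a b from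
        ⟨ir.1.ofReal, ir.2.ofReal⟩).add
      ((show IntervalIntegrable (fun x => ((f' x).im : ℂ)) volume a b from
        ⟨ii.1.ofReal, ii.2.ofReal⟩).mul_const Complex.I)
    simpa only [Complex.re_add_im] using h1
  refine ⟨hint, fun x hx => ?_⟩
  have hsx : uIcc a x ⊆ uIcc a b := uIcc_subset_uIcc_left hx
  have hfx := hf.mono hsx
  have hix := hint.mono_set hsx
  have er : ∫ t in a..x, (f' t).re = (f x).re - (f a).re := by
    rw [← hfx.complex_re.integral_deriv_eq_sub]
    refine intervalIntegral.integral_congr_ae (hre.mono fun t h ht => ?_)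
    exact (h (hsx (uIoc_subset_uIcc ht))).deriv.symm
  have ei : ∫ t in a..x, (f' t).im = (f x).im - (f a).im := by
    rw [← hfx.complex_im.integral_deriv_eq_sub]
    refine intervalIntegral.integral_congr_ae (him.mono fun t h ht => ?_)
    exact (h (hsx (uIoc_subset_uIcc ht))).deriv.symm
  have hR := Complex.reCLM.intervalIntegral_comp_comm hix
  have hI := Complex.imCLM.intervalIntegral_comp_comm hix
  simp only [Complex.reCLM_apply, Complex.imCLM_apply] at hR hI
  refine Complex.ext ?_ ?_
  · rw [Complex.add_re, ← hR, er]; ring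
  · rw [Complex.add_im, ← hI, ei]; ring

end AbsolutelyContinuousOnInterval

theorem IntervalIntegrable.absolutelyContinuousOnInterval_complex {f : ℝ → ℂ} {a b : ℝ}
    (h : IntervalIntegrable f volume a b) :
    AbsolutelyContinuousOnInterval (fun x => ∫ t in a..x, f t) a b := by
  have hix : ∀ x ∈ uIcc a b, IntervalIntegrable f volume a x := fun x hx =>
    h.mono_set (uIcc_subset_uIcc_left hx)
  have hr : IntervalIntegrable (fun x => (f x).re) volume a b :=
    ⟨h.1.re, h.2.re⟩
  have hi : IntervalIntegrable (fun x => (f x).im) volume a b :=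
    ⟨h.1.im, h.2.im⟩
  refine AbsolutelyContinuousOnInterval.complex_of_re_im ?_ ?_
  · refine (hr.absolutelyContinuousOnInterval_intervalIntegral left_mem_uIcc).congr_of_eqOn
      fun x hx => ?_
    exact (Complex.reCLM.intervalIntegral_comp_comm (hix x hx)).symm
  · refine (hi.absolutelyContinuousOnInterval_intervalIntegral left_mem_uIcc).congr_of_eqOn
      fun x hx => ?_
    exact (Complex.imCLM.intervalIntegral_comp_comm (hix x hx)).symm

/-! ### The antiperiodic primitive -/

/-- The primitive of `f` on `[0,1]` with opposite values at the endpoints. -/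
def antiPrim (f : ℝ → ℂ) (y : ℝ) : ℂ := (∫ t in (0 : ℝ)..y, f t) - 1 / 2 * ∫ t in (0 : ℝ)..1, f t

theorem antiPrim_one (f : ℝ → ℂ) : antiPrim f 1 = -antiPrim f 0 := by
  simp only [antiPrim, intervalIntegral.integral_same]; ring

theorem antiPrim_congr {f g : ℝ → ℂ} (h : f =ᵐ[volume.restrict (Ioc (0 : ℝ) 1)] g) {y : ℝ}
    (hy : y ∈ Icc (0 : ℝ) 1) : antiPrim f y = antiPrim g y := by
  have h' := (ae_restrict_iff' measurableSet_Ioc).1 h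
  have key : ∀ x ∈ Icc (0 : ℝ) 1, ∫ t in (0 : ℝ)..x, f t = ∫ t in (0 : ℝ)..x, g t := fun x hx => by
    refine intervalIntegral.integral_congr_ae (h'.mono fun t ht htx => ht ?_)
    rw [uIoc_of_le hx.1] at htx
    exact ⟨htx.1, htx.2.trans hx.2⟩
  rw [antiPrim, antiPrim, key y hy, key 1 ⟨zero_le_one, le_rfl⟩]

section

variable {f : ℝ → ℂ} (hf : IntervalIntegrable f volume 0 1)
include hf

theorem absolutelyContinuousOnInterval_antiPrim :
    AbsolutelyContinuousOnInterval (antiPrim f) 0 1 :=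
  hf.absolutelyContinuousOnInterval_complex.sub
    (LipschitzWith.const _).lipschitzOnWith.absolutelyContinuousOnInterval

theorem ae_hasDerivAt_antiPrim : ∀ᵐ y, y ∈ uIcc (0 : ℝ) 1 → HasDerivAt (antiPrim f) (f y) y := by
  filter_upwards [hf.ae_hasDerivAt_integral] with y hy h1
  exact (hy h1 0 left_mem_uIcc).sub_const _

end

/-- Antiperiodicity fixes the constant of integration: `-v(0) = v(0) + ∫ f`, so `v(0) = -(1/2) ∫ f`.
-/
theorem eq_antiPrim {v f : ℝ → ℂ} (hv : AbsolutelyContinuousOnInterval v 0 1)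
    (hd : ∀ᵐ x, x ∈ uIcc (0 : ℝ) 1 → HasDerivAt v (f x) x) (h1 : v 1 = -v 0) {y : ℝ}
    (hy : y ∈ uIcc (0 : ℝ) 1) : v y = antiPrim f y := by
  obtain ⟨-, h⟩ := hv.intervalIntegrable_and_eq_add_integral hd
  have h2 := h 1 right_mem_uIcc
  rw [h1] at h2
  rw [antiPrim, h y hy]
  linear_combination (-1 / 2 : ℂ) * h2

/-- The operation `antiPrim` is skew-symmetric. -/
theorem integral_star_antiPrim_mul {f g : ℝ → ℂ} (hf : IntervalIntegrable f volume 0 1)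
    (hg : IntervalIntegrable g volume 0 1) :
    ∫ y in (0 : ℝ)..1, starRingEnd ℂ (antiPrim f y) * g y =
      -∫ y in (0 : ℝ)..1, starRingEnd ℂ (f y) * antiPrim g y := by
  have hF := absolutelyContinuousOnInterval_antiPrim hf
  have hG := absolutelyContinuousOnInterval_antiPrim hg
  have hF' : AbsolutelyContinuousOnInterval (fun y => starRingEnd ℂ (antiPrim f y)) 0 1 :=
    hF.of_dist_le fun x _ y _ => (Complex.dist_conj_conj _ _).le
  have hFG := hF'.smul hG
  have hd : ∀ᵐ y, y ∈ uIcc (0 : ℝ) 1 → HasDerivAt ((fun y => starRingEnd ℂ (antiPrim f y)) •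
      antiPrim g) (starRingEnd ℂ (f y) * antiPrim g y + starRingEnd ℂ (antiPrim f y) * g y) y := by
    filter_upwards [ae_hasDerivAt_antiPrim hf, ae_hasDerivAt_antiPrim hg] with y h1 h2 hy
    exact (Complex.conjCLE.hasFDerivAt.comp_hasDerivAt y (h1 hy)).mul (h2 hy)
  obtain ⟨-, h⟩ := hFG.intervalIntegrable_and_eq_add_integral hd
  have h1 := h 1 right_mem_uIcc
  have i1 : IntervalIntegrable (fun y => starRingEnd ℂ (f y) * antiPrim g y) volume 0 1 := by
    refine IntervalIntegrable.mul_continuousOn ?_ hG.continuousOn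
    exact ⟨Complex.conjCLE.toContinuousLinearMap.integrable_comp hf.1,
      Complex.conjCLE.toContinuousLinearMap.integrable_comp hf.2⟩
  have i2 : IntervalIntegrable (fun y => starRingEnd ℂ (antiPrim f y) * g y) volume 0 1 :=
    hg.continuousOn_mul hF'.continuousOn
  rw [intervalIntegral.integral_add i1 i2] at h1
  -- Integration by parts has no boundary term, because both factors change sign between the
  -- endpoints.
  simp only [Pi.smul_apply', smul_eq_mul, antiPrim_one, map_neg, neg_mul_neg] at h1
  linear_combination -h1

/-! ### The primitive as a compact skew-adjoint operator -/

section KernelOperator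

open BoundedContinuousFunction

variable {X H : Type*} [TopologicalSpace X] [CompactSpace X] [NormedAddCommGroup H]
  [InnerProductSpace ℂ H]

/-- The operator `f ↦ (x ↦ ⟪k x, f⟫)` for a continuous kernel `k` on a compact space. -/
def kernelOp (k : C(X, H)) : H →L[ℂ] X →ᵇ ℂ :=
  LinearMap.mkContinuous
    { toFun := fun f => mkOfCompact ⟨fun x => inner ℂ (k x) f, by fun_prop⟩
      map_add' := fun f g => by ext x; simp
      map_smul' := fun c f => by ext x; simp }
    ‖mkOfCompact k‖ fun f => by
      rw [BoundedContinuousFunction.norm_le (by positivity)]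
      intro x
      refine (norm_inner_le_norm _ _).trans ?_
      gcongr
      exact (mkOfCompact k).norm_coe_le_norm x

theorem kernelOp_apply (k : C(X, H)) (f : H) (x : X) : kernelOp k f x = inner ℂ (k x) f := rfl

/-- Arzelà–Ascoli: on the unit ball the images are bounded, and equicontinuous with the modulus of
continuity of `k`. -/
theorem isCompactOperator_kernelOp (k : C(X, H)) : IsCompactOperator (kernelOp k) := by
  have h := isCompactOperator_iff_isCompact_closure_image_closedBall
    (kernelOp k : H →ₗ[ℂ] X →ᵇ ℂ) one_pos
  refine h.2 (arzela_ascoli (Metric.closedBall 0 ‖kernelOp k‖) (isCompact_closedBall _ _) _ ?_ ?_)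
  · rintro _ x ⟨f, hf, rfl⟩
    rw [mem_closedBall_zero_iff] at hf ⊢
    exact ((kernelOp k f).norm_coe_le_norm x).trans ((kernelOp k).unit_le_opNorm f hf)
  · intro x
    rw [Metric.equicontinuousAt_iff_right]
    intro ε hε
    have hc : ∀ᶠ y in 𝓝 x, dist (k x) (k y) < ε :=
      ((Metric.tendsto_nhds.1 k.continuous.continuousAt) ε hε).mono fun y hy => by rwa [dist_comm]
    filter_upwards [hc] with y hy
    rintro ⟨_, f, hf, rfl⟩
    rw [mem_closedBall_zero_iff] at hf
    refine lt_of_le_of_lt ?_ hy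
    change dist (inner ℂ (k x) f) (inner ℂ (k y) f) ≤ _
    rw [dist_eq_norm, dist_eq_norm, ← inner_sub_left]
    exact (norm_inner_le_norm _ _).trans (mul_le_of_le_one_right (norm_nonneg _) hf)

end KernelOperator

/-- Lebesgue measure on `(0,1]`. -/
abbrev unitMeasure : Measure ℝ := volume.restrict (Ioc (0 : ℝ) 1)

/-- The space `L²(0,1)`. -/
abbrev UnitL2 := Lp ℂ 2 unitMeasure

theorem UnitL2.intervalIntegrable (f : UnitL2) : IntervalIntegrable f volume 0 1 := by
  rw [intervalIntegrable_iff_integrableOn_Ioc_of_le zero_le_one]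
  exact (Lp.memLp f).integrable one_le_two

theorem UnitL2.inner_eq (f g : UnitL2) :
    inner ℂ f g = ∫ y in (0 : ℝ)..1, starRingEnd ℂ (f y) * g y := by
  rw [L2.inner_def, intervalIntegral.integral_of_le zero_le_one]
  simp only [RCLike.inner_apply']

/-- The kernel of `antiPrim`. -/
def antiKernel (y : Icc (0 : ℝ) 1) : UnitL2 :=
  indicatorConstLp 2 (measurableSet_Ioc (a := (0 : ℝ)) (b := y)) (measure_ne_top _ _) 1 -
    (1 / 2 : ℂ) • indicatorConstLp 2 (measurableSet_Ioc (a := (0 : ℝ)) (b := 1))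
      (measure_ne_top _ _) 1

theorem inner_indicator_Ioc {y : ℝ} (hy : y ∈ Icc (0 : ℝ) 1) (f : UnitL2) :
    inner ℂ (indicatorConstLp 2 (measurableSet_Ioc (a := (0 : ℝ)) (b := y))
      (measure_ne_top unitMeasure _) (1 : ℂ)) f = ∫ t in (0 : ℝ)..y, f t := by
  rw [L2.inner_indicatorConstLp_one, intervalIntegral.integral_of_le hy.1,
    Measure.restrict_restrict measurableSet_Ioc,
    inter_eq_left.2 (Ioc_subset_Ioc_right hy.2)]

theorem inner_antiKernel (y : Icc (0 : ℝ) 1) (f : UnitL2) :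
    inner ℂ (antiKernel y) f = antiPrim f y := by
  rw [antiKernel, inner_sub_left, inner_smul_left, inner_indicator_Ioc y.2,
    inner_indicator_Ioc ⟨zero_le_one, le_rfl⟩, antiPrim]
  simp [Complex.conj_ofNat]

/-- The constant parts cancel and the difference is, up to sign, the indicator of the interval
between `x` and `y`. This is what makes the kernel continuous into `L²`. -/
theorem norm_antiKernel_sub (x y : Icc (0 : ℝ) 1) :
    ‖antiKernel x - antiKernel y‖ ^ 2 = |(x : ℝ) - y| := by
  have key : ∀ a b : Icc (0 : ℝ) 1, inner ℂ (indicatorConstLp 2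
      (measurableSet_Ioc (a := (0 : ℝ)) (b := a)) (measure_ne_top unitMeasure _) (1 : ℂ))
      (indicatorConstLp 2 (measurableSet_Ioc (a := (0 : ℝ)) (b := b))
      (measure_ne_top unitMeasure _) (1 : ℂ)) = ((min (a : ℝ) b : ℝ) : ℂ) := fun a b => by
    have h : (0 : ℝ) ≤ min (a : ℝ) b := le_min a.2.1 b.2.1
    rw [L2.inner_indicatorConstLp_one_indicatorConstLp_one measurableSet_Ioc measurableSet_Ioc,
      Ioc_inter_Ioc, max_self, measureReal_restrict_apply measurableSet_Ioc,
      inter_eq_left.2 (Ioc_subset_Ioc_right ((min_le_left _ _).trans a.2.2)),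
      Real.volume_real_Ioc_of_le h, sub_zero]
    rfl
  rw [antiKernel, antiKernel, sub_sub_sub_cancel_right, ← inner_self_eq_norm_sq (𝕜 := ℂ),
    inner_sub_left, inner_sub_right, inner_sub_right, key, key, key, key]
  simp only [← Complex.ofReal_sub, RCLike.re_to_complex, Complex.ofReal_re, min_self]
  rw [min_comm (y : ℝ), ← max_sub_min_eq_abs']
  linarith [min_add_max (x : ℝ) y]

theorem continuous_antiKernel : Continuous antiKernel := by
  rw [continuous_iff_continuousAt]
  intro x
  rw [ContinuousAt, tendsto_iff_norm_sub_tendsto_zero]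
  have h1 : Tendsto (fun y : Icc (0 : ℝ) 1 => √|(y : ℝ) - x|) (𝓝 x) (𝓝 0) := by
    have : Continuous fun y : Icc (0 : ℝ) 1 => √|(y : ℝ) - x| := by fun_prop
    simpa using this.tendsto x
  refine h1.congr fun y => ?_
  rw [← norm_antiKernel_sub, Real.sqrt_sq (norm_nonneg _)]

/-- Restriction of a function on `[0,1]` to an element of `L²(0,1)`. -/
def boundedToUnitL2 : BoundedContinuousFunction (Icc (0 : ℝ) 1) ℂ →L[ℂ] UnitL2 :=
  BoundedContinuousFunction.toLp 2 unitMeasure ℂ ∘L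
    BoundedContinuousFunction.compContinuousCLM ℂ ℂ ⟨projIcc (0 : ℝ) 1 zero_le_one,
      continuous_projIcc⟩

/-- The skew-adjoint primitive `f ↦ antiPrim f` on `L²(0,1)`. -/
def primOp : UnitL2 →L[ℂ] UnitL2 :=
  boundedToUnitL2 ∘L kernelOp ⟨antiKernel, continuous_antiKernel⟩

theorem ae_unitMeasure_iff {p : ℝ → Prop} :
    (∀ᵐ y ∂unitMeasure, p y) ↔ ∀ᵐ y, y ∈ uIcc (0 : ℝ) 1 → p y := by
  rw [unitMeasure, restrict_Ioc_eq_restrict_Icc, uIcc_of_le zero_le_one,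
    ae_restrict_iff' measurableSet_Icc]

theorem coeFn_primOp (f : UnitL2) : primOp f =ᵐ[unitMeasure] antiPrim f := by
  have h1 := BoundedContinuousFunction.coeFn_toLp 2 unitMeasure ℂ
    (BoundedContinuousFunction.compContinuousCLM ℂ ℂ ⟨projIcc (0 : ℝ) 1 zero_le_one,
      continuous_projIcc⟩ (kernelOp ⟨antiKernel, continuous_antiKernel⟩ f))
  have h2 : ∀ᵐ y ∂unitMeasure, y ∈ Ioc (0 : ℝ) 1 := ae_restrict_mem measurableSet_Ioc
  filter_upwards [h1, h2] with y hy1 hy2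
  refine hy1.trans ?_
  have hy3 : y ∈ Icc (0 : ℝ) 1 := ⟨hy2.1.le, hy2.2⟩
  change kernelOp ⟨antiKernel, continuous_antiKernel⟩ f (projIcc 0 1 zero_le_one y) = _
  rw [kernelOp_apply, projIcc_of_mem _ hy3]
  exact inner_antiKernel ⟨y, hy3⟩ f

theorem isCompactOperator_primOp : IsCompactOperator primOp :=
  (isCompactOperator_kernelOp _).clm_comp boundedToUnitL2

theorem adjoint_primOp : ContinuousLinearMap.adjoint primOp = -primOp := by
  symm
  rw [ContinuousLinearMap.eq_adjoint_iff]
  intro f g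
  have e1 : inner ℂ (primOp f) g = ∫ y in (0 : ℝ)..1, starRingEnd ℂ (antiPrim f y) * g y := by
    rw [UnitL2.inner_eq]
    refine intervalIntegral.integral_congr_ae ?_
    filter_upwards [ae_unitMeasure_iff.1 (coeFn_primOp f)] with y hy hm
    rw [hy (uIoc_subset_uIcc hm)]
  have e2 : inner ℂ f (primOp g) = ∫ y in (0 : ℝ)..1, starRingEnd ℂ (f y) * antiPrim g y := by
    rw [UnitL2.inner_eq]
    refine intervalIntegral.integral_congr_ae ?_
    filter_upwards [ae_unitMeasure_iff.1 (coeFn_primOp g)] with y hy hm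
    rw [hy (uIoc_subset_uIcc hm)]
  rw [_root_.neg_apply, inner_neg_left, e1, e2, integral_star_antiPrim_mul (UnitL2.intervalIntegrable f)
    (UnitL2.intervalIntegrable g), neg_neg]

theorem eq_zero_of_antiPrim_eq_zero {f : UnitL2} (h : ∀ y ∈ Ioo (0 : ℝ) 1, antiPrim f y = 0) :
    f = 0 := by
  refine Lp.ext ?_
  have h1 := ae_unitMeasure_iff.2 (ae_hasDerivAt_antiPrim (UnitL2.intervalIntegrable f))
  have h2 : ∀ᵐ y ∂unitMeasure, y ∈ Ioo (0 : ℝ) 1 := by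
    rw [unitMeasure, ← restrict_Ioo_eq_restrict_Ioc]
    exact ae_restrict_mem measurableSet_Ioo
  filter_upwards [h1, h2, Lp.coeFn_zero ℂ 2 unitMeasure] with y hy1 hy2 hy3
  rw [hy3, Pi.zero_apply]
  have : HasDerivAt (fun _ => (0 : ℂ)) (f y) y :=
    hy1.congr_of_eventuallyEq (by
      filter_upwards [isOpen_Ioo.mem_nhds hy2] with z hz using (h z hz).symm)
  exact this.unique (hasDerivAt_const _ _)

theorem primOp_injective : Function.Injective primOp := by
  rw [injective_iff_map_eq_zero]
  intro f hf
  refine eq_zero_of_antiPrim_eq_zero fun y hy => ?_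
  have h1 : antiPrim f =ᵐ[volume.restrict (Ioo (0 : ℝ) 1)] fun _ => 0 := by
    rw [restrict_Ioo_eq_restrict_Ioc]
    have h2 := coeFn_primOp f
    rw [hf] at h2
    exact h2.symm.trans (Lp.coeFn_zero _ _ _)
  have hc : ContinuousOn (antiPrim f) (Ioo 0 1) :=
    (absolutelyContinuousOnInterval_antiPrim (UnitL2.intervalIntegrable f)).continuousOn.mono
      (Ioo_subset_Icc_self.trans Icc_subset_uIcc)
  exact Measure.eqOn_open_of_ae_eq h1 isOpen_Ioo hc continuousOn_const hy

/-! ### Multiplication by bounded coefficients -/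

/-- A real coefficient on `(0,1]` with positive lower bound `m` and upper bound `M`. -/
structure IsBoundedCoef (g : ℝ → ℝ) (m M : ℝ) : Prop where
  aesm : AEStronglyMeasurable g unitMeasure
  pos : 0 < m
  mem_Icc : ∀ᵐ y ∂unitMeasure, g y ∈ Icc m M

namespace IsBoundedCoef

variable {g : ℝ → ℝ} {m M : ℝ}

theorem le (h : IsBoundedCoef g m M) : m ≤ M := by
  have : (ae unitMeasure).NeBot := by
    rw [ae_neBot, unitMeasure, Ne, Measure.restrict_eq_zero]
    simp
  obtain ⟨y, hy⟩ := h.mem_Icc.exists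
  exact hy.1.trans hy.2

theorem sqrt (h : IsBoundedCoef g m M) : IsBoundedCoef (fun y => √(g y)) √m √M where
  aesm := Real.continuous_sqrt.comp_aestronglyMeasurable h.aesm
  pos := Real.sqrt_pos.2 h.pos
  mem_Icc := h.mem_Icc.mono fun _ hy => ⟨Real.sqrt_le_sqrt hy.1, Real.sqrt_le_sqrt hy.2⟩

theorem memLp (h : IsBoundedCoef g m M) : MemLp (fun y => (g y : ℂ)) ⊤ unitMeasure := by
  refine MemLp.of_bound (Complex.continuous_ofReal.comp_aestronglyMeasurable h.aesm) M
    (h.mem_Icc.mono fun y hy => ?_)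
  rw [Complex.norm_real, Real.norm_of_nonneg (h.pos.le.trans hy.1)]
  exact hy.2

/-- Multiplication by a bounded coefficient. -/
def mulOp (h : IsBoundedCoef g m M) : UnitL2 →L[ℂ] UnitL2 :=
  ContinuousLinearMap.holderL unitMeasure ⊤ 2 2 (ContinuousLinearMap.mul ℂ ℂ) h.memLp.toLp

theorem coeFn_mulOp (h : IsBoundedCoef g m M) (f : UnitL2) :
    h.mulOp f =ᵐ[unitMeasure] fun y => (g y : ℂ) * f y := by
  have h1 : h.mulOp f =ᵐ[unitMeasure] fun y => (h.memLp.toLp _ : ℝ → ℂ) y * f y :=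
    ContinuousLinearMap.coeFn_holder (ContinuousLinearMap.mul ℂ ℂ) h.memLp.toLp f
  filter_upwards [h1, h.memLp.coeFn_toLp] with y hy1 hy2
  rw [hy1, hy2]

theorem inner_mulOp (h : IsBoundedCoef g m M) (f k : UnitL2) :
    inner ℂ f (h.mulOp k) = ∫ y in (0 : ℝ)..1, (g y : ℂ) * (starRingEnd ℂ (f y) * k y) := by
  rw [UnitL2.inner_eq]
  refine intervalIntegral.integral_congr_ae ?_
  filter_upwards [ae_unitMeasure_iff.1 (h.coeFn_mulOp k)] with y hy hm
  rw [hy (uIoc_subset_uIcc hm)]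
  ring

theorem re_inner_mulOp (h : IsBoundedCoef g m M) (f : UnitL2) :
    (inner ℂ f (h.mulOp f)).re = ∫ y in (0 : ℝ)..1, g y * ‖f y‖ ^ 2 := by
  rw [inner_mulOp, ← Complex.ofReal_re (∫ y in (0 : ℝ)..1, g y * ‖f y‖ ^ 2),
    ← intervalIntegral.integral_ofReal]
  congr 2
  ext y
  rw [mul_comm (starRingEnd ℂ _), Complex.mul_conj, Complex.normSq_eq_norm_sq]
  norm_cast

theorem selfAdjoint_mulOp (h : IsBoundedCoef g m M) : IsSelfAdjoint h.mulOp := by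
  rw [ContinuousLinearMap.isSelfAdjoint_iff_isSymmetric]
  intro f k
  simp only [ContinuousLinearMap.coe_coe]
  rw [← inner_conj_symm, inner_mulOp, inner_mulOp, intervalIntegral.integral_of_le zero_le_one,
    ← integral_conj, intervalIntegral.integral_of_le zero_le_one]
  congr 1
  ext y
  simp only [map_mul, Complex.conj_ofReal, Complex.conj_conj]
  ring

theorem integrable_mul_norm_sq (h : IsBoundedCoef g m M) (f : UnitL2) :
    Integrable (fun y => g y * ‖f y‖ ^ 2) unitMeasure := by
  refine ((Lp.memLp f).norm.integrable_sq).bdd_mul (c := M) h.aesm (h.mem_Icc.mono fun y hy => ?_)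
  rw [Real.norm_of_nonneg (h.pos.le.trans hy.1)]
  exact hy.2

theorem norm_sq_eq (f : UnitL2) : ‖f‖ ^ 2 = ∫ y, ‖f y‖ ^ 2 ∂unitMeasure := by
  rw [← inner_self_eq_norm_sq (𝕜 := ℂ), L2.inner_def, ← integral_re (L2.integrable_inner f f)]
  simp only [inner_self_eq_norm_sq]

theorem le_re_inner_mulOp (h : IsBoundedCoef g m M) (f : UnitL2) :
    m * ‖f‖ ^ 2 ≤ (inner ℂ f (h.mulOp f)).re := by
  rw [re_inner_mulOp, intervalIntegral.integral_of_le zero_le_one, norm_sq_eq,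
    ← integral_const_mul]
  refine integral_mono_ae (((Lp.memLp f).norm.integrable_sq).const_mul m)
    (h.integrable_mul_norm_sq f) (h.mem_Icc.mono fun y hy => ?_)
  exact mul_le_mul_of_nonneg_right hy.1 (sq_nonneg _)

theorem re_inner_mulOp_le (h : IsBoundedCoef g m M) (f : UnitL2) :
    (inner ℂ f (h.mulOp f)).re ≤ M * ‖f‖ ^ 2 := by
  rw [re_inner_mulOp, intervalIntegral.integral_of_le zero_le_one, norm_sq_eq,
    ← integral_const_mul]
  refine integral_mono_ae (h.integrable_mul_norm_sq f)
    (((Lp.memLp f).norm.integrable_sq).const_mul M) (h.mem_Icc.mono fun y hy => ?_)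
  exact mul_le_mul_of_nonneg_right hy.2 (sq_nonneg _)

theorem mulOp_sqrt_mulOp_sqrt (h : IsBoundedCoef g m M) (f : UnitL2) :
    h.sqrt.mulOp (h.sqrt.mulOp f) = h.mulOp f := by
  refine Lp.ext ?_
  filter_upwards [h.sqrt.coeFn_mulOp (h.sqrt.mulOp f), h.sqrt.coeFn_mulOp f, h.coeFn_mulOp f,
    h.mem_Icc] with y h1 h2 h3 h4
  rw [h1, h2, h3, ← mul_assoc, ← Complex.ofReal_mul, Real.mul_self_sqrt (h.pos.le.trans h4.1)]

theorem norm_mulOp_sqrt_sq (h : IsBoundedCoef g m M) (f : UnitL2) :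
    ‖h.sqrt.mulOp f‖ ^ 2 = (inner ℂ f (h.mulOp f)).re := by
  rw [← h.mulOp_sqrt_mulOp_sqrt, ← inner_self_eq_norm_sq (𝕜 := ℂ)]
  exact congrArg Complex.re (h.sqrt.selfAdjoint_mulOp.isSymmetric f _)

end IsBoundedCoef

/-! ### The pencil of the Floquet problem -/

/-- The derivative `1 + i β V` of the gauge transformed primitive, with `V = primOp`. -/
def gradOp (β : ℝ) : UnitL2 →L[ℂ] UnitL2 := 1 + (Complex.I * β) • primOp

theorem gradOp_apply (β : ℝ) (f : UnitL2) :
    gradOp β f = f + (Complex.I * β) • primOp f := rfl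

theorem adjoint_gradOp (β : ℝ) : ContinuousLinearMap.adjoint (gradOp β) = gradOp β := by
  rw [gradOp, map_add, map_smulₛₗ, adjoint_primOp, ContinuousLinearMap.one_def,
    ContinuousLinearMap.adjoint_id]
  simp

section

variable {ρ μ₁ μ₂ : ℝ → ℝ} {r R m₁ M₁ m₂ M₂ : ℝ} (hρ : IsBoundedCoef ρ r R)
  (h₁ : IsBoundedCoef μ₁ m₁ M₁) (h₂ : IsBoundedCoef μ₂ m₂ M₂) (β : ℝ)

open ContinuousLinearMap in
/-- The pencil of the operator `𝓐_K` with `β = K + π`. -/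
def floquetPencil : SpectralPencil UnitL2 where
  A := adjoint (gradOp β) ∘L h₁.mulOp ∘L gradOp β
  W := adjoint primOp ∘L h₂.mulOp ∘L primOp
  S := hρ.sqrt.mulOp ∘L primOp
  -- With `w = G w - iβ V w` one has `‖w‖² ≤ 2 ‖G w‖² + 2 β² ‖V w‖²`; the minimum bounds both terms
  -- by the forms with weights `μ₁` and `ρ`. The `1` in the denominator covers `β = 0`.
  δ := min m₁ (r / (1 + β ^ 2)) / 2
  lo := m₂ / R
  hi := M₂ / r
  selfAdjoint_A := h₁.selfAdjoint_mulOp.adjoint_conj (gradOp β)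
  selfAdjoint_W := h₂.selfAdjoint_mulOp.adjoint_conj primOp
  A_nonneg := fun w => by
    simp only [comp_apply, adjoint_inner_right]
    exact (mul_nonneg h₁.pos.le (sq_nonneg _)).trans (h₁.le_re_inner_mulOp _)
  δ_pos := half_pos (lt_min h₁.pos (div_pos hρ.pos (by positivity)))
  coercive := fun w => by
    simp only [comp_apply, adjoint_inner_right]
    rw [hρ.norm_mulOp_sqrt_sq]
    have e1 := h₁.le_re_inner_mulOp (gradOp β w)
    have e2 := hρ.le_re_inner_mulOp (primOp w)
    have e3 : ‖w‖ ≤ ‖gradOp β w‖ + |β| * ‖primOp w‖ := by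
      have : w = gradOp β w - (Complex.I * β) • primOp w := by
        rw [gradOp_apply, add_sub_cancel_right]
      calc ‖w‖ = ‖gradOp β w - (Complex.I * β) • primOp w‖ := by rw [← this]
        _ ≤ _ := norm_sub_le _ _
        _ = _ := by rw [norm_smul]; simp
    have e4 : ‖w‖ ^ 2 ≤ 2 * ‖gradOp β w‖ ^ 2 + 2 * (β ^ 2 * ‖primOp w‖ ^ 2) := by
      have h5 := pow_le_pow_left₀ (norm_nonneg w) e3 2
      have h6 := sq_nonneg (‖gradOp β w‖ - |β| * ‖primOp w‖)
      have h7 := sq_abs β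
      nlinarith
    set d := min m₁ (r / (1 + β ^ 2)) with hd
    have hd0 : 0 < d := lt_min h₁.pos (div_pos hρ.pos (by positivity))
    have d1 : d ≤ m₁ := min_le_left _ _
    have d2 : d * β ^ 2 ≤ r := by
      have h8 : d ≤ r / (1 + β ^ 2) := min_le_right _ _
      rw [le_div_iff₀ (by positivity)] at h8
      linarith
    have f1 := mul_le_mul_of_nonneg_left e4 (half_pos hd0).le
    have f2 := mul_le_mul_of_nonneg_right d1 (sq_nonneg ‖gradOp β w‖)
    have f3 := mul_le_mul_of_nonneg_right d2 (sq_nonneg ‖primOp w‖)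
    linarith
  S_injective := by
    refine Function.Injective.comp (g := hρ.sqrt.mulOp) ?_ primOp_injective
    rw [injective_iff_map_eq_zero]
    intro f hf
    have h5 := hρ.le_re_inner_mulOp f
    rw [← hρ.norm_mulOp_sqrt_sq, hf, norm_zero, zero_pow two_ne_zero] at h5
    have h6 : ‖f‖ ^ 2 ≤ 0 := nonpos_of_mul_nonpos_right h5 hρ.pos
    exact norm_eq_zero.1 (pow_eq_zero_iff two_ne_zero |>.1 (le_antisymm h6 (sq_nonneg _)))
  S_compact := isCompactOperator_primOp.clm_comp hρ.sqrt.mulOp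
  lo_pos := div_pos h₂.pos (hρ.pos.trans_le hρ.le)
  lo_le_hi := div_le_div₀ (h₂.pos.le.trans h₂.le) h₂.le hρ.pos hρ.le
  lo_le := fun w => by
    have hR : 0 < R := hρ.pos.trans_le hρ.le
    simp only [comp_apply, adjoint_inner_right]
    rw [hρ.norm_mulOp_sqrt_sq]
    refine le_trans ?_ (h₂.le_re_inner_mulOp (primOp w))
    refine (mul_le_mul_of_nonneg_left (hρ.re_inner_mulOp_le (primOp w))
      (div_pos h₂.pos hR).le).trans_eq ?_
    field_simp
  le_hi := fun w => by
    simp only [comp_apply, adjoint_inner_right]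
    rw [hρ.norm_mulOp_sqrt_sq]
    refine (h₂.re_inner_mulOp_le (primOp w)).trans ?_
    refine le_trans (le_of_eq ?_) (mul_le_mul_of_nonneg_left (hρ.le_re_inner_mulOp (primOp w))
      (div_pos (h₂.pos.trans_le h₂.le) hρ.pos).le)
    have := hρ.pos.ne'
    field_simp

/-- Since `V* = -V` and `G* = G`, the weak equation `G* q + κ V* μ₂ V f = ν V* ρ V f` with `q = μ₁ G
f` solves for `q` as a primitive. Thus `q` is antiperiodic and absolutely continuous, and
differentiating recovers the differential equation. -/
theorem mem_eig_floquetPencil {κ ν : ℝ} {f : UnitL2} :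
    f ∈ (floquetPencil hρ h₁ h₂ β).eig κ ν ↔ h₁.mulOp (gradOp β f) =
      primOp ((κ : ℂ) • h₂.mulOp (primOp f) - (ν : ℂ) • hρ.mulOp (primOp f) -
        (Complex.I * β) • h₁.mulOp (gradOp β f)) := by
  rw [SpectralPencil.mem_eig]
  have e1 : (floquetPencil hρ h₁ h₂ β).A f = gradOp β (h₁.mulOp (gradOp β f)) := by
    change ContinuousLinearMap.adjoint (gradOp β) _ = _
    rw [adjoint_gradOp]
    rfl
  have e2 : (floquetPencil hρ h₁ h₂ β).W f = -primOp (h₂.mulOp (primOp f)) := by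
    change ContinuousLinearMap.adjoint primOp _ = _
    rw [adjoint_primOp]
    rfl
  have e3 : ContinuousLinearMap.adjoint (floquetPencil hρ h₁ h₂ β).S
      ((floquetPencil hρ h₁ h₂ β).S f) = -primOp (hρ.mulOp (primOp f)) := by
    change ContinuousLinearMap.adjoint (hρ.sqrt.mulOp ∘L primOp) (hρ.sqrt.mulOp (primOp f)) = _
    rw [ContinuousLinearMap.adjoint_comp, ← ContinuousLinearMap.star_eq_adjoint hρ.sqrt.mulOp,
      hρ.sqrt.selfAdjoint_mulOp.star_eq, adjoint_primOp]
    change -primOp (hρ.sqrt.mulOp (hρ.sqrt.mulOp (primOp f))) = _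
    rw [hρ.mulOp_sqrt_mulOp_sqrt]
  rw [e1, e2, e3, gradOp_apply β (h₁.mulOp _), map_sub, map_sub, map_smul, map_smul, map_smul,
    ← sub_eq_zero, ← sub_eq_zero (a := h₁.mulOp _)]
  refine Eq.congr_left ?_
  module

theorem re_inner_W_floquetPencil (f : UnitL2) :
    (inner ℂ f ((floquetPencil hρ h₁ h₂ β).W f)).re =
      ∫ y in (0 : ℝ)..1, μ₂ y * ‖primOp f y‖ ^ 2 := by
  rw [← h₂.re_inner_mulOp]
  change (inner ℂ f (ContinuousLinearMap.adjoint primOp (h₂.mulOp (primOp f)))).re = _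
  rw [ContinuousLinearMap.adjoint_inner_right]

theorem norm_S_sq_floquetPencil (f : UnitL2) :
    ‖(floquetPencil hρ h₁ h₂ β).S f‖ ^ 2 = ∫ y in (0 : ℝ)..1, ρ y * ‖primOp f y‖ ^ 2 := by
  rw [← hρ.re_inner_mulOp]
  exact hρ.norm_mulOp_sqrt_sq (primOp f)

theorem inner_S_floquetPencil (f g : UnitL2) :
    inner ℂ ((floquetPencil hρ h₁ h₂ β).S f) ((floquetPencil hρ h₁ h₂ β).S g) =
      ∫ y in (0 : ℝ)..1, (ρ y : ℂ) * (starRingEnd ℂ (primOp f y) * primOp g y) := by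
  rw [← hρ.inner_mulOp, ← hρ.mulOp_sqrt_mulOp_sqrt]
  exact hρ.sqrt.selfAdjoint_mulOp.isSymmetric (primOp f) _

end

/-! ### Bounds and measurability of the coefficients -/

namespace FloquetSH

/-- Near each point the positive one-sided limits and the value at the point give positive bounds;
compactness of `[0,1]` makes them uniform. -/
theorem IsCoefficient.exists_bounds {f : ℝ → ℝ} (hf : IsCoefficient f) :
    ∃ m M, 0 < m ∧ ∀ y ∈ Icc (0 : ℝ) 1, f y ∈ Icc m M := by
  refine isCompact_Icc.induction_on (p := fun s => ∃ m M, 0 < m ∧ ∀ y ∈ s, f y ∈ Icc m M)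
    ⟨1, 1, one_pos, fun y hy => hy.elim⟩ ?_ ?_ fun y _ => ?_
  · rintro s t hst ⟨m, M, h1, h2⟩
    exact ⟨m, M, h1, fun y hy => h2 y (hst hy)⟩
  · rintro s t ⟨m, M, h1, h2⟩ ⟨m', M', h1', h2'⟩
    refine ⟨min m m', max M M', lt_min h1 h1', fun y hy => ?_⟩
    rcases hy with hy | hy
    · exact ⟨(min_le_left _ _).trans (h2 y hy).1, (h2 y hy).2.trans (le_max_left _ _)⟩
    · exact ⟨(min_le_right _ _).trans (h2' y hy).1, (h2' y hy).2.trans (le_max_right _ _)⟩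
  · obtain ⟨l, hl, h1⟩ := hf.left_lim y
    obtain ⟨l', hl', h2⟩ := hf.right_lim y
    set m := min (f y) (min (l / 2) (l' / 2))
    set M := max (f y) (max (l + 1) (l' + 1))
    have hm : 0 < m := lt_min (hf.pos y) (lt_min (by linarith) (by linarith))
    have e1 : ∀ᶠ z in 𝓝[<] y, f z ∈ Icc m M := by
      filter_upwards [h1.eventually (Icc_mem_nhds (show l / 2 < l by linarith)
        (show l < l + 1 by linarith))] with z hz
      exact ⟨((min_le_right _ _).trans (min_le_left _ _)).trans hz.1,
        hz.2.trans ((le_max_left _ _).trans (le_max_right _ _))⟩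
    have e2 : ∀ᶠ z in 𝓝[>] y, f z ∈ Icc m M := by
      filter_upwards [h2.eventually (Icc_mem_nhds (show l' / 2 < l' by linarith)
        (show l' < l' + 1 by linarith))] with z hz
      exact ⟨((min_le_right _ _).trans (min_le_right _ _)).trans hz.1,
        hz.2.trans ((le_max_right _ _).trans (le_max_right _ _))⟩
    have e3 : ∀ᶠ z in 𝓝 y, f z ∈ Icc m M := by
      rw [← nhdsLT_sup_nhdsGE, ← nhdsGT_sup_nhdsWithin_singleton, nhdsWithin_singleton]
      exact eventually_sup.2 ⟨e1, eventually_sup.2 ⟨e2, ⟨min_le_left _ _, le_max_left _ _⟩⟩⟩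
    exact ⟨_, mem_nhdsWithin_of_mem_nhds e3, m, M, hm, fun z hz => hz⟩

theorem IsCoefficient.aestronglyMeasurable {f : ℝ → ℝ} (hf : IsCoefficient f) :
    AEStronglyMeasurable f unitMeasure := by
  have h1 : unitMeasure = volume.restrict
      (Icc (0 : ℝ) 1 \ {y ∈ Icc (0 : ℝ) 1 | ¬ ContinuousAt f y}) := by
    rw [unitMeasure, restrict_Ioc_eq_restrict_Icc]
    exact (Measure.restrict_congr_set
      (sdiff_null_ae_eq_self (hf.finite_disc.measure_zero _))).symm
  rw [h1]
  refine ContinuousOn.aestronglyMeasurable (fun y hy => ContinuousAt.continuousWithinAt ?_)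
    (measurableSet_Icc.diff hf.finite_disc.measurableSet)
  by_contra hc
  exact hy.2 ⟨hy.1, hc⟩

theorem IsCoefficient.exists_isBoundedCoef {f : ℝ → ℝ} (hf : IsCoefficient f) :
    ∃ m M, IsBoundedCoef f m M := by
  obtain ⟨m, M, hm, h⟩ := hf.exists_bounds
  refine ⟨m, M, hf.aestronglyMeasurable, hm, ?_⟩
  filter_upwards [ae_restrict_mem measurableSet_Ioc] with y hy using h y ⟨hy.1.le, hy.2⟩

end FloquetSH

/-! ### Gauge transformation and eigenfunctions -/

/-- The gauge factor `e^{i β y}`. -/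
def phase (β y : ℝ) : ℂ := Complex.exp (Complex.I * β * y)

theorem norm_phase (β y : ℝ) : ‖phase β y‖ = 1 := by
  rw [phase, Complex.norm_exp]; simp

theorem phase_ne_zero (β y : ℝ) : phase β y ≠ 0 := Complex.exp_ne_zero _

theorem phase_neg_mul_phase (β y : ℝ) : phase (-β) y * phase β y = 1 := by
  rw [phase, phase, ← Complex.exp_add]; simp

theorem phase_zero (β : ℝ) : phase β 0 = 1 := by simp [phase]

/-- The shift by `π` produces the sign which turns quasi-periodicity with factor `e^{iK}` into
antiperiodicity. -/
theorem phase_one (K : ℝ) : phase (K + Real.pi) 1 = -Complex.exp (Complex.I * K) := by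
  rw [phase]
  push_cast
  rw [mul_one, mul_add, Complex.exp_add, mul_comm Complex.I (Real.pi : ℂ), Complex.exp_pi_mul_I]
  ring

theorem hasDerivAt_phase (β y : ℝ) :
    HasDerivAt (phase β) (Complex.I * β * phase β y) y := by
  have h1 : HasDerivAt (fun z : ℝ => Complex.I * β * (z : ℂ)) (Complex.I * β) y := by
    simpa using (Complex.ofRealCLM.hasDerivAt (x := y)).const_mul (Complex.I * (β : ℂ))
  refine h1.cexp.congr_deriv ?_
  rw [mul_comm]
  rfl

theorem hasDerivAt_phase_mul {g : ℝ → ℂ} {d : ℂ} {y : ℝ} (β : ℝ) (h : HasDerivAt g d y) :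
    HasDerivAt (fun y => phase β y * g y) (phase β y * (d + Complex.I * β * g y)) y := by
  refine ((hasDerivAt_phase β y).mul h).congr_deriv ?_
  ring

theorem AbsolutelyContinuousOnInterval.phase_mul {g : ℝ → ℂ} {a b : ℝ} (β : ℝ)
    (h : AbsolutelyContinuousOnInterval g a b) :
    AbsolutelyContinuousOnInterval (fun y => phase β y * g y) a b := by
  have h1 : ContDiff ℝ 1 (phase β) :=
    (contDiff_const.mul Complex.ofRealCLM.contDiff).cexp
  exact h1.contDiffOn.absolutelyContinuousOnInterval.smul h

/-- An absolutely continuous function with bounded derivative and opposite endpoint values is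
the primitive of an element of `L²(0,1)`. -/
theorem exists_unitL2_antiPrim {v d : ℝ → ℂ} (hv : AbsolutelyContinuousOnInterval v 0 1)
    (hd : ∀ᵐ x, x ∈ uIcc (0 : ℝ) 1 → HasDerivAt v (d x) x) (h1 : v 1 = -v 0) {C : ℝ}
    (hC : ∀ᵐ y ∂unitMeasure, ‖d y‖ ≤ C) :
    ∃ f : UnitL2, f =ᵐ[unitMeasure] d ∧ ∀ y ∈ Icc (0 : ℝ) 1, v y = antiPrim f y := by
  have hm : MemLp d 2 unitMeasure := by
    refine MemLp.of_bound ?_ C hC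
    have := (hv.intervalIntegrable_and_eq_add_integral hd).1
    rw [intervalIntegrable_iff_integrableOn_Ioc_of_le zero_le_one] at this
    exact this.aestronglyMeasurable
  refine ⟨hm.toLp, hm.coeFn_toLp, fun y hy => ?_⟩
  rw [antiPrim_congr hm.coeFn_toLp hy]
  exact eq_antiPrim hv hd h1 (by rwa [uIcc_of_le zero_le_one])

theorem coeFn_gradOp (β : ℝ) (f : UnitL2) :
    gradOp β f =ᵐ[unitMeasure] fun y => f y + Complex.I * β * antiPrim f y := by
  rw [gradOp_apply]
  filter_upwards [Lp.coeFn_add f ((Complex.I * (β : ℂ)) • primOp f),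
    Lp.coeFn_smul (Complex.I * (β : ℂ)) (primOp f), coeFn_primOp f] with y h1 h2 h3
  rw [h1, Pi.add_apply, h2, Pi.smul_apply, h3, smul_eq_mul]

theorem coeFn_smul_sub_smul_sub_smul (a b c : ℂ) (f g h : UnitL2) :
    (a • f - b • g - c • h : UnitL2) =ᵐ[unitMeasure] fun y => a * f y - b * g y - c * h y := by
  filter_upwards [Lp.coeFn_sub (a • f - b • g) (c • h), Lp.coeFn_sub (a • f) (b • g),
    Lp.coeFn_smul a f, Lp.coeFn_smul b g, Lp.coeFn_smul c h] with y h1 h2 h3 h4 h5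
  rw [h1, Pi.sub_apply, h2, Pi.sub_apply, h3, h4, h5]
  rfl

theorem antiPrim_zero {y : ℝ} (hy : y ∈ Icc (0 : ℝ) 1) : antiPrim (0 : UnitL2) y = 0 := by
  rw [antiPrim_congr (Lp.coeFn_zero ℂ 2 unitMeasure) hy]
  simp [antiPrim]

section

variable {ρ μ₁ μ₂ : ℝ → ℝ} {r R m₁ M₁ m₂ M₂ : ℝ} (hρ : IsBoundedCoef ρ r R)
  (h₁ : IsBoundedCoef μ₁ m₁ M₁) (h₂ : IsBoundedCoef μ₂ m₂ M₂) {K κ ν : ℝ}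

/-- The quasi-derivative is `e^{iβy} V h`, where `h` is the argument of `V` in the integrated
equation; its regularity and boundary condition come from `V`. -/
theorem isEigenfunction_of_mem_eig {f : UnitL2}
    (hf : f ∈ (floquetPencil hρ h₁ h₂ (K + Real.pi)).eig κ ν) (hf0 : f ≠ 0) {u : ℝ → ℂ}
    (hu : ∀ y ∈ Icc (0 : ℝ) 1, u y = phase (K + Real.pi) y * antiPrim f y) :
    FloquetSH.IsEigenfunction ρ μ₁ μ₂ K κ ν u := by
  set β := K + Real.pi with hβ
  rw [mem_eig_floquetPencil] at hf
  set q := h₁.mulOp (gradOp β f) with hq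
  set h := (κ : ℂ) • h₂.mulOp (primOp f) - (ν : ℂ) • hρ.mulOp (primOp f) -
    (Complex.I * β) • q with hh
  have hfi := UnitL2.intervalIntegrable f
  have hhi := UnitL2.intervalIntegrable h
  have hI : uIcc (0 : ℝ) 1 = Icc 0 1 := uIcc_of_le zero_le_one
  have hbc : ∀ g : ℝ → ℂ, phase β 1 * antiPrim g 1 =
      Complex.exp (Complex.I * K) * (phase β 0 * antiPrim g 0) := fun g => by
    rw [antiPrim_one, phase_one, phase_zero]; ring
  -- `u` is prescribed on `[0,1]` only, so its derivative can be computed at interior points alone.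
  have hIoo : ∀ᵐ y ∂unitMeasure, y ∈ Ioo (0 : ℝ) 1 := by
    rw [unitMeasure, ← restrict_Ioo_eq_restrict_Ioc]
    exact ae_restrict_mem measurableSet_Ioo
  have hqy : ∀ᵐ y ∂unitMeasure, antiPrim h y = μ₁ y * (f y + Complex.I * β * antiPrim f y) := by
    filter_upwards [coeFn_primOp h, h₁.coeFn_mulOp (gradOp β f), coeFn_gradOp β f]
      with y k1 k2 k3
    rw [← k1, ← hf, hq, k2, k3]
  refine ⟨?_, fun y => phase β y * antiPrim h y, ⟨⟨?_, ?_, ?_⟩, ?_, ?_⟩, ?_⟩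
  · by_contra! hz
    refine hf0 (eq_zero_of_antiPrim_eq_zero fun y hy => ?_)
    have := hz y (Ioo_subset_Icc_self hy)
    rw [hu y (Ioo_subset_Icc_self hy)] at this
    exact (mul_eq_zero.1 this).resolve_left (phase_ne_zero _ _)
  · refine ((absolutelyContinuousOnInterval_antiPrim hfi).phase_mul β).congr_of_eqOn fun y hy => ?_
    exact hu y (hI ▸ hy)
  · exact (absolutelyContinuousOnInterval_antiPrim hhi).phase_mul β
  · rw [← restrict_Ioc_eq_restrict_Icc]
    filter_upwards [hqy, hIoo, ae_unitMeasure_iff.2 (ae_hasDerivAt_antiPrim hfi)] with y k1 k2 k3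
    have hd : HasDerivAt u (phase β y * (f y + Complex.I * β * antiPrim f y)) y :=
      (hasDerivAt_phase_mul β k3).congr_of_eventuallyEq (by
        filter_upwards [Icc_mem_nhds k2.1 k2.2] with z hz using hu z hz)
    rw [hd.deriv, k1]
    ring
  · rw [hu 1 ⟨zero_le_one, le_rfl⟩, hu 0 ⟨le_rfl, zero_le_one⟩]
    exact hbc f
  · exact hbc h
  · rw [← restrict_Ioc_eq_restrict_Icc]
    filter_upwards [hqy, hIoo, ae_unitMeasure_iff.2 (ae_hasDerivAt_antiPrim hhi),
      coeFn_smul_sub_smul_sub_smul κ ν (Complex.I * β) (h₂.mulOp (primOp f))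
        (hρ.mulOp (primOp f)) q, h₂.coeFn_mulOp (primOp f), hρ.coeFn_mulOp (primOp f),
      coeFn_primOp f, coeFn_primOp h, hρ.mem_Icc] with y k1 k2 k3 k4 k5 k6 k7 k8 k9
    have hρ0 : (ρ y : ℂ) ≠ 0 := by exact_mod_cast (hρ.pos.trans_le k9.1).ne'
    rw [FloquetSH.opA, (hasDerivAt_phase_mul β k3).deriv, k4, k5, k6, k7, hf, k8,
      hu y (Ioo_subset_Icc_self k2)]
    field_simp
    ring

/-- The derivatives of `e^{-iβy} u` and `e^{-iβy} p` must be in `L²`. They are even bounded, since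
`u' = p / μ₁` and `p' = (κ μ₂ - ν ρ) u` almost everywhere. -/
theorem exists_mem_eig_of_isEigenfunction {u : ℝ → ℂ}
    (h : FloquetSH.IsEigenfunction ρ μ₁ μ₂ K κ ν u) :
    ∃ f ∈ (floquetPencil hρ h₁ h₂ (K + Real.pi)).eig κ ν, f ≠ 0 ∧
      ∀ y ∈ Icc (0 : ℝ) 1, u y = phase (K + Real.pi) y * antiPrim f y := by
  obtain ⟨⟨y₀, hy₀, hu0⟩, p, ⟨⟨hac, hacp, hqd⟩, hbu, hbp⟩, heq⟩ := h
  set β := K + Real.pi with hβ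
  rw [← restrict_Ioc_eq_restrict_Icc] at hqd heq
  have hI : uIcc (0 : ℝ) 1 = Icc 0 1 := uIcc_of_le zero_le_one
  have hinv : ∀ y (z : ℂ), phase β y * (phase (-β) y * z) = z := fun y z => by
    rw [← mul_assoc, mul_comm (phase β y), phase_neg_mul_phase, one_mul]
  have hbc : ∀ g : ℝ → ℂ, g 1 = Complex.exp (Complex.I * K) * g 0 →
      phase (-β) 1 * g 1 = -(phase (-β) 0 * g 0) := fun g hg => by
    have h2 := phase_neg_mul_phase β 1
    rw [phase_one] at h2
    rw [hg, phase_zero]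
    linear_combination -g 0 * h2
  have hdu := hac.ae_differentiableAt_complex
  have hdp := hacp.ae_differentiableAt_complex
  obtain ⟨Cu, hCu⟩ := hac.exists_bound
  obtain ⟨Cp, hCp⟩ := hacp.exists_bound
  have hmem : ∀ᵐ y ∂unitMeasure, y ∈ uIcc (0 : ℝ) 1 :=
    ae_unitMeasure_iff.2 (Eventually.of_forall fun y hy => hy)
  have hCp0 : 0 ≤ Cp := (norm_nonneg _).trans (hCp 0 left_mem_uIcc)
  have hCu0 : 0 ≤ Cu := (norm_nonneg _).trans (hCu 0 left_mem_uIcc)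
  have hdp_eq : ∀ᵐ y ∂unitMeasure, deriv p y = (κ * μ₂ y - ν * ρ y) * u y := by
    filter_upwards [heq, hρ.mem_Icc] with y k1 k2
    have hρ0 : (ρ y : ℂ) ≠ 0 := by exact_mod_cast (hρ.pos.trans_le k2.1).ne'
    rw [FloquetSH.opA] at k1
    field_simp at k1
    linear_combination -k1
  have hdu_le : ∀ᵐ y ∂unitMeasure, ‖deriv u y‖ ≤ Cp / m₁ := by
    filter_upwards [hqd, h₁.mem_Icc, hmem] with y k1 k2 k3
    rw [le_div_iff₀ h₁.pos]
    refine le_trans ?_ (hCp y k3)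
    rw [k1, norm_mul, Complex.norm_real, Real.norm_of_nonneg (h₁.pos.le.trans k2.1), mul_comm]
    exact mul_le_mul_of_nonneg_right k2.1 (norm_nonneg _)
  have hdp_le : ∀ᵐ y ∂unitMeasure, ‖deriv p y‖ ≤ (|κ| * M₂ + |ν| * R) * Cu := by
    filter_upwards [hdp_eq, h₂.mem_Icc, hρ.mem_Icc, hmem] with y k1 k2 k3 k4
    rw [k1, norm_mul]
    refine mul_le_mul ((norm_sub_le _ _).trans (add_le_add ?_ ?_)) (hCu y k4) (norm_nonneg _) ?_
    · rw [norm_mul, Complex.norm_real, Complex.norm_real,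
        Real.norm_of_nonneg (h₂.pos.le.trans k2.1), Real.norm_eq_abs]
      exact mul_le_mul_of_nonneg_left k2.2 (abs_nonneg _)
    · rw [norm_mul, Complex.norm_real, Complex.norm_real,
        Real.norm_of_nonneg (hρ.pos.le.trans k3.1), Real.norm_eq_abs]
      exact mul_le_mul_of_nonneg_left k3.2 (abs_nonneg _)
    · have := h₂.pos.le.trans h₂.le
      have := hρ.pos.le.trans hρ.le
      positivity
  have hbound : ∀ (g : ℝ → ℂ) (C C' : ℝ), (∀ᵐ y ∂unitMeasure, ‖deriv g y‖ ≤ C) →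
      (∀ y ∈ uIcc (0 : ℝ) 1, ‖g y‖ ≤ C') → ∀ᵐ y ∂unitMeasure,
        ‖phase (-β) y * (deriv g y + Complex.I * (-β : ℝ) * g y)‖ ≤ C + |β| * C' := by
    intro g C C' hg hg'
    filter_upwards [hg, hmem] with y k1 k2
    rw [norm_mul, norm_phase, one_mul]
    refine (norm_add_le _ _).trans (add_le_add k1 ?_)
    rw [norm_mul, norm_mul, Complex.norm_I, one_mul, Complex.norm_real, Real.norm_eq_abs, abs_neg]
    exact mul_le_mul_of_nonneg_left (hg' y k2) (abs_nonneg _)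
  obtain ⟨f, hfd, hfv⟩ := exists_unitL2_antiPrim (hac.phase_mul (-β))
    (hdu.mono fun y k hy => hasDerivAt_phase_mul (-β) (k hy).hasDerivAt) (hbc u hbu)
    (hbound u _ _ hdu_le hCu)
  obtain ⟨g, hgd, hgv⟩ := exists_unitL2_antiPrim (hacp.phase_mul (-β))
    (hdp.mono fun y k hy => hasDerivAt_phase_mul (-β) (k hy).hasDerivAt) (hbc p hbp)
    (hbound p _ _ hdp_le hCp)
  have huf : ∀ y ∈ Icc (0 : ℝ) 1, u y = phase β y * antiPrim f y := fun y hy => by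
    rw [← hfv y hy, hinv]
  have hq : h₁.mulOp (gradOp β f) = primOp g := by
    refine Lp.ext ?_
    filter_upwards [h₁.coeFn_mulOp (gradOp β f), coeFn_gradOp β f, coeFn_primOp g, hfd, hqd, hmem]
      with y k1 k2 k3 k4 k5 k6
    rw [hI] at k6
    rw [k1, k2, k3, k4, ← hfv y k6, ← hgv y k6, k5]
    push_cast
    ring
  refine ⟨f, (mem_eig_floquetPencil hρ h₁ h₂ β).2 ?_, ?_, huf⟩
  · rw [hq]
    congr 1
    refine Lp.ext ?_
    filter_upwards [coeFn_smul_sub_smul_sub_smul κ ν (Complex.I * β) (h₂.mulOp (primOp f))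
        (hρ.mulOp (primOp f)) (primOp g), h₂.coeFn_mulOp (primOp f), hρ.coeFn_mulOp (primOp f),
      coeFn_primOp f, coeFn_primOp g, hgd, hdp_eq, hmem] with y k1 k2 k3 k4 k5 k6 k7 k8
    rw [hI] at k8
    rw [k1, k2, k3, k4, k5, k6, k7, ← hfv y k8, ← hgv y k8]
    push_cast
    ring
  · rintro rfl
    exact hu0 (by rw [huf y₀ hy₀, antiPrim_zero hy₀, mul_zero])

end

/-- Otherwise the injective primitive would be surjective and reach the constant `1`, whose endpoint
values are not opposite. -/
theorem not_finiteDimensional_unitL2 : ¬ FiniteDimensional ℂ UnitL2 := by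
  intro hfin
  obtain ⟨f, hf⟩ := (LinearMap.injective_iff_surjective (f := (primOp : UnitL2 →ₗ[ℂ] UnitL2))).1
    primOp_injective (Lp.const 2 unitMeasure (1 : ℂ))
  have h1 : antiPrim f =ᵐ[volume.restrict (Icc (0 : ℝ) 1)] fun _ => 1 := by
    rw [← restrict_Ioc_eq_restrict_Icc]
    have h2 := coeFn_primOp f
    rw [show primOp f = _ from hf] at h2
    exact h2.symm.trans (Lp.coeFn_const (p := 2) (μ := unitMeasure) (1 : ℂ))
  have hc := (absolutelyContinuousOnInterval_antiPrim
    (UnitL2.intervalIntegrable f)).continuousOn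
  rw [uIcc_of_le zero_le_one] at hc
  have h3 := Measure.eqOn_Icc_of_ae_eq volume zero_ne_one h1 hc continuousOn_const
  have h4 := antiPrim_one f
  rw [h3 ⟨zero_le_one, le_rfl⟩, h3 ⟨le_rfl, zero_le_one⟩] at h4
  norm_num at h4

/-! ### Transfer of the spectrum from the pencil to the Floquet operator -/

/-- The map from the pencil to functions on `[0,1]`. -/
def realize (β : ℝ) : UnitL2 →ₗ[ℂ] (Icc (0 : ℝ) 1 → ℂ) where
  toFun f := fun y => phase β y * inner ℂ (antiKernel y) f
  map_add' f g := by ext y; simp [inner_add_right, mul_add]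
  map_smul' c f := by ext y; simp [inner_smul_right]; ring

theorem realize_apply (β : ℝ) (f : UnitL2) (y : Icc (0 : ℝ) 1) :
    realize β f y = phase β y * antiPrim f y := by
  rw [← inner_antiKernel]; rfl

theorem realize_injective (β : ℝ) : Function.Injective (realize β) := by
  rw [injective_iff_map_eq_zero]
  intro f hf
  refine eq_zero_of_antiPrim_eq_zero fun y hy => ?_
  have h1 := congrFun hf ⟨y, Ioo_subset_Icc_self hy⟩
  rw [realize_apply] at h1
  exact (mul_eq_zero.1 h1).resolve_left (phase_ne_zero _ _)

section

variable {ρ μ₁ μ₂ : ℝ → ℝ} {r R m₁ M₁ m₂ M₂ : ℝ} (hρ : IsBoundedCoef ρ r R)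
  (h₁ : IsBoundedCoef μ₁ m₁ M₁) (h₂ : IsBoundedCoef μ₂ m₂ M₂) (K : ℝ)

/-- Up to the zero function, the eigenfunctions restricted to `[0,1]` already form a subspace, so
taking the span adds nothing else. -/
theorem eigenspace_eq_map (κ ν : ℝ) : FloquetSH.eigenspace ρ μ₁ μ₂ K κ ν =
    ((floquetPencil hρ h₁ h₂ (K + Real.pi)).eig κ ν).map (realize (K + Real.pi)) := by
  refine le_antisymm (Submodule.span_le.2 ?_) ?_
  · rintro _ ⟨u, hu, rfl⟩
    obtain ⟨f, hf, -, huf⟩ := exists_mem_eig_of_isEigenfunction hρ h₁ h₂ hu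
    refine ⟨f, hf, funext fun y => ?_⟩
    rw [realize_apply, ← huf y y.2]
    rfl
  · rintro _ ⟨f, hf, rfl⟩
    rcases eq_or_ne f 0 with rfl | hf0
    · rw [map_zero]; exact Submodule.zero_mem _
    · refine Submodule.subset_span ⟨fun y => phase (K + Real.pi) y * antiPrim f y,
        isEigenfunction_of_mem_eig hρ h₁ h₂ hf hf0 fun y _ => rfl, funext fun y => ?_⟩
      rw [realize_apply]
      rfl

theorem spectralSubspace_eq_map (κ x : ℝ) : FloquetSH.spectralSubspace ρ μ₁ μ₂ K κ x =
    (partialSup ((floquetPencil hρ h₁ h₂ (K + Real.pi)).eig κ) x).map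
      (realize (K + Real.pi)) := by
  rw [partialSup, Submodule.map_iSup, FloquetSH.spectralSubspace]
  simp_rw [Submodule.map_iSup, eigenspace_eq_map hρ h₁ h₂]

theorem eigenvalue_eq_ev (n : ℕ) :
    FloquetSH.eigenvalue ρ μ₁ μ₂ K n = (floquetPencil hρ h₁ h₂ (K + Real.pi)).ev n := by
  ext κ
  rw [FloquetSH.eigenvalue, SpectralPencil.ev, sortedEigenvalue]
  congr 1
  ext x
  rw [Set.mem_ofPred_eq, Set.mem_ofPred_eq, spectralSubspace_eq_map hρ h₁ h₂,
    ← (Submodule.equivMapOfInjective _ (realize_injective (K + Real.pi)) _).rank_eq]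

theorem finrank_eigenspace (κ ν : ℝ) : Module.finrank ℂ (FloquetSH.eigenspace ρ μ₁ μ₂ K κ ν) =
    Module.finrank ℂ ((floquetPencil hρ h₁ h₂ (K + Real.pi)).eig κ ν) := by
  rw [eigenspace_eq_map hρ h₁ h₂]
  exact (Submodule.equivMapOfInjective _ (realize_injective (K + Real.pi)) _).finrank_eq.symm

variable {f : UnitL2} {u : ℝ → ℂ} {β : ℝ}

theorem integral_mul_norm_sq_eq (g : ℝ → ℝ)
    (hu : ∀ y ∈ Icc (0 : ℝ) 1, u y = phase β y * antiPrim f y) :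
    ∫ y in (0 : ℝ)..1, g y * ‖u y‖ ^ 2 = ∫ y in (0 : ℝ)..1, g y * ‖primOp f y‖ ^ 2 := by
  refine intervalIntegral.integral_congr_ae ?_
  filter_upwards [ae_unitMeasure_iff.1 (coeFn_primOp f)] with y hy hm
  have hm' := uIoc_subset_uIcc hm
  rw [hy hm', hu y (by rwa [uIcc_of_le zero_le_one] at hm'), norm_mul, norm_phase, one_mul]

/-- The gauge factor has modulus one and drops out of both integrals. -/
theorem slope_eq_rayleigh (hu : ∀ y ∈ Icc (0 : ℝ) 1, u y = phase β y * antiPrim f y) :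
    FloquetSH.slope ρ μ₂ u = (floquetPencil hρ h₁ h₂ β).rayleigh f := by
  rw [FloquetSH.slope, SpectralPencil.rayleigh, re_inner_W_floquetPencil, norm_S_sq_floquetPencil,
    integral_mul_norm_sq_eq μ₂ hu, integral_mul_norm_sq_eq ρ hu]

/-- The inner product conjugates its first argument while `FloquetSH.Orthogonal` conjugates the
second; hence the order `g`, `f` in the hypothesis. -/
theorem orthogonal_of_inner_eq_zero {g : UnitL2} {v : ℝ → ℂ}
    (hu : ∀ y ∈ Icc (0 : ℝ) 1, u y = phase β y * antiPrim f y)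
    (hv : ∀ y ∈ Icc (0 : ℝ) 1, v y = phase β y * antiPrim g y)
    (h : inner ℂ ((floquetPencil hρ h₁ h₂ β).S g) ((floquetPencil hρ h₁ h₂ β).S f) = 0) :
    FloquetSH.Orthogonal ρ u v := by
  rw [inner_S_floquetPencil] at h
  rw [FloquetSH.Orthogonal, ← h]
  refine intervalIntegral.integral_congr_ae ?_
  filter_upwards [ae_unitMeasure_iff.1 (coeFn_primOp f), ae_unitMeasure_iff.1 (coeFn_primOp g)]
    with y h3 h4 hm
  have hm' := uIoc_subset_uIcc hm
  have hm2 : y ∈ Icc (0 : ℝ) 1 := by rwa [uIcc_of_le zero_le_one] at hm'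
  have h5 : phase β y * starRingEnd ℂ (phase β y) = 1 := by
    rw [Complex.mul_conj, Complex.normSq_eq_norm_sq, norm_phase]; simp
  rw [h3 hm', h4 hm', hu y hm2, hv y hm2, map_mul]
  linear_combination (ρ y : ℂ) * antiPrim f y * starRingEnd ℂ (antiPrim g y) * h5

end

/-! ### Conclusion -/

theorem strictMonoOn_sqrt_comp_sq {E : ℝ → ℝ} (h : StrictMono E) (h0 : ∀ κ, 0 ≤ κ → 0 ≤ E κ) :
    StrictMonoOn (fun k : ℝ => √(E (k ^ 2))) (Ioi 0) := fun a ha _ _ hab =>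
  Real.sqrt_lt_sqrt (h0 _ (sq_nonneg a)) (h (pow_lt_pow_left₀ hab (le_of_lt ha) two_ne_zero))

theorem mainTheorem3 (ρ μ₁ μ₂ : ℝ → ℝ)
    (hρ : FloquetSH.IsCoefficient ρ) (hμ₁ : FloquetSH.IsCoefficient μ₁)
    (hμ₂ : FloquetSH.IsCoefficient μ₂) (K : ℝ) :
    -- every branch `ω_n`, numbered in increasing order, is strictly increasing for `k > 0`
    (∀ n : ℕ, StrictMonoOn (FloquetSH.omega ρ μ₁ μ₂ K n) (Set.Ioi 0)) ∧
    -- its slope, wherever `ω_n²` is a simple eigenvalue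
    (∀ n : ℕ, ∀ κ : ℝ, 0 ≤ κ →
      Module.finrank ℂ (FloquetSH.eigenspace ρ μ₁ μ₂ K κ
        (FloquetSH.eigenvalue ρ μ₁ μ₂ K n κ)) = 1 →
      ∀ u : ℝ → ℂ,
        FloquetSH.IsEigenfunction ρ μ₁ μ₂ K κ (FloquetSH.eigenvalue ρ μ₁ μ₂ K n κ) u →
        HasDerivAt (FloquetSH.eigenvalue ρ μ₁ μ₂ K n) (FloquetSH.slope ρ μ₂ u) κ) ∧
    -- the spectrum consists of analytic branches, for which the slope formula holds at every
    -- `k² ≥ 0`, also where two of them meet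
    (∃ (Λ : ℕ → ℝ → ℝ) (U : ℕ → ℝ → ℝ → ℂ),
      (∀ n : ℕ, AnalyticOnNhd ℝ (Λ n) (Set.Ici 0)) ∧
      (∀ κ : ℝ, 0 ≤ κ → ∃ σ : Equiv.Perm ℕ, ∀ n : ℕ,
        Λ n κ = FloquetSH.eigenvalue ρ μ₁ μ₂ K (σ n) κ) ∧
      (∀ n : ℕ, ∀ κ : ℝ, 0 ≤ κ →
        FloquetSH.IsEigenfunction ρ μ₁ μ₂ K κ (Λ n κ) (U n κ)) ∧
      (∀ m n : ℕ, m ≠ n → ∀ κ : ℝ, 0 ≤ κ → FloquetSH.Orthogonal ρ (U m κ) (U n κ)) ∧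
      (∀ n : ℕ, ∀ κ : ℝ, 0 ≤ κ → HasDerivAt (Λ n) (FloquetSH.slope ρ μ₂ (U n κ)) κ) ∧
      (∀ n : ℕ, StrictMonoOn (fun k : ℝ => Real.sqrt (Λ n (k ^ 2))) (Set.Ioi 0))) := by
  obtain ⟨r, R, hr⟩ := hρ.exists_isBoundedCoef
  obtain ⟨m₁, M₁, h₁⟩ := hμ₁.exists_isBoundedCoef
  obtain ⟨m₂, M₂, h₂⟩ := hμ₂.exists_isBoundedCoef
  have hinf := not_finiteDimensional_unitL2
  set P := floquetPencil hr h₁ h₂ (K + Real.pi) with hP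
  have hev : ∀ n, FloquetSH.eigenvalue ρ μ₁ μ₂ K n = P.ev n := eigenvalue_eq_ev hr h₁ h₂ K
  refine ⟨fun n => ?_, fun n κ _ hsimple u hu => ?_, ?_⟩
  · have : FloquetSH.omega ρ μ₁ μ₂ K n = fun k => √(P.ev n (k ^ 2)) := by
      ext k; rw [FloquetSH.omega, hev]
    rw [this]
    exact strictMonoOn_sqrt_comp_sq (SpectralPencil.ev_strictMono hinf n)
      fun κ hκ => SpectralPencil.ev_nonneg hinf n hκ
  · obtain ⟨f, hf, hf0, huf⟩ := exists_mem_eig_of_isEigenfunction hr h₁ h₂ hu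
    rw [finrank_eigenspace hr h₁ h₂] at hsimple
    rw [hev] at hsimple hf ⊢
    rw [slope_eq_rayleigh hr h₁ h₂ huf]
    exact SpectralPencil.hasDerivAt_ev hinf hsimple hf hf0
  · obtain ⟨Λ, hΛ, hw⟩ := SpectralPencil.exists_analytic_branches (P := P) hinf
    choose σ w hval hmem hne horth hderiv using hw
    refine ⟨Λ, fun n κ y => phase (K + Real.pi) y * antiPrim (w κ n) y,
      fun n => (hΛ n).mono (subset_univ _), fun κ _ => ⟨σ κ, fun n => ?_⟩, fun n κ _ => ?_,
      fun m n hmn κ _ => ?_, fun n κ _ => ?_, fun n => ?_⟩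
    · rw [hev, hval]
    · exact isEigenfunction_of_mem_eig hr h₁ h₂ (hmem κ n) (hne κ n) fun y _ => rfl
    · exact orthogonal_of_inner_eq_zero hr h₁ h₂ (fun y _ => rfl) (fun y _ => rfl)
        (horth κ n m hmn.symm)
    · rw [slope_eq_rayleigh hr h₁ h₂ (fun y _ => rfl)]
      exact hderiv κ n
    -- The slope of an analytic branch is a Rayleigh quotient, bounded below by `lo > 0` on the
    -- whole line; nonnegativity for `κ ≥ 0` comes from the ordered eigenvalues.
    · refine strictMonoOn_sqrt_comp_sq (strictMono_of_deriv_pos fun κ => ?_) fun κ hκ => ?_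
      · rw [(hderiv κ n).deriv]
        exact P.lo_pos.trans_le (P.rayleigh_mem_Icc (hne κ n)).1
      · rw [hval]
        exact SpectralPencil.ev_nonneg hinf _ hκ
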